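/- **Setting.** Let $d\ge 1$, let $\mathfrak L^-$ be a finite set (of noise types) and $\mathfrak s\in[1,\infty)^d$. Write $|\mathbf n|=\sum_i\mathfrak s_i\mathbf n(i)$ for $\mathbf n\in\mathbb N_0^d$, $|x|=\sum_i|x_i|^{1/\mathfrak s_i}$ for $x\in\mathbb R^d$, $|\mathfrak s|=\sum_i\mathfrak s_i$. For a set $I$ let $M(I)$ be the set of finitely supported maps $I\to\mathbb N_0$, with length $\ell(m)=\sum_i m(i)$ and unit vectors $e_i$. Let $\eta>0$, and for $\mathfrak l\in\mathfrak L^-\cup\{0\}$ let $\alpha_{\mathfrak l}$ and $\mathrm{reg}(\mathfrak l)<\alpha_{\mathfrak l}$ be reals with $\alpha_0=0$ and $\alpha_{\mathfrak l}<0$ for $\mathfrak l\in\mathfrak L^-$. Let $r\in\mathbb R$ (the expected regularity of the solution) satisfy $r\le\min_i\mathfrak s_i$ and $r<\eta+\mathrm{reg}(\mathfrak l)$ for all $\mathfrak l\in\mathfrak L^-\cup\{0\}$. *Multi-indices.* The coordinates are $z_{(\mathfrak l,k)}$, $(\mathfrak l,k)\in(\mathfrak L^-\cup\{0\})\times M(\mathbb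 N_0^d)$, and $z_{\mathbf n}$, $\mathbf n\in\mathbb N_0^d$; $\beta,\gamma$ denote multi-indices over the coordinates. A pair $(\mathfrak l,k)$ is subcritical if $r<\eta+\mathrm{reg}(\mathfrak l)$ and, for all $0<k'\le k$ and $\sigma(k')=\sum_{\mathbf n}(r-|\mathbf n|)k'(\mathbf n)$, $r<\eta+\sigma(k')$ and $r<\eta+\mathrm{reg}(\mathfrak l)+\sigma(k')$; $\beta$ is subcritical if $\beta(\mathfrak l,k)\ne0$ only for subcritical $(\mathfrak l,k)$. Set $[\beta]=\sum_{(\mathfrak l,k)}(1-\ell(k))\beta(\mathfrak l,k)+\sum_{\mathbf n}\beta(\mathbf n)$, $\langle\beta\rangle=\sum_{\mathfrak l\in\mathfrak L^-}\sum_k\beta(\mathfrak l,k)$, and $$|\beta|=\sum_{(\mathfrak l,k)}\Big(\alpha_{\mathfrak l}+\sum_{\mathbf n}(\eta-|\mathbf n|)k(\mathbf n)\Big)\beta(\mathfrak l,k)+\sum_{\mathbf n}(|\mathbf n|-\eta)\beta(\mathbf n).$$ Let $\mathcal N_-$ be the set of subcritical $\beta$ with $[\beta]=1$ and $\beta(\mathbf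 n)=0$ whenever $|\mathbf n|<r$; $\mathcal N=\{\beta\in\mathcal N_-:\langle\beta\rangle>0\}$; $\mathcal P=\{e_{\mathbf n}\}$; $T=\mathcal P\cup\mathcal N$; $\mathcal C=\{\beta\in\mathcal N:|\beta|<0,\ \langle\beta\rangle\ge2\}$. An admissible counterterm is $c=\sum_{\beta\in\mathcal C}c_\beta z^\beta$ with real $c_\beta$. *Group.* Let $D^{(\mathbf n)}=\sum_{(\mathfrak l,k):(\mathfrak l,k+e_{\mathbf n})\text{ subcritical}}(k(\mathbf n)+1)z_{(\mathfrak l,k+e_{\mathbf n})}\partial_{z_{(\mathfrak l,k)}}+\partial_{z_{\mathbf n}}$ and $\boldsymbol\partial_i=\sum_{\mathbf n}(\mathbf n(i)+1)z_{\mathbf n+e_i}D^{(\mathbf n)}$, which are derivations. For $\mathcal M\subset\mathcal N\times\mathbb N_0^d$, $J\in M(\mathcal M)$ and $\mathbf m\in\mathbb N_0^d$ put $$\mathsf D_{(J,\mathbf m)}=\frac1{J!\,\mathbf m!}\prod_{(\gamma,\mathbf n)}(z^\gamma)^{J(\gamma,\mathbf n)}\ \boldsymbol\partial^{\mathbf m}\prod_{(\gamma,\mathbf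 n)}(D^{(\mathbf n)})^{J(\gamma,\mathbf n)}$$ (rightmost operators act first), with matrix entries $\mathsf D_{(J,\mathbf m)}z^\gamma=\sum_\beta(\mathsf D_{(J,\mathbf m)})^\gamma_\beta z^\beta$. A character $\mathbf f$ of the free commutative real algebra on generators $Z_{(\gamma,\mathbf n)}$, $(\gamma,\mathbf n)\in\mathcal M$, and $Z_1,\dots,Z_d$ defines a matrix $\Gamma^*_{\mathbf f}$ indexed by $\beta,\gamma\in T\cup\mathcal N_-$ through $$(\Gamma^*_{\mathbf f})^\gamma_\beta=\sum_{(J,\mathbf m)}\mathbf f(Z^{(J,\mathbf m)})(\mathsf D_{(J,\mathbf m)})^\gamma_\beta,$$ acting on formal series $\pi=\sum_\gamma\pi_\gamma z^\gamma$ by $(\Gamma_{\mathbf f}^*\pi)_\beta=\sum_\gamma(\Gamma_{\mathbf f}^*)_\beta^\gamma\pi_\gamma$. Let $\mathcal M^-=\{(\gamma,\mathbf n):\gamma\in\mathcal N,|\mathbf n|<\eta\}$ and $\mathcal M^+=\{(\gamma,\mathbf n):\gamma\in\mathcal N,|\mathbf n|<\eta+|\gamma|\}$. The structure group $G$ consists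 of the maps $\Gamma$ whose duals $\Gamma^*$ are the $\Gamma^*_{\boldsymbol\pi}$ with $\boldsymbol\pi$ a character for $\mathcal M^+$. Given smooth functions $\Pi_{x\gamma}$, let $\boldsymbol\Pi_x$ be the (point-dependent) character for $\mathcal M^-$ with $Z_{(\gamma,\mathbf n)}\mapsto\frac1{\mathbf n!}\partial^{\mathbf n}\Pi_{x\gamma}$ and $Z_i\mapsto(\cdot-x)_i$. *Kernel and noises.* Let $K=\bar K\chi$, where $\bar K:\mathbb R^d\setminus\{0\}\to\mathbb R$ is smooth with $\bar K(\lambda^{\mathfrak s_1}x_1,\dots,\lambda^{\mathfrak s_d}x_d)=\lambda^{\eta-|\mathfrak s|}\bar K(x)$ for all $\lambda>0$, $x\neq0$, and $\chi\in C_c^\infty(\mathbb R^d)$ is supported in $\{|x|\le1\}$. Let $\xi_{\mathfrak l}\in C^\infty(\mathbb R^d)$ for $\mathfrak l\in\mathfrak L^-$, and $\xi_0=1$. **Theorem.** For $\mathcal M=\mathcal M^\pm$ and every $\beta\in T\cup\mathcal N_-$ there are only finitely many $(\gamma,(J,\mathbf m))$ with $\gamma\in T\cup\mathcal N_-$ and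 $(\mathsf D_{(J,\mathbf m)})^\gamma_\beta\ne0$, so the sums above are finite. For every admissible counterterm $c$ there exist smooth functions $\Pi_{x\beta}:\mathbb R^d\to\mathbb R$ ($x\in\mathbb R^d$, $\beta\in T$; set $\Pi_{x\beta}=0$ for $\beta\notin T$) and $\Gamma_{xy}\in G$ ($x,y\in\mathbb R^d$) such that: 1. $\Pi_{xe_{\mathbf n}}=(\cdot-x)^{\mathbf n}$ for all $\mathbf n\in\mathbb N_0^d$. 2. The functions $\Pi^-_{x\beta}:=\big(\Gamma^*_{\boldsymbol\Pi_x}\big(\sum_{\mathfrak l\in\mathfrak L^-\cup\{0\}}\xi_{\mathfrak l}z_{(\mathfrak l,0)}+c\big)\big)_\beta$, $\beta\in\mathcal N_-$, are smooth, and for every $\beta\in\mathcal N$ the convolution $K*\Pi^-_{x\beta}$ exists everywhere and $\Pi_{x\beta}-K*\Pi^-_{x\beta}$ is a polynomial of scaled degree $<|\beta|+\eta$. 3. $\Pi_x=\Gamma^*_{xy}\Pi_y$ and $\Gamma^*_{xy}=\Gamma^*_{xz}\Gamma^*_{zy}$ for all $x,y,z\in\mathbb R^d$. 4. For every compact $B\subset\mathbb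 R^d$, uniformly over $x\in B$ and $|y-x|\le1$: $|\Pi^-_{x\beta}(y)|\lesssim|y-x|^{|\beta|}$ for $\beta\in\mathcal N_-$; $|\Pi_{x\beta}(y)|\lesssim|y-x|^{|\beta|+\eta}$ for $\beta\in T$; and $|(\Gamma^*_{xy})^\gamma_\beta|\lesssim|y-x|^{|\beta|-|\gamma|}$ for $\beta,\gamma\in T\cup\mathcal N_-$. (For a negative exponent the bound is void at $y=x$; the constants may depend on $\beta,\gamma,B$ and all the data.) -/

import Mathlib

open scoped ContDiff

noncomputable section

namespace MultiIndexModel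

/-- Space-time multi-indices `𝐧 ∈ ℕ₀^d`. -/
abbrev NIdx (d : ℕ) := Fin d →₀ ℕ

/-- The index set of the coordinates: `Sum.inl (𝔩, k)` with `𝔩 ∈ 𝔏⁻ ∪ {0}` (`none` is `𝔩 = 0`) and
`k ∈ M(ℕ₀^d)` is the index of `z_(𝔩,k)`, and `Sum.inr 𝐧` is the index of `z_𝐧`. -/
abbrev Coord (d : ℕ) (L : Type*) := (Option L × (NIdx d →₀ ℕ)) ⊕ NIdx d

/-- Multi-indices over the coordinates. -/
abbrev MIdx (d : ℕ) (L : Type*) := Coord d L →₀ ℕ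

/-- Polynomials in the coordinates. -/
abbrev ZPoly (d : ℕ) (L : Type*) := MvPolynomial (Coord d L) ℝ

/-- The numerical data: the scaling `𝔰`, the regularization exponent `η`, the homogeneities
`α_𝔩` of the noises, the auxiliary regularities `reg 𝔩` of the noises, and the auxiliary
regularity `regsol` of the solution. -/
structure Setting (d : ℕ) (L : Type*) where
  s : Fin d → ℝ
  eta : ℝ
  alpha : Option L → ℝ
  reg : Option L → ℝ
  regsol : ℝ

/-- `e_(𝔩,k)`. -/
def eNoise {d : ℕ} {L : Type*} (l : Option L) (k : NIdx d →₀ ℕ) : MIdx d L :=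
  Finsupp.single (Sum.inl (l, k)) 1

/-- `e_𝐧`. -/
def ePoly {d : ℕ} (L : Type*) (n : NIdx d) : MIdx d L :=
  Finsupp.single (Sum.inr n) 1

/-- `∂_i f`. -/
def partialDeriv {d : ℕ} (i : Fin d) (f : (Fin d → ℝ) → ℝ) : (Fin d → ℝ) → ℝ :=
  fun y => fderiv ℝ f y (Pi.single i 1)

/-- `∂^𝐧 f`. -/
def multiDeriv {d : ℕ} (n : NIdx d) (f : (Fin d → ℝ) → ℝ) : (Fin d → ℝ) → ℝ :=
  (List.finRange d).foldr (fun i g => (partialDeriv i)^[n i] g) f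

/-- `𝐧!`. -/
def nFactorial {d : ℕ} (n : NIdx d) : ℝ := ∏ i, ((n i).factorial : ℝ)

/-- The bracket `[β] = ∑ (1 - length k) β(𝔩,k) + ∑ β(𝐧)`. -/
def bracket {d : ℕ} {L : Type*} (β : MIdx d L) : ℤ :=
  β.sum fun c b =>
    match c with
    | Sum.inl (_, k) => (1 - (k.degree : ℤ)) * (b : ℤ)
    | Sum.inr _ => (b : ℤ)

/-- The noise homogeneity: the number of factors `z_(𝔩,k)` of `z^β` with `𝔩 ≠ 0`. -/
def noiseHom {d : ℕ} {L : Type*} (β : MIdx d L) : ℕ :=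
  β.sum fun c b =>
    match c with
    | Sum.inl (some _, _) => b
    | Sum.inl (none, _) => 0
    | Sum.inr _ => 0

namespace Setting

variable {d : ℕ} {L : Type*} (S : Setting d L)

/-- The scaled degree `|𝐧| = ∑ 𝔰_i 𝐧(i)`. -/
def deg (n : NIdx d) : ℝ := ∑ i, S.s i * (n i : ℝ)

/-- The scaled length `|x| = ∑ |x_i|^(1/𝔰_i)`; the scaled distance is `|y - x|`. -/
def size (x : Fin d → ℝ) : ℝ := ∑ i, |x i| ^ (1 / S.s i)

/-- The rescaling `x ↦ (λ^𝔰_i x_i)_i`. -/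
def rescale (r : ℝ) (x : Fin d → ℝ) : Fin d → ℝ := fun i => r ^ S.s i * x i

/-- `∑_𝐧 (regsol - |𝐧|) k(𝐧)`. -/
def regSum (k : NIdx d →₀ ℕ) : ℝ := k.sum fun n a => (S.regsol - S.deg n) * (a : ℝ)

/-- Subcriticality of the pair `(𝔩, k)`. The minimum over `0 < k' ≤ k` is spelled out, so that
the minimum over the empty set (for `k = 0`) is `+∞`. -/
def Subcritical (l : Option L) (k : NIdx d →₀ ℕ) : Prop :=
  S.regsol < S.eta + S.reg l ∧
    ∀ k' : NIdx d →₀ ℕ, 0 < k' → k' ≤ k →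
      S.regsol < S.eta + S.regSum k' ∧ S.regsol < S.eta + (S.reg l + S.regSum k')

/-- The assumptions on the numerical data. -/
structure Standing : Prop where
  one_le_s : ∀ i, 1 ≤ S.s i
  eta_pos : 0 < S.eta
  alpha_zero : S.alpha none = 0
  alpha_neg : ∀ l : L, S.alpha (some l) < 0
  reg_lt : ∀ l, S.reg l < S.alpha l
  subcritical_zero : ∀ l, S.Subcritical l 0
  regsol_le : ∀ i, S.regsol ≤ S.s i

/-- The homogeneity
`|β| = ∑ (α_𝔩 + ∑_𝐧 (η - |𝐧|) k(𝐧)) β(𝔩,k) + ∑ (|𝐧| - η) β(𝐧)`. -/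
def hom (β : MIdx d L) : ℝ :=
  β.sum fun c b =>
    match c with
    | Sum.inl (l, k) =>
        (S.alpha l + k.sum fun n a => (S.eta - S.deg n) * (a : ℝ)) * (b : ℝ)
    | Sum.inr n => (S.deg n - S.eta) * (b : ℝ)

/-- The index set of `Π⁻`. -/
def setNminus : Set (MIdx d L) :=
  {β | bracket β = 1 ∧ (∀ l k, β (Sum.inl (l, k)) ≠ 0 → S.Subcritical l k) ∧
    ∀ n, S.deg n < S.regsol → β (Sum.inr n) = 0}

/-- The non-polynomial populated multi-indices. -/
def setN : Set (MIdx d L) := {β | β ∈ S.setNminus ∧ 0 < noiseHom β}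

/-- The populated multi-indices. -/
def populated : Set (MIdx d L) := Set.range (ePoly L) ∪ S.setN

/-- The union of the index sets of `Π` and of `Π⁻`. -/
def allIdx : Set (MIdx d L) := S.populated ∪ S.setNminus

/-- The index set of the admissible counterterms. -/
def setC : Set (MIdx d L) := {β | β ∈ S.setN ∧ S.hom β < 0 ∧ 2 ≤ noiseHom β}

/-- The index set `𝓜⁻ = {(γ,𝐧) : γ ∈ 𝓝, |𝐧| < η}`. -/
def setMminus : Set (MIdx d L × NIdx d) := {p | p.1 ∈ S.setN ∧ S.deg p.2 < S.eta}

/-- The index set `𝓜⁺ = {(γ,𝐧) : γ ∈ 𝓝, |𝐧| < η + |γ|}`. -/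
def setMplus : Set (MIdx d L × NIdx d) :=
  {p | p.1 ∈ S.setN ∧ S.deg p.2 < S.eta + S.hom p.1}

open Classical in
/-- The derivation `D^(𝐧) = ∑ (k(𝐧)+1) z_(𝔩,k+e_𝐧) ∂_{z_(𝔩,k)} + ∂_{z_𝐧}`, where the sum is over
the `(𝔩,k)` such that `(𝔩,k+e_𝐧)` is subcritical. -/
def D (n : NIdx d) : Derivation ℝ (ZPoly d L) (ZPoly d L) :=
  MvPolynomial.mkDerivation ℝ fun c =>
    match c with
    | Sum.inl (l, k) =>
        if S.Subcritical l (k + Finsupp.single n 1) then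
          ((k n : ℝ) + 1) • MvPolynomial.X (Sum.inl (l, k + Finsupp.single n 1))
        else 0
    | Sum.inr m => if m = n then 1 else 0

/-- The derivation `∑_𝐧 (𝐧(i)+1) z_{𝐧+e_i} D^(𝐧)`. On every generator the sum is finite. -/
def bpartial (i : Fin d) : Derivation ℝ (ZPoly d L) (ZPoly d L) :=
  MvPolynomial.mkDerivation ℝ fun c =>
    ∑ᶠ n : NIdx d,
      ((n i : ℝ) + 1) •
        (MvPolynomial.X (Sum.inr (n + Finsupp.single i 1)) * S.D n (MvPolynomial.X c))

/-- `∏_i ∂_i^{𝐦(i)}` for the derivations `∂_i` above. -/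
def bpartialPow (m : NIdx d) : Module.End ℝ (ZPoly d L) :=
  ((List.finRange d).map fun i => (S.bpartial i : ZPoly d L →ₗ[ℝ] ZPoly d L) ^ m i).prod

theorem Subcritical.anti {S : Setting d L} {l : Option L} {k k' : NIdx d →₀ ℕ} (h : k' ≤ k)
    (hk : S.Subcritical l k) : S.Subcritical l k' :=
  ⟨hk.1, fun j hj hjk => hk.2 j hj (hjk.trans h)⟩

open Classical in
theorem D_X_inr (n m : NIdx d) :
    S.D n (MvPolynomial.X (Sum.inr m)) = MvPolynomial.C (if m = n then 1 else 0) := by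
  rw [D, MvPolynomial.mkDerivation_X]
  dsimp only
  split_ifs <;> simp

open Classical in
theorem D_X_inl (n : NIdx d) (l : Option L) (k : NIdx d →₀ ℕ) :
    S.D n (MvPolynomial.X (Sum.inl (l, k))) =
      if S.Subcritical l (k + Finsupp.single n 1) then
        ((k n : ℝ) + 1) • MvPolynomial.X (Sum.inl (l, k + Finsupp.single n 1))
      else 0 := by
  rw [D, MvPolynomial.mkDerivation_X]

theorem D_D_X_inl (n m : NIdx d) (l : Option L) (k : NIdx d →₀ ℕ) :
    S.D n (S.D m (MvPolynomial.X (Sum.inl (l, k)))) =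
      S.D m (S.D n (MvPolynomial.X (Sum.inl (l, k)))) := by
  classical
  by_cases hnm : n = m
  · rw [hnm]
  have key : ∀ a b : NIdx d, a ≠ b →
      S.D a (S.D b (MvPolynomial.X (Sum.inl (l, k)))) =
        if S.Subcritical l (k + Finsupp.single a 1 + Finsupp.single b 1) then
          (((k a : ℝ) + 1) * ((k b : ℝ) + 1)) •
            (MvPolynomial.X (Sum.inl (l, k + Finsupp.single a 1 + Finsupp.single b 1)) :
              ZPoly d L)
        else 0 := by
    intro a b hab
    have e : k + Finsupp.single b 1 + Finsupp.single a 1 =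
        k + Finsupp.single a 1 + Finsupp.single b 1 := by
      rw [add_assoc, add_assoc, add_comm (Finsupp.single b 1)]
    rw [D_X_inl]
    by_cases h2 : S.Subcritical l (k + Finsupp.single a 1 + Finsupp.single b 1)
    · have h1 : S.Subcritical l (k + Finsupp.single b 1) :=
        h2.anti (by rw [← e]; exact le_self_add)
      rw [if_pos h1, if_pos h2, Derivation.map_smul, D_X_inl, e, if_pos h2, smul_smul]
      have hb : (k + Finsupp.single b 1 : NIdx d →₀ ℕ) a = k a := by
        simp [hab]
      rw [hb, mul_comm]
    · rw [if_neg h2]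
      split_ifs with h1
      · rw [Derivation.map_smul, D_X_inl, e, if_neg h2, smul_zero]
      · simp
  rw [key n m hnm, key m n (Ne.symm hnm)]
  have e : k + Finsupp.single m 1 + Finsupp.single n 1 =
      k + Finsupp.single n 1 + Finsupp.single m 1 := by
    rw [add_assoc, add_assoc, add_comm (Finsupp.single m 1)]
  rw [e, mul_comm]

theorem D_commute (n m : NIdx d) :
    Commute (S.D n : ZPoly d L →ₗ[ℝ] ZPoly d L) (S.D m : ZPoly d L →ₗ[ℝ] ZPoly d L) := by
  have h : ⁅S.D n, S.D m⁆ = 0 := by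
    apply MvPolynomial.derivation_ext
    rintro (⟨l, k⟩ | j)
    · rw [Derivation.commutator_apply, D_D_X_inl]
      simp
    · rw [Derivation.commutator_apply, D_X_inr, D_X_inr, ← MvPolynomial.algebraMap_eq,
        Derivation.map_algebraMap, Derivation.map_algebraMap]
      simp
  refine LinearMap.ext fun p => ?_
  have := congrArg (fun E : Derivation ℝ (ZPoly d L) (ZPoly d L) => E p) h
  simp only [Derivation.commutator_apply, Derivation.coe_zero, Pi.zero_apply] at this
  exact sub_eq_zero.mp this

/-- The endomorphism
`(1 / (J! 𝐦!)) ∏ (z^γ)^J(γ,𝐧) ∂^𝐦 ∏ (D^(𝐧))^J(γ,𝐧)`, with rightmost factors acting first. -/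
def opD {M : Set (MIdx d L × NIdx d)} (J : M →₀ ℕ) (m : NIdx d) : Module.End ℝ (ZPoly d L) :=
  ((J.prod fun _ a => (a.factorial : ℝ)) * nFactorial m)⁻¹ •
    (LinearMap.mulLeft ℝ (MvPolynomial.monomial (J.sum fun p a => a • p.1.1) (1 : ℝ)) *
      S.bpartialPow m *
      J.support.noncommProd (fun p => (S.D p.1.2 : ZPoly d L →ₗ[ℝ] ZPoly d L) ^ J p)
        (fun p _ q _ _ => (S.D_commute p.1.2 q.1.2).pow_pow (J p) (J q)))

/-- The matrix coefficient of `opD J m` in row `β` and column `γ`: the coefficient of `z^β` in the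
image of `z^γ`. -/
def coefD {M : Set (MIdx d L × NIdx d)} (J : M →₀ ℕ) (m : NIdx d) (β γ : MIdx d L) : ℝ :=
  MvPolynomial.coeff β (S.opD J m (MvPolynomial.monomial γ 1))

/-- Finiteness of the rows of the action: each row `β` meets only finitely many `(γ,(J,𝐦))`. -/
def FiniteRows (M : Set (MIdx d L × NIdx d)) : Prop :=
  ∀ β ∈ S.allIdx,
    {q : MIdx d L × ((M →₀ ℕ) × NIdx d) |
      q.1 ∈ S.allIdx ∧ S.coefD q.2.1 q.2.2 β q.1 ≠ 0}.Finite

open Classical in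
/-- The matrix of `Γ_𝐟^* = ∑_(J,𝐦) 𝐟(Z^(J,𝐦)) D_(J,𝐦)` for a character `𝐟` of the free commutative
algebra over `M ⊔ {1,…,d}`. -/
def gammaStar {M : Set (MIdx d L × NIdx d)} (f : MvPolynomial (M ⊕ Fin d) ℝ →ₐ[ℝ] ℝ)
    (β γ : MIdx d L) : ℝ :=
  if β ∈ S.allIdx ∧ γ ∈ S.allIdx then
    ∑ᶠ q : (M →₀ ℕ) × NIdx d,
      f (MvPolynomial.monomial (Finsupp.sumElim q.1 q.2) 1) * S.coefD q.1 q.2 β γ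
  else 0

/-- The structure group, through the matrices of the dual maps `Γ^*`. -/
def structureGroup : Set (MIdx d L → MIdx d L → ℝ) :=
  {Γ | ∃ π : MvPolynomial (S.setMplus ⊕ Fin d) ℝ →ₐ[ℝ] ℝ, Γ = S.gammaStar π}

/-- The character of the algebra over `𝓜⁻ ⊔ {1,…,d}` given at the point `y` by
`(1/𝐧!) ∂^𝐧 Π_{xγ}(y)` and `(y - x)_i`; `P` is the family `(Π_{xγ})_γ`. -/
def modelChar (P : MIdx d L → (Fin d → ℝ) → ℝ) (x y : Fin d → ℝ) :
    MvPolynomial (S.setMminus ⊕ Fin d) ℝ →ₐ[ℝ] ℝ :=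
  MvPolynomial.aeval
    (Sum.elim (fun p => (nFactorial p.1.2)⁻¹ * multiDeriv p.1.2 (P p.1.1) y)
      (fun i => y i - x i))

/-- The noises including `ξ_0 = 1`. -/
def noise (ξ : L → (Fin d → ℝ) → ℝ) (l : Option L) (y : Fin d → ℝ) : ℝ :=
  match l with
  | some l => ξ l y
  | none => 1

open Classical in
/-- The coefficients of `∑_𝔩 ξ_𝔩(y) z_(𝔩,0) + c`. -/
def rhsCoef [Fintype L] (ξ : L → (Fin d → ℝ) → ℝ) (c : MIdx d L → ℝ) (y : Fin d → ℝ)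
    (γ : MIdx d L) : ℝ :=
  (∑ l : Option L, if γ = eNoise l 0 then noise ξ l y else 0) + c γ

/-- `Π⁻_{xβ}(y)`, the `β`-component of `Γ_{Π_x}^*(∑_𝔩 ξ_𝔩 z_(𝔩,0) + c)` at `y`. -/
def modelMinus [Fintype L] (ξ : L → (Fin d → ℝ) → ℝ) (c : MIdx d L → ℝ)
    (P : MIdx d L → (Fin d → ℝ) → ℝ) (x : Fin d → ℝ) (β : MIdx d L) (y : Fin d → ℝ) : ℝ :=
  ∑ᶠ γ : MIdx d L, S.gammaStar (S.modelChar P x y) β γ * rhsCoef ξ c y γ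

/-- `c` is an admissible counterterm. -/
def Admissible (c : MIdx d L → ℝ) : Prop := ∀ β, c β ≠ 0 → β ∈ S.setC

/-- The kernel assumption: `K = K̄ χ` with `K̄` smooth away from the origin and homogeneous of degree
`η - |𝔰|` under the scaling, and `χ` a smooth cutoff supported in the unit ball. -/
def IsKernel (K : (Fin d → ℝ) → ℝ) : Prop :=
  ∃ Kbar χ : (Fin d → ℝ) → ℝ,
    ContDiffOn ℝ ∞ Kbar {0}ᶜ ∧
    (∀ r : ℝ, 0 < r → ∀ x : Fin d → ℝ, x ≠ 0 →
      Kbar (S.rescale r x) = r ^ (S.eta - ∑ i, S.s i) * Kbar x) ∧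
    ContDiff ℝ ∞ χ ∧ HasCompactSupport χ ∧ (∀ x, χ x ≠ 0 → S.size x ≤ 1) ∧
    ∀ x, K x = Kbar x * χ x

/-- `|F(x,y)| ≲ |y-x|^κ` for `|y-x| ≤ 1`, locally uniformly in `x`. For `κ < 0` the right-hand side
is `+∞` at `y = x`, so nothing is required there. -/
def LocalBound (κ : ℝ) (F : (Fin d → ℝ) → (Fin d → ℝ) → ℝ) : Prop :=
  ∀ B : Set (Fin d → ℝ), IsCompact B → ∃ C : ℝ, ∀ x ∈ B, ∀ y, S.size (y - x) ≤ 1 →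
    (y ≠ x ∨ 0 ≤ κ) → |F x y| ≤ C * S.size (y - x) ^ κ

end Setting

/-- The convolution `K * h` on `ℝ^d`. -/
def conv {d : ℕ} (K h : (Fin d → ℝ) → ℝ) : (Fin d → ℝ) → ℝ :=
  MeasureTheory.convolution K h (ContinuousLinearMap.mul ℝ ℝ) MeasureTheory.volume

end MultiIndexModel

end

open MultiIndexModel

/-!
The model is built by induction over the multi-indices.

The algebraic core is that every map `Γ^*` is a substitution of power series. If `u_𝐧` denotes the
image of `z_𝐧` (the jet of the map, `jetOf`), then `z_(𝔩,k)` is sent to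
`∑ (k'! / k!) z_(𝔩,k') ∏ (u_𝐧 - z_𝐧)^(k'-k)(𝐧) / (k'-k)(𝐧)!`, summed over `k' = k` and the
subcritical `k' ≥ k` (`Setting.jetImage`, `Setting.jetSubst`). This is proved by computing the
generating function of the operators `opD` over the free algebra of generators: both sides satisfy
the same differential equations in the generators (`Setting.coeff_genericJet`,
`Setting.gammaStar_eq`). Finiteness of the rows is the statement that the coefficients of the
generating function are polynomials, finitely many of which are nonzero in each row, and the
substitutions compose as `Φ_u ∘ Φ_v = Φ_{Φ_u v}` (`Setting.jetSubst_jetSubst`), which is the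
multinomial theorem for divided powers. Moreover, apart from the polynomial coordinates, the matrix
is strictly triangular in the jet with respect to the degree of the multi-indices
(`coeff_jetMonomial_congr`). All the gradings, the homogeneity bounds and the smoothness of the
coefficients are multiplicative filtrations, which a substitution preserves as soon as its jet does
(`Filtration.level_jetMonomial`).

The functions `Π_{xβ}` are then constructed by recursion over the degree of `β`: for `β ∈ 𝓝`, the
function `Π_{xβ}` is `K * Π⁻_{xβ}` minus its Taylor polynomial at `x` of degree below `|β| + η`
(`exists_isModel`). The kernel is integrable with compact support, so the convolution preserves
joint smoothness in the base point and the argument, and since all smooth functions are qualitative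
here, the bound on `Π_{xβ}` is Taylor's theorem (`Setting.localBound_of_multiDeriv_eq_zero`) while
that on `Π⁻_{xβ}` follows from the filtration by homogeneity.

The characters of `Γ_{xy}` are fixed by a second recursion, which matches the derivatives at `y` of
`Π_{xβ}` and of `Γ^*_{xy} Π_y` in orders below `|β| + η` (`exists_isRecentering`). By induction on
the degree, `Π⁻` is recentered by `Γ^*_{xy}` (`IsModel.minus_of_recentering`), hence `Π_{xβ}` and
`(Γ^*_{xy} Π_y)_β` differ by a polynomial of degree below `|β| + η`, whose derivatives at `y` vanish
by the choice of the character (`IsModel.recentering_step`). Finally a jet which recenters `Π_y` to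
`Π_x` is unique (`IsModel.eq_of_recentering`), which yields the composition rule.
-/

noncomputable section

namespace MultiIndexModel

/-! ### Divided powers -/

section DividedPowers

variable {ι B B' : Type*} [CommRing B] [Algebra ℝ B] [CommRing B'] [Algebra ℝ B']

/-- The divided power `∏ₙ wₙ ^ K(n) / K(n)!`. -/
def dp (w : ι → B) (K : ι →₀ ℕ) : B :=
  K.prod fun n a => ((a.factorial : ℝ)⁻¹) • w n ^ a

@[simp] theorem dp_zero (w : ι → B) : dp w 0 = 1 := by simp [dp]

theorem dp_eq_prod (w : ι → B) (K : ι →₀ ℕ) {s : Finset ι} (h : K.support ⊆ s) :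
    dp w K = ∏ n ∈ s, (((K n).factorial : ℝ)⁻¹) • w n ^ K n := by
  rw [dp, Finsupp.prod_of_support_subset K h]
  simp

theorem dp_add_single (w : ι → B) (K : ι →₀ ℕ) (n : ι) :
    ((K n : ℝ) + 1) • dp w (K + Finsupp.single n 1) = w n * dp w K := by
  classical
  have h1 : K.support ⊆ insert n K.support := Finset.subset_insert _ _
  have h2 : (K + Finsupp.single n 1).support ⊆ insert n K.support := by
    intro j hj
    by_cases h : j = n
    · simp [h]
    · have : K j ≠ 0 := by simpa [Ne.symm h, h] using hj
      simp [this]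
  have hn : n ∈ insert n K.support := Finset.mem_insert_self _ _
  rw [dp_eq_prod w _ h1, dp_eq_prod w _ h2, ← Finset.mul_prod_erase _ _ hn,
    ← Finset.mul_prod_erase _ _ hn]
  have e : ∏ x ∈ (insert n K.support).erase n,
      ((((K + Finsupp.single n 1 : ι →₀ ℕ) x).factorial : ℝ)⁻¹) •
        w x ^ (K + Finsupp.single n 1 : ι →₀ ℕ) x =
      ∏ x ∈ (insert n K.support).erase n, (((K x).factorial : ℝ)⁻¹) • w x ^ K x := by
    refine Finset.prod_congr rfl fun x hx => ?_
    have : x ≠ n := Finset.ne_of_mem_erase hx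
    simp [this]
  rw [e, ← smul_mul_assoc, ← mul_assoc]
  congr 1
  have hf : ((K n : ℝ) + 1) ≠ 0 := by positivity
  have hf' : ((K n).factorial : ℝ) ≠ 0 := by positivity
  simp only [Finsupp.add_apply, Finsupp.single_eq_same, Nat.factorial_succ, Nat.cast_mul,
    Nat.cast_add, Nat.cast_one, smul_smul, mul_smul_comm, pow_succ']
  congr 1
  field_simp

/-- The induction step over multi-indices: a nonzero `K` is the successor of one of smaller degree.
-/
theorem exists_eq_add_single (K : ι →₀ ℕ) (hK : K ≠ 0) :
    ∃ (K' : ι →₀ ℕ) (n : ι), K = K' + Finsupp.single n 1 ∧ K'.degree < K.degree := by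
  obtain ⟨n, hn⟩ := Finsupp.ne_iff.mp hK
  have hle : Finsupp.single n 1 ≤ K := by
    rw [Finsupp.single_le_iff]
    exact Nat.one_le_iff_ne_zero.mpr hn
  refine ⟨K - Finsupp.single n 1, n, (tsub_add_cancel_of_le hle).symm, ?_⟩
  conv_rhs => rw [← tsub_add_cancel_of_le hle]
  simp [map_add]

/-- The multinomial theorem for divided powers. -/
theorem dp_add (w w' : ι → B) (K : ι →₀ ℕ) [DecidableEq ι] :
    dp (w + w') K = ∑ p ∈ Finset.HasAntidiagonal.antidiagonal K, dp w p.1 * dp w' p.2 := by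
  have aux : ∀ (v v' : ι → B) (K : ι →₀ ℕ) (n : ι),
      ∑ p ∈ Finset.HasAntidiagonal.antidiagonal (K + Finsupp.single n 1),
          (((p : (ι →₀ ℕ) × (ι →₀ ℕ)).1 n : ℝ) • dp v p.1) * dp v' p.2 =
        v n * ∑ p ∈ Finset.HasAntidiagonal.antidiagonal K, dp v p.1 * dp v' p.2 := by
    intro v v' K n
    rw [Finset.mul_sum]
    symm
    refine Finset.sum_of_injOn (fun p => (p.1 + Finsupp.single n 1, p.2)) ?_ ?_ ?_ ?_
    · rintro ⟨a, b⟩ _ ⟨a', b'⟩ _ h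
      simpa using h
    · rintro ⟨a, b⟩ h
      simp only [Finset.mem_coe, Finset.HasAntidiagonal.mem_antidiagonal] at h ⊢
      rw [← h]; abel
    · rintro ⟨a, b⟩ h h'
      have ha : a n = 0 := by
        by_contra hne
        have hle : Finsupp.single n 1 ≤ a := by
          rw [Finsupp.single_le_iff]
          exact Nat.one_le_iff_ne_zero.mpr hne
        apply h'
        refine ⟨(a - Finsupp.single n 1, b), ?_, ?_⟩
        · simp only [Finset.mem_coe, Finset.HasAntidiagonal.mem_antidiagonal] at h ⊢
          have : a - Finsupp.single n 1 + Finsupp.single n 1 + b = K + Finsupp.single n 1 := by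
            rw [tsub_add_cancel_of_le hle, h]
          rw [add_right_comm] at this
          exact add_right_cancel this
        · simp [tsub_add_cancel_of_le hle]
      simp [ha]
    · rintro ⟨a, b⟩ _
      have := dp_add_single v a n
      simp only [Finsupp.add_apply, Finsupp.single_eq_same, Nat.cast_add, Nat.cast_one]
      rw [this, mul_assoc]
  induction h : K.degree using Nat.strong_induction_on generalizing K with
  | _ N ih =>
    by_cases hK : K = 0
    · simp [hK]
    obtain ⟨K', n, rfl, hd⟩ := exists_eq_add_single K hK
    have e1 := dp_add_single (w + w') K' n
    rw [ih _ (h ▸ hd) K' rfl] at e1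
    have hne : ((K' n : ℝ) + 1) ≠ 0 := by positivity
    have e2 : ((K' n : ℝ) + 1) •
        ∑ p ∈ Finset.HasAntidiagonal.antidiagonal (K' + Finsupp.single n 1), dp w p.1 * dp w' p.2 =
        (w + w') n * ∑ p ∈ Finset.HasAntidiagonal.antidiagonal K', dp w p.1 * dp w' p.2 := by
      have a1 := aux w w' K' n
      have a2 := aux w' w K' n
      rw [Pi.add_apply, add_mul, ← a1, Finset.smul_sum]
      have a3 : w' n * ∑ p ∈ Finset.HasAntidiagonal.antidiagonal K', dp w p.1 * dp w' p.2 =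
          ∑ p ∈ Finset.HasAntidiagonal.antidiagonal (K' + Finsupp.single n 1),
            dp w p.1 * ((p.2 n : ℝ) • dp w' p.2) := by
        have b1 := Finsupp.sum_antidiagonal_swap K' fun a b => dp w' a * dp w b
        have b2 := Finsupp.sum_antidiagonal_swap (K' + Finsupp.single n 1)
          fun a b => ((a n : ℝ) • dp w' a) * dp w b
        simp only [mul_comm (dp w _)]
        rw [← b1, ← a2, b2]
      rw [a3, ← Finset.sum_add_distrib]
      refine Finset.sum_congr rfl fun p hp => ?_
      rw [Finset.HasAntidiagonal.mem_antidiagonal] at hp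
      have : (K' n : ℝ) + 1 = (p.1 n : ℝ) + p.2 n := by
        have := congrArg (fun f : ι →₀ ℕ => f n) hp
        simp only [Finsupp.add_apply, Finsupp.single_eq_same] at this
        exact_mod_cast this.symm
      rw [this, add_smul, smul_mul_assoc, mul_smul_comm]
    exact smul_right_injective _ hne (e1.trans e2.symm)

theorem map_dp (f : B →ₐ[ℝ] B') (w : ι → B) (K : ι →₀ ℕ) :
    f (dp w K) = dp (fun n => f (w n)) K := by
  simp [dp, Finsupp.prod, map_prod]

theorem dp_zero_fun [DecidableEq ι] (K : ι →₀ ℕ) : dp (0 : ι → B) K = if K = 0 then 1 else 0 := by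
  split_ifs with h
  · simp [h]
  · obtain ⟨n, hn⟩ := Finsupp.ne_iff.mp h
    refine Finset.prod_eq_zero (Finsupp.mem_support_iff.mpr hn) ?_
    simp [zero_pow hn]

theorem derivation_prod {ι B : Type*} [CommRing B] [Algebra ℝ B] [DecidableEq ι]
    (δ : Derivation ℝ B B) (s : Finset ι) (g : ι → B) :
    δ (∏ n ∈ s, g n) = ∑ n ∈ s, (∏ j ∈ s.erase n, g j) * δ (g n) := by
  induction s using Finset.induction_on with
  | empty => simp
  | insert a s ha ih =>
    rw [Finset.prod_insert ha, Derivation.leibniz, ih, Finset.sum_insert ha,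
      Finset.erase_insert ha, add_comm]
    congr 1
    rw [smul_eq_mul, Finset.mul_sum]
    refine Finset.sum_congr rfl fun n hn => ?_
    have hne : a ≠ n := fun h => ha (h ▸ hn)
    rw [Finset.erase_insert_of_ne hne,
      Finset.prod_insert (fun h => ha (Finset.mem_of_mem_erase h)), mul_assoc]

theorem derivation_dp (δ : Derivation ℝ B B) (w : ι → B) (K : ι →₀ ℕ) :
    δ (dp w K) = ∑ n ∈ K.support, δ (w n) * dp w (K - Finsupp.single n 1) := by
  classical
  rw [dp, Finsupp.prod, derivation_prod]
  refine Finset.sum_congr rfl fun n hn => ?_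
  have hs : (K - Finsupp.single n 1).support ⊆ K.support := by
    intro j hj
    simp only [Finsupp.mem_support_iff, Finsupp.tsub_apply] at hj ⊢
    omega
  obtain ⟨a, ha⟩ : ∃ a, K n = a + 1 :=
    Nat.exists_eq_succ_of_ne_zero (Finsupp.mem_support_iff.mp hn)
  rw [dp_eq_prod w _ hs, ← Finset.mul_prod_erase _ _ hn, Derivation.map_smul,
    Derivation.leibniz_pow, ha]
  have e : ∏ x ∈ K.support.erase n, ((((K - Finsupp.single n 1 : ι →₀ ℕ) x).factorial : ℝ)⁻¹) •
        w x ^ (K - Finsupp.single n 1 : ι →₀ ℕ) x =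
      ∏ x ∈ K.support.erase n, (((K x).factorial : ℝ)⁻¹) • w x ^ K x := by
    refine Finset.prod_congr rfl fun x hx => ?_
    have : x ≠ n := Finset.ne_of_mem_erase hx
    simp [this]
  rw [e]
  have hf : ((a : ℝ) + 1) ≠ 0 := by positivity
  have hf' : (a.factorial : ℝ) ≠ 0 := by positivity
  simp only [Finsupp.tsub_apply, Finsupp.single_eq_same, ha, Nat.add_sub_cancel, smul_eq_mul]
  have e3 : (((a + 1).factorial : ℝ)⁻¹) • (a + 1) • (w n ^ a * δ (w n)) =
      ((a.factorial : ℝ)⁻¹) • (w n ^ a * δ (w n)) := by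
    rw [← Nat.cast_smul_eq_nsmul ℝ, smul_smul, Nat.factorial_succ]
    congr 1
    push_cast
    field_simp
  rw [e3]
  simp only [mul_smul_comm, smul_mul_assoc]
  congr 1
  ring

end DividedPowers

/-! ### Power series in the coordinates -/

/-- Formal power series in the coordinates `z_(𝔩,k)`, `z_𝐧` with coefficients in `A`. -/
abbrev ZSeries (d : ℕ) (L : Type*) (A : Type*) := MvPowerSeries (Coord d L) A

section Series

variable {d : ℕ} {L A A' : Type*} [CommRing A] [Algebra ℝ A] [CommRing A'] [Algebra ℝ A']

theorem coeff_real_smul (r : ℝ) (f : ZSeries d L A) (β : MIdx d L) :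
    MvPowerSeries.coeff β (r • f) = r • MvPowerSeries.coeff β f := rfl

/-- The coefficientwise extension of a derivation of the coefficient ring. -/
def liftDer (δ : Derivation ℝ A A) : Derivation ℝ (ZSeries d L A) (ZSeries d L A) :=
  Derivation.mk'
    { toFun := fun f β => δ (MvPowerSeries.coeff β f)
      map_add' := fun f g => by
        funext β
        simp only [map_add]
        rfl
      map_smul' := fun r f => by
        funext β
        rw [coeff_real_smul, Derivation.map_smul]
        rfl }
    (fun f g => by
      classical
      ext β
      change δ (MvPowerSeries.coeff β (f * g)) = _
      rw [MvPowerSeries.coeff_mul, map_sum, smul_eq_mul, smul_eq_mul, map_add,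
        MvPowerSeries.coeff_mul, mul_comm g, MvPowerSeries.coeff_mul, ← Finset.sum_add_distrib]
      refine Finset.sum_congr rfl fun p _ => ?_
      rw [Derivation.leibniz, smul_eq_mul, smul_eq_mul, mul_comm (MvPowerSeries.coeff p.2 g)]
      rfl)

@[simp] theorem coeff_liftDer (δ : Derivation ℝ A A) (f : ZSeries d L A) (β : MIdx d L) :
    MvPowerSeries.coeff β (liftDer δ f) = δ (MvPowerSeries.coeff β f) := rfl

theorem liftDer_X (δ : Derivation ℝ A A) (c : Coord d L) :
    liftDer δ (MvPowerSeries.X c : ZSeries d L A) = 0 := by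
  classical
  ext β
  rw [coeff_liftDer, MvPowerSeries.coeff_X]
  split_ifs <;> simp

theorem coeff_mul_congr {σ R : Type*} [CommRing R] {β : σ →₀ ℕ} (a : MvPowerSeries σ R)
    {p q : MvPowerSeries σ R}
    (h : ∀ β' ≤ β, MvPowerSeries.coeff β' p = MvPowerSeries.coeff β' q) :
    MvPowerSeries.coeff β (a * p) = MvPowerSeries.coeff β (a * q) := by
  classical
  rw [MvPowerSeries.coeff_mul, MvPowerSeries.coeff_mul]
  refine Finset.sum_congr rfl fun x hx => ?_
  rw [Finset.HasAntidiagonal.mem_antidiagonal] at hx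
  rw [h x.2 (hx ▸ le_add_self)]

theorem coeff_X_mul_of_eq_zero {σ R : Type*} [CommRing R] {β : σ →₀ ℕ} {c : σ} (h : β c = 0)
    (f : MvPowerSeries σ R) : MvPowerSeries.coeff β (MvPowerSeries.X c * f) = 0 := by
  rw [MvPowerSeries.X_def, MvPowerSeries.coeff_monomial_mul, if_neg]
  rw [Finsupp.single_le_iff]
  omega

/-- The `k` such that `z_(𝔩,k)` divides `z^β`. -/
def noiseSupport (l : Option L) (β : MIdx d L) : Finset (NIdx d →₀ ℕ) :=
  β.support.preimage (fun k => Sum.inl (l, k)) (by intro a _ b _ h; simpa using h)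

theorem mem_noiseSupport {l : Option L} {β : MIdx d L} {k : NIdx d →₀ ℕ} :
    k ∈ noiseSupport l β ↔ β (Sum.inl (l, k)) ≠ 0 := by
  unfold noiseSupport
  exact Finset.mem_preimage.trans Finsupp.mem_support_iff

theorem noiseSupport_mono (l : Option L) {β β' : MIdx d L} (h : β' ≤ β) :
    noiseSupport l β' ⊆ noiseSupport l β := by
  intro k hk
  rw [mem_noiseSupport] at hk ⊢
  have := h (Sum.inl (l, k))
  omega

/-- `k! = ∏ₙ k(n)!`. -/
def kFact {ι : Type*} (k : ι →₀ ℕ) : ℝ := k.prod fun _ a => (a.factorial : ℝ)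

theorem kFact_pos {ι : Type*} (k : ι →₀ ℕ) : 0 < kFact k :=
  Finset.prod_pos fun _ _ => by positivity

theorem kFact_add_single {ι : Type*} (k : ι →₀ ℕ) (n : ι) :
    kFact (k + Finsupp.single n 1) = ((k n : ℝ) + 1) * kFact k := by
  classical
  have h1 : k.support ⊆ insert n k.support := Finset.subset_insert _ _
  have h2 : (k + Finsupp.single n 1).support ⊆ insert n k.support := by
    intro j hj
    by_cases h : j = n
    · simp [h]
    · have : k j ≠ 0 := by simpa [Ne.symm h, h] using hj
      simp [this]
  have hn : n ∈ insert n k.support := Finset.mem_insert_self _ _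
  rw [kFact, kFact, Finsupp.prod_of_support_subset k h1 _ (by simp),
    Finsupp.prod_of_support_subset _ h2 _ (by simp), ← Finset.mul_prod_erase _ _ hn,
    ← Finset.mul_prod_erase _ _ hn, ← mul_assoc]
  congr 1
  · simp [Nat.factorial_succ]
  · refine Finset.prod_congr rfl fun x hx => ?_
    have : x ≠ n := Finset.ne_of_mem_erase hx
    simp [this]

namespace Setting

variable (S : Setting d L)

/-- The indices `k' ≥ k` that occur in the image of `z_(𝔩,k)`. -/
def Reaches (l : Option L) (k k' : NIdx d →₀ ℕ) : Prop :=
  k ≤ k' ∧ (k' = k ∨ S.Subcritical l k')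

variable {S} in
theorem reaches_refl (l : Option L) (k : NIdx d →₀ ℕ) : S.Reaches l k k := ⟨le_rfl, Or.inl rfl⟩

variable {S} in
theorem Reaches.trans {l : Option L} {k k' k'' : NIdx d →₀ ℕ} (h : S.Reaches l k k')
    (h' : S.Reaches l k' k'') : S.Reaches l k k'' := by
  refine ⟨h.1.trans h'.1, ?_⟩
  rcases h'.2 with rfl | h2
  · exact h.2
  · exact Or.inr h2

variable {S} in
/-- Subcriticality is inherited by smaller multi-indices, so every intermediate `k'` may be passed
through. Hence the truncation to subcritical pairs is compatible with composing two shifts. -/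
theorem Reaches.split {l : Option L} {k k' k'' : NIdx d →₀ ℕ} (h : S.Reaches l k k'')
    (h1 : k ≤ k') (h2 : k' ≤ k'') : S.Reaches l k k' ∧ S.Reaches l k' k'' := by
  rcases h.2 with rfl | h3
  · obtain rfl : k' = k'' := le_antisymm h2 h1
    exact ⟨reaches_refl _ _, reaches_refl _ _⟩
  · exact ⟨⟨h1, Or.inr (h3.anti h2)⟩, ⟨h2, Or.inr h3⟩⟩

open Classical in
/-- The term `k'! z_(𝔩,k') w^(k'-k) / (k'-k)!` of the expansion of `k! z_(𝔩,k)` under the shift of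
the jet by `w`. -/
def shiftTerm (l : Option L) (k k' : NIdx d →₀ ℕ) (w : NIdx d → ZSeries d L A) : ZSeries d L A :=
  if S.Reaches l k k' then
    kFact k' • (MvPowerSeries.X (Sum.inl (l, k')) * dp w (k' - k))
  else 0

/-- The image `∑_{k' ≥ k} k'! z_(𝔩,k') w^(k'-k) / (k'-k)!` of `k! z_(𝔩,k)` under the shift of the jet
by `w`. The sum is coefficientwise finite: `k'` contributes to the coefficient of `z^β` only if
`z_(𝔩,k')` divides `z^β`. -/
def shiftSeries (l : Option L) (k : NIdx d →₀ ℕ) (w : NIdx d → ZSeries d L A) : ZSeries d L A :=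
  fun β => ∑ k' ∈ noiseSupport l β, MvPowerSeries.coeff β (S.shiftTerm l k k' w)

theorem coeff_shiftTerm_of_notMem {l : Option L} {k k' : NIdx d →₀ ℕ}
    {w : NIdx d → ZSeries d L A} {β : MIdx d L} (h : k' ∉ noiseSupport l β) :
    MvPowerSeries.coeff β (S.shiftTerm l k k' w) = 0 := by
  rw [mem_noiseSupport, not_not] at h
  rw [shiftTerm]
  split_ifs
  · rw [coeff_real_smul, coeff_X_mul_of_eq_zero h, smul_zero]
  · simp

theorem coeff_shiftSeries {l : Option L} {k : NIdx d →₀ ℕ} {w : NIdx d → ZSeries d L A}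
    {β : MIdx d L} {F : Finset (NIdx d →₀ ℕ)} (h : noiseSupport l β ⊆ F) :
    MvPowerSeries.coeff β (S.shiftSeries l k w) =
      MvPowerSeries.coeff β (∑ k' ∈ F, S.shiftTerm l k k' w) := by
  rw [map_sum]
  exact Finset.sum_subset h fun k' _ hk' => S.coeff_shiftTerm_of_notMem hk'

theorem coeff_mul_shiftSeries {l : Option L} {k : NIdx d →₀ ℕ} {w : NIdx d → ZSeries d L A}
    {β : MIdx d L} {F : Finset (NIdx d →₀ ℕ)} (h : noiseSupport l β ⊆ F) (a : ZSeries d L A) :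
    MvPowerSeries.coeff β (a * S.shiftSeries l k w) =
      MvPowerSeries.coeff β (a * ∑ k' ∈ F, S.shiftTerm l k k' w) :=
  coeff_mul_congr a fun _ hβ' => S.coeff_shiftSeries ((noiseSupport_mono l hβ').trans h)

theorem mapAlgHom_shiftTerm (f : A →ₐ[ℝ] A') (l : Option L) (k k' : NIdx d →₀ ℕ)
    (w : NIdx d → ZSeries d L A) :
    MvPowerSeries.mapAlgHom f (S.shiftTerm l k k' w) =
      S.shiftTerm l k k' fun n => MvPowerSeries.mapAlgHom f (w n) := by
  rw [shiftTerm, shiftTerm]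
  split_ifs
  · rw [map_smul, map_mul, map_dp, MvPowerSeries.mapAlgHom_apply f (MvPowerSeries.X _),
      MvPowerSeries.map_X]
  · simp

theorem mapAlgHom_shiftSeries (f : A →ₐ[ℝ] A') (l : Option L) (k : NIdx d →₀ ℕ)
    (w : NIdx d → ZSeries d L A) :
    MvPowerSeries.mapAlgHom f (S.shiftSeries l k w) =
      S.shiftSeries l k fun n => MvPowerSeries.mapAlgHom f (w n) := by
  ext β
  rw [S.coeff_shiftSeries (Finset.Subset.refl _), map_sum, MvPowerSeries.mapAlgHom_apply,
    MvPowerSeries.coeff_map, S.coeff_shiftSeries (Finset.Subset.refl _), map_sum]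
  change f _ = _
  rw [map_sum]
  refine Finset.sum_congr rfl fun k' _ => ?_
  rw [← mapAlgHom_shiftTerm, MvPowerSeries.mapAlgHom_apply, MvPowerSeries.coeff_map]
  rfl

theorem liftDer_shiftTerm (δ : Derivation ℝ A A) (l : Option L) (k k' : NIdx d →₀ ℕ)
    (w : NIdx d → ZSeries d L A) {N : Finset (NIdx d)}
    (hN : ∀ n, S.Subcritical l (k + Finsupp.single n 1) → n ∈ N) :
    liftDer δ (S.shiftTerm l k k' w) =
      ∑ n ∈ N, open Classical in if S.Subcritical l (k + Finsupp.single n 1) then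
        liftDer δ (w n) * S.shiftTerm l (k + Finsupp.single n 1) k' w else 0 := by
  classical
  rw [shiftTerm]
  split_ifs with h
  · rw [Derivation.map_smul, Derivation.leibniz, liftDer_X, smul_zero, add_zero, smul_eq_mul,
      derivation_dp, Finset.mul_sum, Finset.smul_sum]
    refine Finset.sum_subset_zero_on_sdiff ?_ ?_ ?_
    · intro n hn
      apply hN
      have hle : k + Finsupp.single n 1 ≤ k' := by
        rw [add_comm, ← le_tsub_iff_right h.1, Finsupp.single_le_iff]
        exact Nat.one_le_iff_ne_zero.mpr (Finsupp.mem_support_iff.mp hn)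
      rcases h.2 with rfl | h2
      · simp at hn
      · exact h2.anti hle
    · intro n hn
      rw [Finset.mem_sdiff, Finsupp.mem_support_iff, not_not] at hn
      split_ifs with h2
      · rw [shiftTerm, if_neg, mul_zero]
        intro h3
        have h4 := h3.1 n
        have h5 := hn.2
        simp only [Finsupp.tsub_apply, Finsupp.add_apply, Finsupp.single_eq_same] at h4 h5
        omega
      · rfl
    · intro n hn
      have hle : k + Finsupp.single n 1 ≤ k' := by
        rw [add_comm, ← le_tsub_iff_right h.1, Finsupp.single_le_iff]
        exact Nat.one_le_iff_ne_zero.mpr (Finsupp.mem_support_iff.mp hn)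
      have hsub : S.Subcritical l k' := by
        rcases h.2 with rfl | h2
        · simp at hn
        · exact h2
      rw [if_pos (hsub.anti hle), shiftTerm, if_pos ⟨hle, Or.inr hsub⟩, tsub_tsub,
        mul_smul_comm]
      congr 1
      ring
  · rw [map_zero]
    symm
    refine Finset.sum_eq_zero fun n _ => ?_
    split_ifs with h2
    · rw [shiftTerm, if_neg, mul_zero]
      intro h3
      exact h (Reaches.trans ⟨le_self_add, Or.inr h2⟩ h3)
    · rfl

/-- Differentiating the shifted `z_(𝔩,k)` in the jet produces the shifted `z_(𝔩,k+e_𝐧)`: this is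
the chain rule behind the derivations `D^(𝐧)`. -/
theorem liftDer_shiftSeries (δ : Derivation ℝ A A) (l : Option L) (k : NIdx d →₀ ℕ)
    (w : NIdx d → ZSeries d L A) {N : Finset (NIdx d)}
    (hN : ∀ n, S.Subcritical l (k + Finsupp.single n 1) → n ∈ N) :
    liftDer δ (S.shiftSeries l k w) =
      ∑ n ∈ N, open Classical in if S.Subcritical l (k + Finsupp.single n 1) then
        liftDer δ (w n) * S.shiftSeries l (k + Finsupp.single n 1) w else 0 := by
  classical
  ext β
  have hF := Finset.Subset.refl (noiseSupport l β)
  rw [coeff_liftDer, S.coeff_shiftSeries hF, ← coeff_liftDer, map_sum, map_sum, map_sum]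
  simp_rw [S.liftDer_shiftTerm δ l k _ w hN, map_sum]
  rw [Finset.sum_comm]
  refine Finset.sum_congr rfl fun n _ => ?_
  split_ifs with h
  · rw [S.coeff_mul_shiftSeries hF, Finset.mul_sum, map_sum]
  · simp

end Setting

end Series

/-! ### Substitution of jets -/

theorem coeff_subst_congr {σ τ R A : Type*} [CommRing R] [CommRing A] [Algebra R A]
    {a : σ → MvPowerSeries τ A} (ha : MvPowerSeries.HasSubst a) {f g : MvPowerSeries σ R}
    {β : τ →₀ ℕ}
    (h : ∀ γ, MvPowerSeries.coeff β (γ.prod fun c e => a c ^ e) ≠ 0 →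
      MvPowerSeries.coeff γ f = MvPowerSeries.coeff γ g) :
    MvPowerSeries.coeff β (MvPowerSeries.subst a f) =
      MvPowerSeries.coeff β (MvPowerSeries.subst a g) := by
  rw [MvPowerSeries.coeff_subst ha, MvPowerSeries.coeff_subst ha]
  refine finsum_congr fun γ => ?_
  by_cases h0 : MvPowerSeries.coeff β (γ.prod fun c e => a c ^ e) = 0
  · rw [h0, smul_zero, smul_zero]
  · rw [h γ h0]

/-- Row finiteness of a substitution: only finitely many monomials contribute to a given
coefficient. -/
theorem finite_coeff_prod_ne_zero {σ τ A : Type*} [CommRing A]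
    {a : σ → MvPowerSeries τ A} (ha : MvPowerSeries.HasSubst a) (β : τ →₀ ℕ) :
    {γ : σ →₀ ℕ | MvPowerSeries.coeff β (γ.prod fun c e => a c ^ e) ≠ 0}.Finite := by
  have h := MvPowerSeries.coeff_subst_finite ha (fun _ => (1 : A)) β
  refine h.subset fun γ hγ => ?_
  rw [Function.mem_support]
  change (1 : A) • _ ≠ 0
  rwa [one_smul]

section Jets

variable {d : ℕ} {L A A' : Type*} [CommRing A] [Algebra ℝ A] [CommRing A'] [Algebra ℝ A']

/-- A jet `(uₙ)` of power series that can be substituted for `(z_𝐧)`: there are no constant terms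
and every coefficient sees only finitely many `𝐧`. -/
structure JetAdm (u : NIdx d → ZSeries d L A) : Prop where
  const : ∀ n, MvPowerSeries.constantCoeff (u n) = 0
  fin : ∀ β, {n | MvPowerSeries.coeff β (u n) ≠ 0}.Finite

namespace Setting

variable (S : Setting d L)

/-- The images of the coordinates under the algebra morphism that replaces `z_𝐧` by `u_𝐧`, and
shifts the jet in which the `z_(𝔩,k)` are the Taylor coefficients by `u_𝐧 - z_𝐧`. -/
def jetImage (u : NIdx d → ZSeries d L A) : Coord d L → ZSeries d L A
  | Sum.inl (l, k) => (kFact k)⁻¹ • S.shiftSeries l k fun n => u n - MvPowerSeries.X (Sum.inr n)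
  | Sum.inr n => u n

theorem mapAlgHom_jetImage (f : A →ₐ[ℝ] A') (u : NIdx d → ZSeries d L A) (c : Coord d L) :
    MvPowerSeries.mapAlgHom f (S.jetImage u c) =
      S.jetImage (fun n => MvPowerSeries.mapAlgHom f (u n)) c := by
  rcases c with ⟨l, k⟩ | n
  · simp only [jetImage]
    rw [map_smul, mapAlgHom_shiftSeries]
    congr 2
    funext n
    rw [map_sub, MvPowerSeries.mapAlgHom_apply f (MvPowerSeries.X _), MvPowerSeries.map_X]
  · rfl

variable {S} in
theorem hasSubst_jetImage {u : NIdx d → ZSeries d L A} (hu : JetAdm u) :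
    MvPowerSeries.HasSubst (S.jetImage u) := by
  constructor
  · rintro (⟨l, k⟩ | n)
    · have : MvPowerSeries.constantCoeff (S.jetImage u (Sum.inl (l, k))) = 0 := by
        rw [← MvPowerSeries.coeff_zero_eq_constantCoeff_apply]
        simp only [jetImage]
        rw [coeff_real_smul, S.coeff_shiftSeries (Finset.Subset.refl _)]
        have : noiseSupport l (0 : MIdx d L) = ∅ := by
          ext j
          simp [mem_noiseSupport]
        simp [this]
      rw [this]
      exact IsNilpotent.zero
    · rw [show S.jetImage u (Sum.inr n) = u n from rfl, hu.const]
      exact IsNilpotent.zero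
  · intro β
    have h1 : (Sum.inr '' {n | MvPowerSeries.coeff β (u n) ≠ 0} : Set (Coord d L)).Finite :=
      (hu.fin β).image _
    let G : Coord d L → Set (Coord d L) := fun c => match c with
      | Sum.inl (l, k') => (fun k => (Sum.inl (l, k) : Coord d L)) '' Set.Iic k'
      | Sum.inr _ => ∅
    have h2 : (⋃ c ∈ (β.support : Set (Coord d L)), G c).Finite := by
      refine Set.Finite.biUnion (Finset.finite_toSet _) ?_
      rintro (⟨l, k'⟩ | n) _
      · exact (Set.finite_Iic k').image _
      · exact Set.finite_empty
    refine (h1.union h2).subset ?_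
    rintro (⟨l, k⟩ | n) hc
    · right
      simp only [jetImage, Set.mem_ofPred_eq] at hc
      rw [coeff_real_smul, S.coeff_shiftSeries (Finset.Subset.refl _), map_sum] at hc
      have hne : ∑ k' ∈ noiseSupport l β, MvPowerSeries.coeff β
          (S.shiftTerm l k k' fun n => u n - MvPowerSeries.X (Sum.inr n)) ≠ 0 :=
        fun h => hc (by rw [h, smul_zero])
      obtain ⟨k', hk', hk''⟩ := Finset.exists_ne_zero_of_sum_ne_zero hne
      have hr : S.Reaches l k k' := by
        by_contra hr
        rw [shiftTerm, if_neg hr] at hk''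
        simp at hk''
      rw [mem_noiseSupport] at hk'
      simp only [Set.mem_iUnion]
      exact ⟨Sum.inl (l, k'), Finsupp.mem_support_iff.mpr hk', k, hr.1, rfl⟩
    · exact Or.inl ⟨n, hc, rfl⟩

/-- The algebra morphism of power series given by the substitution of a jet. -/
def jetSubst (u : NIdx d → ZSeries d L A) (f : ZSeries d L A) : ZSeries d L A :=
  MvPowerSeries.subst (S.jetImage u) f

/-- The image of a monomial under the substitution of a jet. -/
def jetMonomial (u : NIdx d → ZSeries d L A) (γ : MIdx d L) : ZSeries d L A :=
  γ.prod fun c e => S.jetImage u c ^ e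

variable {S} in
/-- `jetSubst` as an algebra morphism. -/
def jetSubstAlg {u : NIdx d → ZSeries d L A} (hu : JetAdm u) :
    ZSeries d L A →ₐ[ℝ] ZSeries d L A :=
  (MvPowerSeries.substAlgHom (hasSubst_jetImage (S := S) hu)).restrictScalars ℝ

variable {S} in
theorem jetSubst_eq {u : NIdx d → ZSeries d L A} (hu : JetAdm u) (f : ZSeries d L A) :
    S.jetSubst u f = S.jetSubstAlg hu f :=
  (MvPowerSeries.substAlgHom_apply (hasSubst_jetImage hu) f).symm

theorem coeff_jetSubst {u : NIdx d → ZSeries d L A} (hu : JetAdm u) (f : ZSeries d L A)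
    (β : MIdx d L) :
    MvPowerSeries.coeff β (S.jetSubst u f) =
      ∑ᶠ γ, MvPowerSeries.coeff γ f * MvPowerSeries.coeff β (S.jetMonomial u γ) :=
  MvPowerSeries.coeff_subst (hasSubst_jetImage hu) f β

theorem finite_jetMonomial {u : NIdx d → ZSeries d L A} (hu : JetAdm u) (β : MIdx d L) :
    {γ | MvPowerSeries.coeff β (S.jetMonomial u γ) ≠ 0}.Finite :=
  finite_coeff_prod_ne_zero (hasSubst_jetImage hu) β

theorem jetSubst_X {u : NIdx d → ZSeries d L A} (hu : JetAdm u) (c : Coord d L) :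
    S.jetSubst u (MvPowerSeries.X c) = S.jetImage u c :=
  MvPowerSeries.subst_X (hasSubst_jetImage hu) c

theorem jetSubst_monomial {u : NIdx d → ZSeries d L A} (hu : JetAdm u) (γ : MIdx d L) :
    S.jetSubst u (MvPowerSeries.monomial γ 1) = S.jetMonomial u γ := by
  rw [jetSubst, MvPowerSeries.subst_monomial (hasSubst_jetImage hu), map_one, one_mul]
  rfl

theorem mapAlgHom_jetMonomial (f : A →ₐ[ℝ] A') (u : NIdx d → ZSeries d L A) (γ : MIdx d L) :
    MvPowerSeries.mapAlgHom f (S.jetMonomial u γ) =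
      S.jetMonomial (fun n => MvPowerSeries.mapAlgHom f (u n)) γ := by
  simp only [jetMonomial, Finsupp.prod, map_prod, map_pow, mapAlgHom_jetImage]

variable {S} in
theorem jetSubst_shiftTerm {u : NIdx d → ZSeries d L A} (hu : JetAdm u) (l : Option L)
    (k k' : NIdx d →₀ ℕ) (w : NIdx d → ZSeries d L A) :
    S.jetSubst u (S.shiftTerm l k k' w) = open Classical in if S.Reaches l k k' then
      dp (fun n => S.jetSubst u (w n)) (k' - k) *
        S.shiftSeries l k' (fun n => u n - MvPowerSeries.X (Sum.inr n)) else 0 := by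
  have hφ := jetSubst_eq (S := S) hu
  rw [shiftTerm]
  split_ifs with h
  · rw [hφ, map_smul, map_mul, map_dp, ← hφ, jetSubst_X S hu]
    simp only [← hφ]
    rw [jetImage, smul_mul_assoc, smul_smul, mul_inv_cancel₀ (kFact_pos k').ne', one_smul,
      mul_comm]
  · rw [hφ, map_zero]

variable {S} in
/-- The shift by `v + w` is the shift by `w` after that by `v`: this is the binomial theorem
`dp_add` for divided powers, combined with `Reaches.split`. -/
theorem sum_dp_mul_shiftTerm (l : Option L) (k k'' : NIdx d →₀ ℕ)
    (v w : NIdx d → ZSeries d L A) {F : Finset (NIdx d →₀ ℕ)} (hF : ∀ k' ≤ k'', k' ∈ F) :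
    ∑ k' ∈ F, (open Classical in if S.Reaches l k k' then
      dp v (k' - k) * S.shiftTerm l k' k'' w else 0) = S.shiftTerm l k k'' (v + w) := by
  classical
  by_cases h : S.Reaches l k k''
  · rw [shiftTerm, if_pos h, dp_add, Finset.mul_sum, Finset.smul_sum]
    symm
    refine Finset.sum_of_injOn (fun p => k + p.1) ?_ ?_ ?_ ?_
    · rintro ⟨a, b⟩ hab ⟨a', b'⟩ hab' e
      rw [Finset.mem_coe, Finset.HasAntidiagonal.mem_antidiagonal] at hab hab'
      have e1 : a = a' := add_left_cancel e
      subst e1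
      rw [← hab'] at hab
      have e2 : b = b' := add_left_cancel hab
      rw [e2]
    · rintro ⟨a, b⟩ hab
      rw [Finset.mem_coe, Finset.HasAntidiagonal.mem_antidiagonal] at hab
      refine hF _ ?_
      calc k + a ≤ k + (a + b) := add_le_add_right le_self_add _
        _ = k'' := by rw [hab]; exact add_tsub_cancel_of_le h.1
    · intro k' _ hk'
      split_ifs with h1
      · rw [shiftTerm, if_neg, mul_zero]
        intro h2
        apply hk'
        refine ⟨(k' - k, k'' - k'), ?_, add_tsub_cancel_of_le h1.1⟩
        rw [Finset.mem_coe, Finset.HasAntidiagonal.mem_antidiagonal]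
        change k' - k + (k'' - k') = k'' - k
        rw [add_comm]
        exact tsub_add_tsub_cancel h2.1 h1.1
      · rfl
    · rintro ⟨a, b⟩ hab
      rw [Finset.HasAntidiagonal.mem_antidiagonal] at hab
      have hk : k + a + b = k'' := by
        rw [add_assoc, hab]
        exact add_tsub_cancel_of_le h.1
      have hs := h.split (k' := k + a) le_self_add (by rw [← hk]; exact le_self_add)
      have e : k'' - (k + a) = b := by rw [← hk]; simp
      simp only
      rw [if_pos hs.1, shiftTerm, if_pos hs.2, e, add_tsub_cancel_left, mul_smul_comm]
      congr 1
      ring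
  · rw [shiftTerm, if_neg h]
    refine Finset.sum_eq_zero fun k' _ => ?_
    split_ifs with h1
    · rw [shiftTerm, if_neg, mul_zero]
      exact fun h2 => h (h1.trans h2)
    · rfl

variable {S} in
/-- A substitution acts on shifted noise coordinates by adding the increment of its jet to the
shift, after substituting in the latter. -/
theorem jetSubst_shiftSeries {u : NIdx d → ZSeries d L A} (hu : JetAdm u) (l : Option L)
    (k : NIdx d →₀ ℕ) (w : NIdx d → ZSeries d L A) :
    S.jetSubst u (S.shiftSeries l k w) = S.shiftSeries l k
      ((fun n => S.jetSubst u (w n)) + fun n => u n - MvPowerSeries.X (Sum.inr n)) := by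
  classical
  ext β
  set R := (S.finite_jetMonomial hu β).toFinset
  set F : Finset (NIdx d →₀ ℕ) := R.biUnion (noiseSupport l) ∪
    (noiseSupport l β).biUnion (fun k'' => Finset.Iic k'')
  have h1 : MvPowerSeries.coeff β (S.jetSubst u (S.shiftSeries l k w)) =
      MvPowerSeries.coeff β (S.jetSubst u (∑ k' ∈ F, S.shiftTerm l k k' w)) := by
    refine coeff_subst_congr (hasSubst_jetImage hu) fun γ hγ => S.coeff_shiftSeries ?_
    refine Finset.Subset.trans ?_ Finset.subset_union_left
    exact Finset.subset_biUnion_of_mem _ ((S.finite_jetMonomial hu β).mem_toFinset.mpr hγ)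
  have h2 : S.jetSubst u (∑ k' ∈ F, S.shiftTerm l k k' w) =
      ∑ k' ∈ F, S.jetSubst u (S.shiftTerm l k k' w) := by
    simp only [jetSubst_eq hu, map_sum]
  rw [h1, h2, S.coeff_shiftSeries (Finset.Subset.refl _), map_sum, map_sum]
  have h3 : ∀ k' ∈ F, MvPowerSeries.coeff β (S.jetSubst u (S.shiftTerm l k k' w)) =
      ∑ k'' ∈ noiseSupport l β, MvPowerSeries.coeff β (if S.Reaches l k k' then
        dp (fun n => S.jetSubst u (w n)) (k' - k) *
          S.shiftTerm l k' k'' (fun n => u n - MvPowerSeries.X (Sum.inr n)) else 0) := by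
    intro k' _
    rw [jetSubst_shiftTerm hu]
    split_ifs
    · rw [S.coeff_mul_shiftSeries (Finset.Subset.refl _), Finset.mul_sum, map_sum]
    · simp
  rw [Finset.sum_congr rfl h3, Finset.sum_comm]
  refine Finset.sum_congr rfl fun k'' hk'' => ?_
  rw [← map_sum, sum_dp_mul_shiftTerm]
  intro k' hk'
  exact Finset.mem_union_right _ (Finset.mem_biUnion.mpr ⟨k'', hk'', Finset.mem_Iic.mpr hk'⟩)

variable {S} in
theorem jetSubst_jetImage {u v : NIdx d → ZSeries d L A} (hu : JetAdm u) (c : Coord d L) :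
    S.jetSubst u (S.jetImage v c) = S.jetImage (fun n => S.jetSubst u (v n)) c := by
  rcases c with ⟨l, k⟩ | n
  · simp only [jetImage]
    rw [jetSubst_eq hu, map_smul, ← jetSubst_eq hu, jetSubst_shiftSeries hu]
    congr 2
    funext n
    have h2 : S.jetSubst u (v n - MvPowerSeries.X (Sum.inr n)) = S.jetSubst u (v n) - u n := by
      rw [jetSubst_eq hu, map_sub, ← jetSubst_eq hu, ← jetSubst_eq hu, jetSubst_X S hu]
      rfl
    rw [Pi.add_apply, h2]
    ring
  · rfl

/-- The substitutions of jets are closed under composition. -/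
theorem jetSubst_jetSubst {u v : NIdx d → ZSeries d L A} (hu : JetAdm u) (hv : JetAdm v)
    (f : ZSeries d L A) :
    S.jetSubst u (S.jetSubst v f) = S.jetSubst (fun n => S.jetSubst u (v n)) f := by
  rw [jetSubst, jetSubst, MvPowerSeries.subst_comp_subst_apply (hasSubst_jetImage hv)
    (hasSubst_jetImage hu)]
  congr 1
  funext c
  exact jetSubst_jetImage hu c

end Setting

theorem JetAdm.jetSubst {S : Setting d L} {u v : NIdx d → ZSeries d L A} (hu : JetAdm u)
    (hv : JetAdm v) : JetAdm fun n => S.jetSubst u (v n) := by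
  have h := (Setting.hasSubst_jetImage (S := S) hv).comp (Setting.hasSubst_jetImage (S := S) hu)
  constructor
  · intro n
    refine MvPowerSeries.constantCoeff_subst_eq_zero (Setting.hasSubst_jetImage hu) ?_ (hv.const n)
    rintro (⟨l, k⟩ | m)
    · rw [← MvPowerSeries.coeff_zero_eq_constantCoeff_apply]
      simp only [Setting.jetImage]
      rw [coeff_real_smul, S.coeff_shiftSeries (Finset.Subset.refl _)]
      have : noiseSupport l (0 : MIdx d L) = ∅ := by
        ext j
        simp [mem_noiseSupport]
      simp [this]
    · exact hu.const m
  · intro β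
    have := (h.coeff_zero β).preimage (f := Sum.inr) Sum.inr_injective.injOn
    simp only [MvPowerSeries.substAlgHom_apply] at this
    exact this

end Jets

/-! ### Scaled degrees and subcriticality -/

section Degrees

variable {d : ℕ} {L : Type*} {S : Setting d L}

namespace Setting

theorem deg_zero : S.deg 0 = 0 := by simp [deg]

theorem deg_add (m n : NIdx d) : S.deg (m + n) = S.deg m + S.deg n := by
  simp [deg, mul_add, Finset.sum_add_distrib]

theorem deg_single (i : Fin d) : S.deg (Finsupp.single i 1) = S.s i := by
  classical
  rw [deg, Finset.sum_eq_single i]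
  · simp
  · intro j _ hj
    simp [Ne.symm hj]
  · simp

theorem Standing.deg_nonneg (hS : S.Standing) (n : NIdx d) : 0 ≤ S.deg n :=
  Finset.sum_nonneg fun i _ => mul_nonneg (zero_le_one.trans (hS.one_le_s i)) (Nat.cast_nonneg _)

theorem Standing.deg_mono (hS : S.Standing) {m n : NIdx d} (h : m ≤ n) : S.deg m ≤ S.deg n := by
  rw [← add_tsub_cancel_of_le h, deg_add]
  linarith [hS.deg_nonneg (n - m)]

theorem Standing.le_deg (hS : S.Standing) (n : NIdx d) (i : Fin d) : (n i : ℝ) ≤ S.deg n := by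
  have h1 : S.s i * (n i : ℝ) ≤ S.deg n :=
    Finset.single_le_sum (f := fun i => S.s i * (n i : ℝ))
      (fun j _ => mul_nonneg (zero_le_one.trans (hS.one_le_s j)) (Nat.cast_nonneg _))
      (Finset.mem_univ i)
  have h2 := mul_le_mul_of_nonneg_right (hS.one_le_s i) (Nat.cast_nonneg (α := ℝ) (n i))
  linarith

theorem Standing.finite_deg_le (hS : S.Standing) (κ : ℝ) : {n : NIdx d | S.deg n ≤ κ}.Finite := by
  obtain ⟨N, hN⟩ := exists_nat_ge κ
  refine (Set.finite_Iic (Finsupp.equivFunOnFinite.symm fun _ : Fin d => N)).subset ?_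
  intro n hn i
  have : (n i : ℝ) ≤ N := ((hS.le_deg n i).trans hn).trans hN
  simpa using this

theorem Standing.finite_deg_lt (hS : S.Standing) (κ : ℝ) : {n : NIdx d | S.deg n < κ}.Finite :=
  (hS.finite_deg_le κ).subset fun _ h => (show S.deg _ < κ from h).le

theorem Subcritical.deg_lt {l : Option L} {k : NIdx d →₀ ℕ} (h : S.Subcritical l k) {n : NIdx d}
    (hn : k n ≠ 0) : S.deg n < S.eta := by
  have h1 := (h.2 (Finsupp.single n 1) (by
    rw [pos_iff_ne_zero]
    simp) (by rw [Finsupp.single_le_iff]; omega)).1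
  rw [regSum, Finsupp.sum_single_index (by simp), Nat.cast_one, mul_one] at h1
  linarith [h1]

end Setting

end Degrees

/-! ### Jets given by a translation and a family of coefficients -/

section JetOf

variable {d : ℕ} {L A A' : Type*} [CommRing A] [Algebra ℝ A] [CommRing A'] [Algebra ℝ A']

theorem ePoly_injective : Function.Injective (ePoly L : NIdx d → MIdx d L) := by
  intro m n h
  have := (Finsupp.single_left_inj (one_ne_zero (α := ℕ))).mp h
  exact Sum.inr_injective this

theorem ePoly_ne_zero (n : NIdx d) : ePoly L n ≠ 0 := by simp [ePoly]

open Classical in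
/-- The power series `∑_N a_N z_N`. -/
def linSeries (a : NIdx d → A) : ZSeries d L A :=
  fun β => if h : ∃ N, β = ePoly L N then a h.choose else 0

@[simp] theorem coeff_linSeries (a : NIdx d → A) (N : NIdx d) :
    MvPowerSeries.coeff (ePoly L N) (linSeries (L := L) a) = a N := by
  have h : ∃ N', ePoly L N = ePoly L N' := ⟨N, rfl⟩
  rw [MvPowerSeries.coeff_apply, linSeries, dif_pos h, ← ePoly_injective h.choose_spec]

theorem coeff_linSeries_of_notMem (a : NIdx d → A) {β : MIdx d L}
    (hβ : β ∉ Set.range (ePoly L)) : MvPowerSeries.coeff β (linSeries (L := L) a) = 0 := by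
  rw [MvPowerSeries.coeff_apply, linSeries, dif_neg]
  rintro ⟨N, rfl⟩
  exact hβ ⟨N, rfl⟩

/-- Equality of power series can be checked separately on the `e_N` and on the other
multi-indices. -/
theorem ext_linSeries {f : ZSeries d L A} {a : NIdx d → A}
    (h : ∀ N, MvPowerSeries.coeff (ePoly L N) f = a N)
    (h' : ∀ β, β ∉ Set.range (ePoly L) → MvPowerSeries.coeff β f = 0) : f = linSeries a := by
  ext β
  by_cases hβ : β ∈ Set.range (ePoly L)
  · obtain ⟨N, rfl⟩ := hβ
    rw [h, coeff_linSeries]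
  · rw [h' β hβ, coeff_linSeries_of_notMem a hβ]

open Classical in
/-- The coefficient `binom(N,n) h^(N-n)` of `z_N` in the translate of `z_n` by `h`. -/
def shiftCoef (h : Fin d → A) (n N : NIdx d) : A :=
  if n ≤ N then (kFact N / kFact n) • dp h (N - n) else 0

theorem map_shiftCoef (f : A →ₐ[ℝ] A') (h : Fin d → A) (n N : NIdx d) :
    f (shiftCoef h n N) = shiftCoef (fun i => f (h i)) n N := by
  rw [shiftCoef, shiftCoef]
  split_ifs
  · rw [map_smul, map_dp]
  · simp

/-- The jet `∑_N binom(N,n) h^(N-n) z_N + π_n`. -/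
def jetOf (h : Fin d → A) (π : NIdx d → ZSeries d L A) (n : NIdx d) : ZSeries d L A :=
  linSeries (shiftCoef h n) + π n

theorem mapAlgHom_linSeries (f : A →ₐ[ℝ] A') (a : NIdx d → A) :
    MvPowerSeries.mapAlgHom f (linSeries (L := L) a) = linSeries fun N => f (a N) := by
  refine ext_linSeries (fun N => ?_) fun β hβ => ?_
  · rw [MvPowerSeries.mapAlgHom_apply, MvPowerSeries.coeff_map, coeff_linSeries]
    rfl
  · rw [MvPowerSeries.mapAlgHom_apply, MvPowerSeries.coeff_map, coeff_linSeries_of_notMem a hβ,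
      map_zero]

theorem mapAlgHom_jetOf (f : A →ₐ[ℝ] A') (h : Fin d → A) (π : NIdx d → ZSeries d L A)
    (n : NIdx d) :
    MvPowerSeries.mapAlgHom f (jetOf h π n) =
      jetOf (fun i => f (h i)) (fun n => MvPowerSeries.mapAlgHom f (π n)) n := by
  rw [jetOf, jetOf, map_add, mapAlgHom_linSeries]
  simp only [map_shiftCoef]

theorem jetAdm_jetOf (h : Fin d → A) {π : NIdx d → ZSeries d L A}
    (h0 : ∀ n, MvPowerSeries.coeff 0 (π n) = 0)
    (hf : ∀ β, {n | MvPowerSeries.coeff β (π n) ≠ 0}.Finite) : JetAdm (jetOf h π) := by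
  constructor
  · intro n
    rw [← MvPowerSeries.coeff_zero_eq_constantCoeff_apply, jetOf, map_add, h0, add_zero]
    refine coeff_linSeries_of_notMem _ ?_
    rintro ⟨N, hN⟩
    exact ePoly_ne_zero N hN
  · intro β
    by_cases hβ : β ∈ Set.range (ePoly L)
    · obtain ⟨N, rfl⟩ := hβ
      refine ((Set.finite_Iic N).union (hf (ePoly L N))).subset ?_
      intro n hn
      rw [Set.mem_ofPred_eq, jetOf, map_add, coeff_linSeries] at hn
      by_cases hle : n ≤ N
      · exact Or.inl hle
      · right
        rw [shiftCoef, if_neg hle, zero_add] at hn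
        exact hn
    · refine (hf β).subset ?_
      intro n hn
      rw [Set.mem_ofPred_eq, jetOf, map_add, coeff_linSeries_of_notMem _ hβ, zero_add] at hn
      exact hn

theorem shiftCoef_self (h : Fin d → A) (n : NIdx d) : shiftCoef h n n = 1 := by
  rw [shiftCoef, if_pos le_rfl, tsub_self, dp_zero, div_self (kFact_pos n).ne', one_smul]

theorem shiftCoef_zero {n N : NIdx d} (hne : n ≠ N) : shiftCoef (0 : Fin d → A) n N = 0 := by
  classical
  rw [shiftCoef]
  split_ifs with h
  · rw [dp_zero_fun, if_neg, smul_zero]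
    intro h0
    exact hne (le_antisymm h (tsub_eq_zero_iff_le.mp h0))
  · rfl

theorem linSeries_single (n : NIdx d) (a : NIdx d → A) (h1 : a n = 1) (h0 : ∀ N, n ≠ N → a N = 0) :
    linSeries (L := L) a = MvPowerSeries.X (Sum.inr n) := by
  classical
  symm
  refine ext_linSeries (fun N => ?_) fun β hβ => ?_
  · rw [MvPowerSeries.coeff_X]
    by_cases h : n = N
    · subst h
      rw [h1]
      exact if_pos rfl
    · rw [if_neg, h0 N h]
      intro e
      exact h (ePoly_injective e.symm)
  · rw [MvPowerSeries.coeff_X, if_neg]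
    rintro rfl
    exact hβ ⟨n, rfl⟩

theorem derivation_shiftCoef (δ : Derivation ℝ A A) (h : Fin d → A) (i : Fin d)
    (hδ : ∀ j, δ (h j) = if j = i then 1 else 0) (n N : NIdx d) :
    δ (shiftCoef h n N) = ((n i : ℝ) + 1) • shiftCoef h (n + Finsupp.single i 1) N := by
  classical
  rw [shiftCoef, shiftCoef]
  by_cases h1 : n ≤ N
  · rw [if_pos h1, Derivation.map_smul, derivation_dp]
    simp_rw [hδ, ite_mul, one_mul, zero_mul]
    rw [Finset.sum_ite_eq']
    by_cases h2 : n + Finsupp.single i 1 ≤ N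
    · have h3 : i ∈ (N - n).support := by
        have := h2 i
        simp only [Finsupp.add_apply, Finsupp.single_eq_same] at this
        rw [Finsupp.mem_support_iff, Finsupp.tsub_apply]
        omega
      rw [if_pos h3, if_pos h2, tsub_tsub, smul_smul, kFact_add_single]
      congr 1
      have := (kFact_pos n).ne'
      have : ((n i : ℝ) + 1) ≠ 0 := by positivity
      field_simp
    · have h3 : i ∉ (N - n).support := by
        rw [Finsupp.mem_support_iff, not_not]
        by_contra h4
        apply h2
        rw [add_comm, ← le_tsub_iff_right h1, Finsupp.single_le_iff]
        omega
      rw [if_neg h3, if_neg h2, smul_zero, smul_zero]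
  · rw [if_neg h1, if_neg (fun h2 => h1 (le_self_add.trans h2)), map_zero, smul_zero]

theorem derivation_shiftCoef_eq_zero (δ : Derivation ℝ A A) (h : Fin d → A)
    (hδ : ∀ j, δ (h j) = 0) (n N : NIdx d) : δ (shiftCoef h n N) = 0 := by
  rw [shiftCoef]
  split_ifs
  · rw [Derivation.map_smul, derivation_dp]
    simp [hδ]
  · simp

theorem liftDer_linSeries (δ : Derivation ℝ A A) (a : NIdx d → A) :
    liftDer δ (linSeries (L := L) a) = linSeries fun N => δ (a N) := by
  refine ext_linSeries (fun N => ?_) fun β hβ => ?_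
  · rw [coeff_liftDer, coeff_linSeries]
  · rw [coeff_liftDer, coeff_linSeries_of_notMem a hβ, map_zero]

theorem linSeries_smul (r : ℝ) (a : NIdx d → A) :
    (linSeries (L := L) fun N => r • a N) = r • linSeries a := by
  symm
  refine ext_linSeries (fun N => ?_) fun β hβ => ?_
  · rw [coeff_real_smul, coeff_linSeries]
  · rw [coeff_real_smul, coeff_linSeries_of_notMem a hβ, smul_zero]

end JetOf

/-! ### Derivatives of a substitution in the jet -/

section Derivatives

variable {d : ℕ} {L A A' : Type*} [CommRing A] [Algebra ℝ A] [CommRing A'] [Algebra ℝ A']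
variable (S : Setting d L)

namespace Setting

/-- The substitution of a jet on polynomials. -/
def jetEval (u : NIdx d → ZSeries d L A) : ZPoly d L →ₐ[ℝ] ZSeries d L A :=
  MvPolynomial.aeval (S.jetImage u)

theorem jetEval_monomial (u : NIdx d → ZSeries d L A) (γ : MIdx d L) :
    S.jetEval u (MvPolynomial.monomial γ 1) = S.jetMonomial u γ := by
  rw [jetEval, MvPolynomial.aeval_monomial, map_one, one_mul, jetMonomial]

theorem jetEval_X (u : NIdx d → ZSeries d L A) (c : Coord d L) :
    S.jetEval u (MvPolynomial.X c) = S.jetImage u c :=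
  MvPolynomial.aeval_X _ _

theorem mapAlgHom_jetEval (f : A →ₐ[ℝ] A') (u : NIdx d → ZSeries d L A) (p : ZPoly d L) :
    MvPowerSeries.mapAlgHom f (S.jetEval u p) =
      S.jetEval (fun n => MvPowerSeries.mapAlgHom f (u n)) p := by
  have : ((MvPowerSeries.mapAlgHom f).comp (S.jetEval u)) =
      S.jetEval (fun n => MvPowerSeries.mapAlgHom f (u n)) := by
    refine MvPolynomial.algHom_ext fun c => ?_
    rw [AlgHom.comp_apply, jetEval_X, jetEval_X, mapAlgHom_jetImage]
  exact congrArg (fun g => g p) this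

variable {S}

theorem finite_D_X_ne_zero (hS : S.Standing) (c : Coord d L) :
    {n | S.D n (MvPolynomial.X c : ZPoly d L) ≠ 0}.Finite := by
  rcases c with ⟨l, k⟩ | m
  · refine (hS.finite_deg_lt S.eta).subset fun n hn => ?_
    rw [Set.mem_ofPred_eq, D_X_inl] at hn
    have hsub : S.Subcritical l (k + Finsupp.single n 1) := by
      by_contra h
      rw [if_neg h] at hn
      exact hn rfl
    exact hsub.deg_lt (n := n) (by simp)
  · refine (Set.finite_singleton m).subset fun n hn => ?_
    rw [Set.mem_ofPred_eq, D_X_inr] at hn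
    by_contra h
    rw [if_neg (fun e : m = n => h e.symm), map_zero] at hn
    exact hn rfl

/-- The chain rule for the image of a coordinate. -/
theorem liftDer_jetImage (δ : Derivation ℝ A A) (u : NIdx d → ZSeries d L A) (c : Coord d L)
    {N : Finset (NIdx d)} (hN : ∀ n, S.D n (MvPolynomial.X c : ZPoly d L) ≠ 0 → n ∈ N) :
    liftDer δ (S.jetImage u c) =
      ∑ n ∈ N, liftDer δ (u n) * S.jetEval u (S.D n (MvPolynomial.X c)) := by
  classical
  rcases c with ⟨l, k⟩ | m
  · have hN' : ∀ n, S.Subcritical l (k + Finsupp.single n 1) → n ∈ N := by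
      intro n hn
      apply hN
      rw [D_X_inl, if_pos hn, Ne, smul_eq_zero, not_or]
      exact ⟨by positivity, MvPolynomial.X_ne_zero _⟩
    simp only [jetImage]
    rw [Derivation.map_smul, S.liftDer_shiftSeries δ l k _ hN', Finset.smul_sum]
    refine Finset.sum_congr rfl fun n _ => ?_
    rw [D_X_inl]
    split_ifs with h
    · rw [map_sub, liftDer_X, sub_zero, map_smul, jetEval_X]
      simp only [jetImage]
      rw [← mul_smul_comm, smul_smul, kFact_add_single]
      congr 2
      have := (kFact_pos k).ne'
      have : ((k n : ℝ) + 1) ≠ 0 := by positivity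
      field_simp
    · simp
  · have hm : m ∈ N := by
      apply hN
      rw [D_X_inr, if_pos rfl, map_one]
      exact one_ne_zero
    rw [Finset.sum_eq_single m]
    · rw [D_X_inr, if_pos rfl, map_one, map_one, mul_one]
      rfl
    · intro n _ hn
      rw [D_X_inr, if_neg (Ne.symm hn), map_zero, map_zero, mul_zero]
    · exact fun h => absurd hm h

theorem liftDer_jetEval_aux (δ : Derivation ℝ A A) (u : NIdx d → ZSeries d L A)
    (D' : Derivation ℝ (ZPoly d L) (ZPoly d L)) (g : ZSeries d L A)
    (h : ∀ c, liftDer δ (S.jetImage u c) = g * S.jetEval u (D' (MvPolynomial.X c)))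
    (p : ZPoly d L) : liftDer δ (S.jetEval u p) = g * S.jetEval u (D' p) := by
  induction p using MvPolynomial.induction_on with
  | C a =>
    rw [← MvPolynomial.algebraMap_eq, AlgHom.commutes, Derivation.map_algebraMap,
      Derivation.map_algebraMap, map_zero, mul_zero]
  | add p q hp hq => rw [map_add, map_add, hp, hq, map_add, map_add, mul_add]
  | mul_X p c hp =>
    rw [map_mul, Derivation.leibniz, Derivation.leibniz, hp, jetEval_X, h, map_add, smul_eq_mul,
      smul_eq_mul, smul_eq_mul, smul_eq_mul, map_mul, map_mul, jetEval_X]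
    ring

/-- If only the component `n₀` of the jet depends on a parameter, differentiating a substituted
polynomial in this parameter amounts to applying `D n₀` to the polynomial. -/
theorem liftDer_jetEval_D (hS : S.Standing) (δ : Derivation ℝ A A) (u : NIdx d → ZSeries d L A)
    (n₀ : NIdx d) (h0 : ∀ n, n ≠ n₀ → liftDer δ (u n) = 0) (p : ZPoly d L) :
    liftDer δ (S.jetEval u p) = liftDer δ (u n₀) * S.jetEval u (S.D n₀ p) := by
  classical
  refine liftDer_jetEval_aux δ u (S.D n₀) _ (fun c => ?_) p
  rw [liftDer_jetImage δ u c (N := insert n₀ (finite_D_X_ne_zero hS c).toFinset)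
    (fun n hn => Finset.mem_insert_of_mem ((Set.Finite.mem_toFinset _).mpr hn))]
  rw [Finset.sum_eq_single n₀]
  · intro n _ hn
    rw [h0 n hn, zero_mul]
  · exact fun h => absurd (Finset.mem_insert_self _ _) h

/-- If the jet evolves under a translation in direction `i`, differentiating a substituted
polynomial amounts to applying `bpartial i` to the polynomial. -/
theorem liftDer_jetEval_bpartial (hS : S.Standing) (δ : Derivation ℝ A A)
    (u : NIdx d → ZSeries d L A) (i : Fin d)
    (hu : ∀ n, liftDer δ (u n) = ((n i : ℝ) + 1) • u (n + Finsupp.single i 1)) (p : ZPoly d L) :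
    liftDer δ (S.jetEval u p) = S.jetEval u (S.bpartial i p) := by
  classical
  rw [← one_mul (S.jetEval u (S.bpartial i p))]
  refine liftDer_jetEval_aux δ u (S.bpartial i) 1 (fun c => ?_) p
  have hfin := finite_D_X_ne_zero hS c
  rw [liftDer_jetImage δ u c (N := hfin.toFinset)
    (fun n hn => (Set.Finite.mem_toFinset _).mpr hn), bpartial, MvPolynomial.mkDerivation_X,
    one_mul, finsum_eq_sum_of_support_subset (s := hfin.toFinset), map_sum]
  · refine Finset.sum_congr rfl fun n _ => ?_
    rw [hu, map_smul, map_mul, jetEval_X, smul_mul_assoc]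
    rfl
  · intro n hn
    rw [Set.Finite.coe_toFinset]
    intro h
    rw [Function.mem_support, h, mul_zero, smul_zero] at hn
    exact hn rfl

end Setting

end Derivatives

/-! ### The generating function of the operators `opD` -/

section Universal

variable {d : ℕ} {L : Type*} (S : Setting d L)

namespace Setting

/-- The product `∏ (D^(𝐧))^J(γ,𝐧)` in `opD`. -/
def dPow {M : Set (MIdx d L × NIdx d)} (J : M →₀ ℕ) : Module.End ℝ (ZPoly d L) :=
  J.support.noncommProd (fun p => (S.D p.1.2 : ZPoly d L →ₗ[ℝ] ZPoly d L) ^ J p)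
    (fun p _ q _ _ => (S.D_commute p.1.2 q.1.2).pow_pow (J p) (J q))

theorem dPow_eq_mul_erase {M : Set (MIdx d L × NIdx d)} [DecidableEq M] (J : M →₀ ℕ) (p : M) :
    S.dPow J = (S.D p.1.2 : ZPoly d L →ₗ[ℝ] ZPoly d L) ^ J p *
      (J.support.erase p).noncommProd (fun p => (S.D p.1.2 : ZPoly d L →ₗ[ℝ] ZPoly d L) ^ J p)
        (fun p _ q _ _ => (S.D_commute p.1.2 q.1.2).pow_pow (J p) (J q)) := by
  by_cases hp : p ∈ J.support
  · exact (Finset.mul_noncommProd_erase _ hp _ _).symm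
  · have h0 : J p = 0 := by simpa using hp
    rw [h0, pow_zero, one_mul, dPow]
    exact Finset.noncommProd_congr (Finset.erase_eq_of_notMem hp).symm (fun _ _ => rfl) _

theorem dPow_add_single {M : Set (MIdx d L × NIdx d)} (J : M →₀ ℕ) (p : M) :
    S.dPow (J + Finsupp.single p 1) = S.dPow J * (S.D p.1.2 : ZPoly d L →ₗ[ℝ] ZPoly d L) := by
  classical
  have hs : (J + Finsupp.single p 1).support.erase p = J.support.erase p := by
    ext q
    by_cases h : q = p
    · simp [h]
    · simp [h]
  rw [dPow_eq_mul_erase S _ p, dPow_eq_mul_erase S J p, Finsupp.add_apply, Finsupp.single_eq_same,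
    pow_succ, mul_assoc, mul_assoc]
  congr 1
  have hc : Commute (S.D p.1.2 : ZPoly d L →ₗ[ℝ] ZPoly d L)
      ((J.support.erase p).noncommProd (fun p => (S.D p.1.2 : ZPoly d L →ₗ[ℝ] ZPoly d L) ^ J p)
        (fun p _ q _ _ => (S.D_commute p.1.2 q.1.2).pow_pow (J p) (J q))) :=
    Finset.noncommProd_commute _ _ _ _ fun q _ => (S.D_commute p.1.2 q.1.2).pow_right (J q)
  rw [← hc.eq]
  congr 1
  refine Finset.noncommProd_congr hs (fun q hq => ?_) _
  have : q ≠ p := Finset.ne_of_mem_erase hq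
  simp [this]

/-- The recursion in `J` of the operators `opD`, which mirrors differentiation in the generator
`Z_p` on the side of the generating function. -/
theorem opD_add_single {M : Set (MIdx d L × NIdx d)} (J : M →₀ ℕ) (p : M) (m : NIdx d)
    (q : ZPoly d L) :
    ((J p : ℝ) + 1) • S.opD (J + Finsupp.single p 1) m q =
      MvPolynomial.monomial p.1.1 1 * S.opD J m (S.D p.1.2 q) := by
  have e1 := S.dPow_add_single J p
  simp only [dPow] at e1
  rw [opD, opD, e1]
  have e2 : (J + Finsupp.single p 1).sum (fun p a => a • p.1.1) =
      p.1.1 + J.sum fun p a => a • p.1.1 := by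
    classical
    rw [Finsupp.sum_add_index (by simp) (by intros; rw [add_smul]),
      Finsupp.sum_single_index (by simp), one_smul, add_comm]
  rw [e2]
  have e3 : ((J + Finsupp.single p 1).prod fun _ a => (a.factorial : ℝ)) =
      ((J p : ℝ) + 1) * J.prod fun _ a => (a.factorial : ℝ) := kFact_add_single J p
  rw [e3]
  simp only [LinearMap.smul_apply, Module.End.mul_apply, LinearMap.mulLeft_apply, smul_smul,
    Derivation.coeFn_coe]
  rw [mul_smul_comm, ← mul_assoc, MvPolynomial.monomial_mul, one_mul]
  congr 1
  have : ((J p : ℝ) + 1) ≠ 0 := by positivity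
  rw [mul_assoc, mul_inv, ← mul_assoc, mul_inv_cancel₀ this, one_mul]

theorem opD_zero {M : Set (MIdx d L × NIdx d)} (m : NIdx d) (q : ZPoly d L) :
    S.opD (0 : M →₀ ℕ) m q = (kFact m)⁻¹ • S.bpartialPow m q := by
  have : kFact m = nFactorial m := by
    rw [kFact, nFactorial, Finsupp.prod_fintype _ _ (by simp)]
  rw [opD, this]
  simp [MvPolynomial.monomial_zero']

end Setting

/-- Evaluating the generators `Z_(γ,𝐧)` at zero extracts the coefficients of the pure monomials in
`Z_1, …, Z_d`. -/
theorem coeff_killCompl_inr {α : Type*} (q : MvPolynomial (α ⊕ Fin d) ℝ) (m : NIdx d) :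
    MvPolynomial.coeff m (MvPolynomial.killCompl (f := (Sum.inr : Fin d → α ⊕ Fin d))
      Sum.inr_injective q) = MvPolynomial.coeff (Finsupp.sumElim 0 m) q := by
  classical
  induction q using MvPolynomial.induction_on' with
  | monomial s a =>
    have hm : Finsupp.sumElim (0 : α →₀ ℕ) m = m.mapDomain Sum.inr := by
      ext (x | x)
      · rw [Finsupp.mapDomain_of_notMem_range _ _ (by simp)]
        rfl
      · rw [Finsupp.mapDomain_apply Sum.inr_injective]
        rfl
    by_cases hs : s ∈ Set.range (Finsupp.mapDomain (Sum.inr : Fin d → α ⊕ Fin d))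
    · obtain ⟨t, rfl⟩ := hs
      rw [MvPolynomial.killCompl_monomial_mapDomain, MvPolynomial.coeff_monomial,
        MvPolynomial.coeff_monomial, hm]
      congr 1
      exact propext ⟨fun h => by rw [h], fun h => Finsupp.mapDomain_injective Sum.inr_injective h⟩
    · rw [MvPolynomial.coeff_monomial, if_neg (fun h => hs ⟨m, by rw [h, hm]⟩)]
      rw [MvPolynomial.killCompl_monomial_eq_zero_of_not_subset _ _ fun h => hs
        ⟨_, Finsupp.mapDomain_comapDomain _ Sum.inr_injective s h⟩, MvPolynomial.coeff_zero]
  | add p q hp hq => rw [map_add, MvPolynomial.coeff_add, hp, hq, MvPolynomial.coeff_add]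

section Jet

variable {A : Type*} [CommRing A] [Algebra ℝ A]

open Classical in
/-- The power series `∑_γ v(γ,𝐧) z^γ` over the `γ` with `(γ,𝐧) ∈ M`. -/
def charSeries {M : Set (MIdx d L × NIdx d)} (v : M → A) (n : NIdx d) : ZSeries d L A :=
  fun β => if h : (β, n) ∈ M then v ⟨(β, n), h⟩ else 0

/-- The jet of the map `Γ^*` given by the values `v` of a character on the generators. -/
def charJet {M : Set (MIdx d L × NIdx d)} (v : M ⊕ Fin d → A) : NIdx d → ZSeries d L A :=
  jetOf (fun i => v (Sum.inr i)) (charSeries fun p => v (Sum.inl p))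

theorem coeff_charSeries {M : Set (MIdx d L × NIdx d)} (v : M → A) {n : NIdx d} {β : MIdx d L}
    (h : (β, n) ∈ M) : MvPowerSeries.coeff β (charSeries v n) = v ⟨(β, n), h⟩ := by
  rw [MvPowerSeries.coeff_apply, charSeries, dif_pos h]

theorem coeff_charSeries_of_notMem {M : Set (MIdx d L × NIdx d)} (v : M → A) {n : NIdx d}
    {β : MIdx d L} (h : (β, n) ∉ M) : MvPowerSeries.coeff β (charSeries v n) = 0 := by
  rw [MvPowerSeries.coeff_apply, charSeries, dif_neg h]

theorem mapAlgHom_charJet {A' : Type*} [CommRing A'] [Algebra ℝ A']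
    {M : Set (MIdx d L × NIdx d)} (f : A →ₐ[ℝ] A') (v : M ⊕ Fin d → A) (n : NIdx d) :
    MvPowerSeries.mapAlgHom f (charJet v n) = charJet (fun x => f (v x)) n := by
  rw [charJet, charJet, mapAlgHom_jetOf]
  congr 1
  funext n
  ext β
  rw [MvPowerSeries.mapAlgHom_apply, MvPowerSeries.coeff_map]
  by_cases h : (β, n) ∈ M
  · rw [coeff_charSeries _ h, coeff_charSeries _ h]
    rfl
  · rw [coeff_charSeries_of_notMem _ h, coeff_charSeries_of_notMem _ h, map_zero]

end Jet

namespace Setting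

theorem jetEval_jetOf_zero (p : ZPoly d L) :
    S.jetEval (jetOf (0 : Fin d → ℝ) (0 : NIdx d → ZSeries d L ℝ)) p =
      (p : MvPowerSeries (Coord d L) ℝ) := by
  classical
  have hX : ∀ n, jetOf (0 : Fin d → ℝ) (0 : NIdx d → ZSeries d L ℝ) n =
      MvPowerSeries.X (Sum.inr n) := by
    intro n
    rw [jetOf, Pi.zero_apply, add_zero]
    exact linSeries_single n _ (shiftCoef_self 0 n) fun N hN => shiftCoef_zero hN
  have : S.jetEval (jetOf (0 : Fin d → ℝ) (0 : NIdx d → ZSeries d L ℝ)) =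
      MvPolynomial.coeToMvPowerSeries.algHom ℝ := by
    refine MvPolynomial.algHom_ext fun c => ?_
    rw [jetEval_X, MvPolynomial.coeToMvPowerSeries.algHom_apply, Algebra.algebraMap_self,
      MvPowerSeries.map_id, RingHom.id_apply, MvPolynomial.coe_X]
    rcases c with ⟨l, k⟩ | n
    · simp only [jetImage]
      have hw : (fun n => jetOf (0 : Fin d → ℝ) (0 : NIdx d → ZSeries d L ℝ) n -
          MvPowerSeries.X (Sum.inr n)) = 0 := by
        funext n
        rw [hX, sub_self]
        rfl
      rw [hw]
      ext β
      rw [coeff_real_smul, S.coeff_shiftSeries (Finset.subset_insert k (noiseSupport l β)),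
        Finset.sum_eq_single k]
      · rw [shiftTerm, if_pos (reaches_refl l k), tsub_self, dp_zero, mul_one, coeff_real_smul,
          smul_smul, inv_mul_cancel₀ (kFact_pos k).ne', one_smul]
      · intro k' _ hk'
        rw [shiftTerm]
        split_ifs with h
        · rw [dp_zero_fun, if_neg, mul_zero, smul_zero]
          intro h0
          exact hk' (le_antisymm (tsub_eq_zero_iff_le.mp h0) h.1)
        · rfl
      · exact fun h => absurd (Finset.mem_insert_self _ _) h
    · exact hX n
  rw [this, MvPolynomial.coeToMvPowerSeries.algHom_apply, Algebra.algebraMap_self,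
    MvPowerSeries.map_id, RingHom.id_apply]

/-- The generic translation. -/
def genericShift (d : ℕ) (L : Type*) : NIdx d → ZSeries d L (MvPolynomial (Fin d) ℝ) :=
  jetOf MvPolynomial.X 0

theorem liftDer_genericShift (i : Fin d) (n : NIdx d) :
    liftDer (MvPolynomial.pderiv i) (genericShift d L n) =
      ((n i : ℝ) + 1) • genericShift d L (n + Finsupp.single i 1) := by
  classical
  rw [genericShift, jetOf, jetOf, Pi.zero_apply, Pi.zero_apply, add_zero, add_zero,
    liftDer_linSeries, ← linSeries_smul]
  congr 1
  funext N
  refine derivation_shiftCoef _ _ i (fun j => ?_) n N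
  rw [MvPolynomial.pderiv_X, Pi.single_apply]

variable {S}

/-- Taylor coefficients in the `i`-th translation variable are given by powers of `bpartial i`. -/
theorem coeff_genericShift_pow (hS : S.Standing) (β : MIdx d L) (i : Fin d) (a : ℕ) (m : NIdx d)
    (hm : m i = 0) (p : ZPoly d L) :
    MvPolynomial.coeff m (MvPowerSeries.coeff β (S.jetEval (genericShift d L)
      (((S.bpartial i : ZPoly d L →ₗ[ℝ] ZPoly d L) ^ a) p))) =
    (a.factorial : ℝ) * MvPolynomial.coeff (m + Finsupp.single i a)
      (MvPowerSeries.coeff β (S.jetEval (genericShift d L) p)) := by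
  have step : ∀ (m : NIdx d) (q : ZPoly d L),
      MvPolynomial.coeff m (MvPowerSeries.coeff β (S.jetEval (genericShift d L)
        (S.bpartial i q))) = ((m i : ℝ) + 1) * MvPolynomial.coeff (m + Finsupp.single i 1)
      (MvPowerSeries.coeff β (S.jetEval (genericShift d L) q)) := by
    intro m q
    rw [← liftDer_jetEval_bpartial hS (MvPolynomial.pderiv i) (genericShift d L) i
      (fun n => liftDer_genericShift i n), coeff_liftDer, MvPolynomial.coeff_pderiv, mul_comm]
  induction a generalizing p with
  | zero => simp
  | succ a ih =>
    rw [pow_succ, Module.End.mul_apply, ih, Derivation.coeFn_coe, step, add_assoc,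
      ← Finsupp.single_add, Nat.factorial_succ]
    simp only [Finsupp.add_apply, hm, Finsupp.single_eq_same, zero_add, Nat.cast_mul, Nat.cast_add,
      Nat.cast_one]
    ring

theorem coeff_genericShift_list (hS : S.Standing) (β : MIdx d L) (m₀ : NIdx d) (l : List (Fin d))
    (hl : l.Nodup) (m : NIdx d) (hm : ∀ i ∈ l, m i = 0) (p : ZPoly d L) :
    MvPolynomial.coeff m (MvPowerSeries.coeff β (S.jetEval (genericShift d L)
      ((l.map fun i => (S.bpartial i : ZPoly d L →ₗ[ℝ] ZPoly d L) ^ m₀ i).prod p))) =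
    (l.map fun i => ((m₀ i).factorial : ℝ)).prod *
      MvPolynomial.coeff (m + (l.map fun i => Finsupp.single i (m₀ i)).sum)
      (MvPowerSeries.coeff β (S.jetEval (genericShift d L) p)) := by
  induction l generalizing m with
  | nil => simp
  | cons i l ih =>
    rw [List.nodup_cons] at hl
    rw [List.map_cons, List.prod_cons, Module.End.mul_apply,
      coeff_genericShift_pow hS β i (m₀ i) m (hm i (List.mem_cons_self)),
      ih hl.2, List.map_cons, List.prod_cons, List.map_cons, List.sum_cons, add_assoc, mul_assoc]
    intro j hj
    have hij : j ≠ i := fun h => hl.1 (h ▸ hj)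
    rw [Finsupp.add_apply, hm j (List.mem_cons_of_mem _ hj), Finsupp.single_apply,
      if_neg (Ne.symm hij), add_zero]

/-- The case `J = 0` of `coeff_genericJet`: the Taylor coefficients in the translation variables of
the substitution of the translated jet are the operators `∂^𝐦 / 𝐦!`. -/
theorem coeff_genericShift (hS : S.Standing) (β : MIdx d L) (m : NIdx d) (p : ZPoly d L) :
    MvPolynomial.coeff m (MvPowerSeries.coeff β (S.jetEval (genericShift d L) p)) =
      (kFact m)⁻¹ * MvPolynomial.coeff β (S.bpartialPow m p) := by
  classical
  have h := coeff_genericShift_list hS β m (List.finRange d) (List.nodup_finRange d) 0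
    (fun _ _ => rfl) p
  have e1 : ((List.finRange d).map fun i => ((m i).factorial : ℝ)).prod = kFact m := by
    rw [kFact, Finsupp.prod_fintype _ _ (by simp), ← List.prod_ofFn, List.ofFn_eq_map]
  have e2 : ((List.finRange d).map fun i => Finsupp.single i (m i)).sum = m := by
    rw [← List.ofFn_eq_map, List.sum_ofFn]
    exact Finsupp.univ_sum_single m
  rw [e1, e2, zero_add] at h
  -- the constant coefficient is read off at translation zero
  have h0 : ∀ q : ZPoly d L,
      MvPolynomial.coeff 0 (MvPowerSeries.coeff β (S.jetEval (genericShift d L) q)) =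
        MvPolynomial.coeff β q := by
    intro q
    have e3 := mapAlgHom_jetEval S (MvPolynomial.aeval (0 : Fin d → ℝ)) (genericShift d L) q
    have e4 : (fun n => MvPowerSeries.mapAlgHom (MvPolynomial.aeval (0 : Fin d → ℝ))
        (genericShift d L n)) = jetOf (0 : Fin d → ℝ) (0 : NIdx d → ZSeries d L ℝ) := by
      funext n
      rw [genericShift, mapAlgHom_jetOf]
      congr 1
      · funext i
        simp
    rw [e4, jetEval_jetOf_zero] at e3
    have e5 := congrArg (MvPowerSeries.coeff β) e3
    rw [MvPolynomial.coeff_coe, MvPowerSeries.mapAlgHom_apply, MvPowerSeries.coeff_map] at e5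
    rw [← e5, ← MvPolynomial.constantCoeff_eq]
    simp
  rw [h0] at h
  rw [bpartialPow, h, ← mul_assoc, inv_mul_cancel₀ (kFact_pos m).ne', one_mul]

/-- The jet of the generic character. -/
def genericJet (M : Set (MIdx d L × NIdx d)) :
    NIdx d → ZSeries d L (MvPolynomial (M ⊕ Fin d) ℝ) :=
  charJet MvPolynomial.X

theorem liftDer_genericJet (M : Set (MIdx d L × NIdx d)) (p : M) (n : NIdx d) :
    liftDer (MvPolynomial.pderiv (Sum.inl p)) (genericJet M n) =
      open Classical in if n = p.1.2 then MvPowerSeries.monomial p.1.1 1 else 0 := by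
  classical
  rw [genericJet, charJet, jetOf, map_add, liftDer_linSeries]
  have h1 : (linSeries (L := L) fun N => (MvPolynomial.pderiv (R := ℝ) (Sum.inl p))
      (shiftCoef (fun i => MvPolynomial.X (Sum.inr i : M ⊕ Fin d)) n N)) = 0 := by
    symm
    refine ext_linSeries (fun N => ?_) fun _ _ => rfl
    rw [derivation_shiftCoef_eq_zero]
    · rfl
    · intro j
      rw [MvPolynomial.pderiv_X, Pi.single_apply, if_neg (by simp)]
  rw [h1, zero_add]
  ext1 β
  rw [coeff_liftDer]
  by_cases h : (β, n) ∈ M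
  · rw [coeff_charSeries _ h, MvPolynomial.pderiv_X, Pi.single_apply]
    by_cases hn : n = p.1.2
    · rw [if_pos hn, MvPowerSeries.coeff_monomial]
      congr 1
      rw [Sum.inl.injEq, Subtype.ext_iff, Prod.ext_iff]
      simp [hn]
    · rw [if_neg hn, if_neg, MvPowerSeries.coeff_zero]
      intro e
      rw [Sum.inl.injEq] at e
      exact hn (by rw [← e])
  · rw [coeff_charSeries_of_notMem _ h, map_zero]
    split_ifs with hn
    · rw [MvPowerSeries.coeff_monomial, if_neg]
      rintro rfl
      exact h (by rw [hn]; exact p.2)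
    · rw [MvPowerSeries.coeff_zero]

/-- The operators `opD` are the Taylor coefficients, in the values of the character, of the
substitution of the generic jet. -/
theorem coeff_genericJet (hS : S.Standing) (M : Set (MIdx d L × NIdx d)) (J : M →₀ ℕ)
    (m : NIdx d) (β : MIdx d L) (q : ZPoly d L) :
    MvPolynomial.coeff (Finsupp.sumElim J m)
      (MvPowerSeries.coeff β (S.jetEval (genericJet M) q)) =
      MvPolynomial.coeff β (S.opD J m q) := by
  classical
  induction hd : J.degree using Nat.strong_induction_on generalizing J β q with
  | _ N ih =>
    by_cases hJ : J = 0
    · subst hJ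
      -- no generator `Z_(γ,𝐧)` occurs: evaluating these at zero leaves the translated jet
      rw [opD_zero, MvPolynomial.coeff_smul, smul_eq_mul, ← coeff_genericShift hS,
        ← coeff_killCompl_inr]
      have e1 := mapAlgHom_jetEval S (MvPolynomial.killCompl (R := ℝ)
        (f := (Sum.inr : Fin d → M ⊕ Fin d)) Sum.inr_injective) (genericJet M) q
      have e2 : (fun n => MvPowerSeries.mapAlgHom (MvPolynomial.killCompl (R := ℝ)
          (f := (Sum.inr : Fin d → M ⊕ Fin d)) Sum.inr_injective) (genericJet M n)) =
          genericShift d L := by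
        funext n
        rw [genericJet, mapAlgHom_charJet, charJet, genericShift]
        congr 1
        · funext i
          rw [← MvPolynomial.rename_X (R := ℝ) (Sum.inr : Fin d → M ⊕ Fin d) i,
            MvPolynomial.killCompl_rename_app]
        · funext n
          ext1 β
          by_cases h : (β, n) ∈ M
          · rw [coeff_charSeries _ h, MvPolynomial.killCompl, MvPolynomial.aeval_X, dif_neg (by simp)]
            rfl
          · rw [coeff_charSeries_of_notMem _ h]
            rfl
      rw [e2] at e1
      rw [← e1, MvPowerSeries.mapAlgHom_apply, MvPowerSeries.coeff_map]
      rfl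
    -- differentiating in the generator `Z_p` lowers `J` by `p` on both sides
    · obtain ⟨J', p, rfl, hlt⟩ := exists_eq_add_single J hJ
      have hne : ((J' p : ℝ) + 1) ≠ 0 := by positivity
      have e1 := liftDer_jetEval_D hS (MvPolynomial.pderiv (Sum.inl p)) (genericJet M) p.1.2
        (fun n hn => by rw [liftDer_genericJet, if_neg hn]) q
      rw [liftDer_genericJet, if_pos rfl] at e1
      have e2 := congrArg (fun f => MvPolynomial.coeff (Finsupp.sumElim J' m)
        (MvPowerSeries.coeff β f)) e1
      simp only [coeff_liftDer, MvPolynomial.coeff_pderiv] at e2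
      have e3 : Finsupp.sumElim J' m + Finsupp.single (Sum.inl p) 1 =
          Finsupp.sumElim (J' + Finsupp.single p 1) m := by
        ext (x | x)
        · simp [Finsupp.single_apply]
        · simp
      have e4 : (Finsupp.sumElim J' m) (Sum.inl p) = J' p := rfl
      rw [e3, e4, MvPowerSeries.coeff_monomial_mul] at e2
      have e5 := congrArg (MvPolynomial.coeff β) (S.opD_add_single J' p m q)
      rw [MvPolynomial.coeff_smul, smul_eq_mul, MvPolynomial.coeff_monomial_mul'] at e5
      refine mul_left_cancel₀ hne ?_
      rw [e5, mul_comm, e2]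
      split_ifs with hle
      · rw [one_mul, one_mul, ih _ (hd ▸ hlt) J' _ _ rfl]
      · rw [MvPolynomial.coeff_zero]

end Setting

end Universal

/-! ### The matrices of `Γ^*` as substitutions -/

section GammaStar

variable {d : ℕ} {L : Type*} {S : Setting d L}

theorem jetAdm_charJet {A : Type*} [CommRing A] [Algebra ℝ A] {M : Set (MIdx d L × NIdx d)}
    (h0 : ∀ n, ((0 : MIdx d L), n) ∉ M) (hf : ∀ β, {n | (β, n) ∈ M}.Finite)
    (v : M ⊕ Fin d → A) : JetAdm (charJet v) := by
  refine jetAdm_jetOf _ (fun n => coeff_charSeries_of_notMem _ (h0 n)) fun β => ?_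
  refine (hf β).subset fun n hn => ?_
  by_contra h
  exact hn (coeff_charSeries_of_notMem _ h)

/-- The jet of the character `f`. -/
def jetOfChar {M : Set (MIdx d L × NIdx d)} (f : MvPolynomial (M ⊕ Fin d) ℝ →ₐ[ℝ] ℝ) :
    NIdx d → ZSeries d L ℝ :=
  charJet fun x => f (MvPolynomial.X x)

namespace Setting

/-- The entries of the substitution attached to a character are the values of the character at the
entries of the generic substitution. -/
theorem coeff_jetMonomial_jetOfChar {M : Set (MIdx d L × NIdx d)}
    (f : MvPolynomial (M ⊕ Fin d) ℝ →ₐ[ℝ] ℝ) (β γ : MIdx d L) :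
    MvPowerSeries.coeff β (S.jetMonomial (jetOfChar f) γ) =
      f (MvPowerSeries.coeff β (S.jetMonomial (genericJet M) γ)) := by
  have h := S.mapAlgHom_jetMonomial f (genericJet M) γ
  simp only [genericJet, mapAlgHom_charJet] at h
  change _ = S.jetMonomial (jetOfChar f) γ at h
  rw [← h, MvPowerSeries.mapAlgHom_apply, MvPowerSeries.coeff_map]
  rfl

/-- The matrix `Γ^*` of a character is the matrix of the substitution of its jet: the character is
applied to the generating function of the operators `opD`. -/
theorem gammaStar_eq (hS : S.Standing) {M : Set (MIdx d L × NIdx d)}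
    (f : MvPolynomial (M ⊕ Fin d) ℝ →ₐ[ℝ] ℝ) {β γ : MIdx d L} (hβ : β ∈ S.allIdx)
    (hγ : γ ∈ S.allIdx) :
    S.gammaStar f β γ = MvPowerSeries.coeff β (S.jetMonomial (jetOfChar f) γ) := by
  rw [gammaStar, if_pos ⟨hβ, hγ⟩, coeff_jetMonomial_jetOfChar]
  set q := MvPowerSeries.coeff β (S.jetMonomial (genericJet M) γ) with hq
  have hc : ∀ s, MvPolynomial.coeff s q =
      S.coefD (Finsupp.sumFinsuppEquivProdFinsupp s).1 (Finsupp.sumFinsuppEquivProdFinsupp s).2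
        β γ := by
    intro s
    rw [coefD, ← coeff_genericJet hS M, jetEval_monomial]
    congr 1
    exact (Finsupp.sumFinsuppEquivProdFinsupp.symm_apply_apply s).symm
  have h1 : f q = ∑ᶠ s, f (MvPolynomial.monomial s 1) * MvPolynomial.coeff s q := by
    rw [finsum_eq_sum_of_support_subset (s := q.support)]
    · conv_lhs => rw [q.as_sum, map_sum]
      refine Finset.sum_congr rfl fun s _ => ?_
      have : MvPolynomial.monomial s (MvPolynomial.coeff s q) =
          MvPolynomial.coeff s q • (MvPolynomial.monomial s (1 : ℝ)) := by
        rw [MvPolynomial.smul_monomial, smul_eq_mul, mul_one]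
      rw [this, map_smul, smul_eq_mul, mul_comm]
    · intro s hs
      rw [Function.mem_support] at hs
      exact Finset.mem_coe.mpr (MvPolynomial.mem_support_iff.mpr (right_ne_zero_of_mul hs))
  rw [h1, ← finsum_comp_equiv Finsupp.sumFinsuppEquivProdFinsupp]
  refine finsum_congr fun s => ?_
  rw [hc]
  congr 3
  exact congrArg _ (Finsupp.sumFinsuppEquivProdFinsupp.symm_apply_apply s)

/-- Only finitely many operators contribute to a row, since the entries of the generating function
are polynomials in the generators and its rows are finite. -/
theorem finiteRows (hS : S.Standing) {M : Set (MIdx d L × NIdx d)}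
    (h0 : ∀ n, ((0 : MIdx d L), n) ∉ M) (hf : ∀ β, {n | (β, n) ∈ M}.Finite) :
    S.FiniteRows M := by
  intro β _
  have hu : JetAdm (genericJet M) := jetAdm_charJet h0 hf _
  have hfin : (⋃ γ ∈ {γ | MvPowerSeries.coeff β (S.jetMonomial (genericJet M) γ) ≠ 0},
      (fun s => (γ, Finsupp.sumFinsuppEquivProdFinsupp s)) ''
        ((MvPowerSeries.coeff β (S.jetMonomial (genericJet M) γ)).support :
          Set (M ⊕ Fin d →₀ ℕ))).Finite :=
    (S.finite_jetMonomial hu β).biUnion fun γ _ => (Finset.finite_toSet _).image _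
  refine hfin.subset ?_
  rintro ⟨γ, J, m⟩ ⟨_, h⟩
  have hc : MvPolynomial.coeff (Finsupp.sumElim J m)
      (MvPowerSeries.coeff β (S.jetMonomial (genericJet M) γ)) ≠ 0 := by
    rw [← jetEval_monomial, coeff_genericJet hS M]
    exact h
  simp only [Set.mem_iUnion]
  refine ⟨γ, ?_, Finsupp.sumElim J m, ?_, ?_⟩
  · intro h0
    rw [h0] at hc
    exact hc rfl
  · exact Finset.mem_coe.mpr (MvPolynomial.mem_support_iff.mpr hc)
  · exact congrArg (Prod.mk γ) (Finsupp.sumFinsuppEquivProdFinsupp.apply_symm_apply (J, m))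

end Setting

end GammaStar

/-! ### Gradings and filtrations -/

section Gradings

variable {d : ℕ} {L : Type*}

theorem bracket_add (β γ : MIdx d L) : bracket (β + γ) = bracket β + bracket γ := by
  classical
  refine Finsupp.sum_add_index' ?_ ?_
  · rintro (⟨l, k⟩ | n) <;> simp
  · rintro (⟨l, k⟩ | n) a b <;> push_cast <;> ring

theorem noiseHom_add (β γ : MIdx d L) : noiseHom (β + γ) = noiseHom β + noiseHom γ := by
  classical
  refine Finsupp.sum_add_index' ?_ ?_
  · rintro (⟨_ | l, k⟩ | n) <;> simp
  · rintro (⟨_ | l, k⟩ | n) a b <;> simp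

theorem Setting.hom_add (S : Setting d L) (β γ : MIdx d L) :
    S.hom (β + γ) = S.hom β + S.hom γ := by
  classical
  refine Finsupp.sum_add_index' ?_ ?_
  · rintro (⟨l, k⟩ | n) <;> simp
  · rintro (⟨l, k⟩ | n) a b <;> push_cast <;> ring

/-- The bracket as an additive map. -/
def bracketHom : MIdx d L →+ ℤ := AddMonoidHom.mk' bracket bracket_add

/-- The noise homogeneity as an additive map. -/
def noiseHomHom : MIdx d L →+ ℕ where
  toFun := noiseHom
  map_zero' := rfl
  map_add' := noiseHom_add

/-- The homogeneity as an additive map. -/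
def Setting.homHom (S : Setting d L) : MIdx d L →+ ℝ := AddMonoidHom.mk' S.hom S.hom_add

theorem bracket_eNoise (l : Option L) (k : NIdx d →₀ ℕ) :
    bracket (eNoise l k) = 1 - (k.degree : ℤ) := by
  simp [bracket, eNoise]

theorem bracket_ePoly (n : NIdx d) : bracket (ePoly L n) = 1 := by
  simp [bracket, ePoly]

theorem noiseHom_ePoly (n : NIdx d) : noiseHom (ePoly L n) = 0 := by
  simp [noiseHom, ePoly]

theorem noiseHom_eNoise_some (l : L) (k : NIdx d →₀ ℕ) : noiseHom (eNoise (some l) k) = 1 := by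
  simp [noiseHom, eNoise]

theorem noiseHom_eNoise_none (k : NIdx d →₀ ℕ) : noiseHom (eNoise (none : Option L) k) = 0 := by
  simp [noiseHom, eNoise]

theorem Setting.hom_eNoise (S : Setting d L) (l : Option L) (k : NIdx d →₀ ℕ) :
    S.hom (eNoise l k) = S.alpha l + k.sum fun n a => (S.eta - S.deg n) * (a : ℝ) := by
  simp [hom, eNoise]

theorem Setting.hom_ePoly (S : Setting d L) (n : NIdx d) :
    S.hom (ePoly L n) = S.deg n - S.eta := by
  simp [hom, ePoly]

theorem addHom_eq_sum {W : Type*} [AddCommMonoid W] (f : MIdx d L →+ W) (γ : MIdx d L) :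
    f γ = γ.sum fun c e => e • f (Finsupp.single c 1) := by
  conv_lhs => rw [← Finsupp.sum_single γ]
  rw [map_finsuppSum]
  refine Finsupp.sum_congr fun c _ => ?_
  rw [← map_nsmul]
  simp

/-- A multiplicative filtration of the coefficients of power series: `mem β a x` says that `x` may
be the coefficient of `z^β` in a power series of level `a`. -/
structure Filtration (d : ℕ) (L A W : Type*) [CommRing A] [Algebra ℝ A] [AddCommMonoid W] where
  mem : MIdx d L → W → A → Prop
  zero : ∀ β a, mem β a 0
  add : ∀ β a x y, mem β a x → mem β a y → mem β a (x + y)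
  smul : ∀ β a (r : ℝ) x, mem β a x → mem β a (r • x)
  mul : ∀ β β' a a' x x', mem β a x → mem β' a' x' → mem (β + β') (a + a') (x * x')
  one : mem 0 0 1

namespace Filtration

variable {A W : Type*} [CommRing A] [Algebra ℝ A] [AddCommMonoid W] (Φ : Filtration d L A W)

/-- All coefficients of `F` are of level `a`. -/
def Level (a : W) (F : ZSeries d L A) : Prop := ∀ β, Φ.mem β a (MvPowerSeries.coeff β F)

variable {Φ}

theorem mem_sum {ι : Type*} {s : Finset ι} {g : ι → A} {β : MIdx d L} {a : W}
    (h : ∀ i ∈ s, Φ.mem β a (g i)) : Φ.mem β a (∑ i ∈ s, g i) := by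
  classical
  induction s using Finset.induction_on with
  | empty => exact Φ.zero β a
  | insert i s hi ih =>
    rw [Finset.sum_insert hi]
    exact Φ.add _ _ _ _ (h i (Finset.mem_insert_self _ _))
      (ih fun j hj => h j (Finset.mem_insert_of_mem hj))

theorem Level.mul {a b : W} {F G : ZSeries d L A} (hF : Φ.Level a F) (hG : Φ.Level b G) :
    Φ.Level (a + b) (F * G) := by
  classical
  intro β
  rw [MvPowerSeries.coeff_mul]
  refine mem_sum fun p hp => ?_
  rw [Finset.HasAntidiagonal.mem_antidiagonal] at hp
  rw [← hp]
  exact Φ.mul _ _ _ _ _ _ (hF p.1) (hG p.2)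

theorem Level.one : Φ.Level 0 (1 : ZSeries d L A) := by
  classical
  intro β
  rw [MvPowerSeries.coeff_one]
  split_ifs with h
  · rw [h]
    exact Φ.one
  · exact Φ.zero _ _

theorem Level.pow {a : W} {F : ZSeries d L A} (hF : Φ.Level a F) (e : ℕ) :
    Φ.Level (e • a) (F ^ e) := by
  induction e with
  | zero =>
    rw [zero_smul, pow_zero]
    exact Level.one
  | succ e ih =>
    rw [succ_nsmul, pow_succ]
    exact ih.mul hF

theorem Level.prod {ι : Type*} {s : Finset ι} {a : ι → W} {F : ι → ZSeries d L A}
    (h : ∀ i ∈ s, Φ.Level (a i) (F i)) : Φ.Level (∑ i ∈ s, a i) (∏ i ∈ s, F i) := by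
  classical
  induction s using Finset.induction_on with
  | empty => exact Level.one
  | insert i s hi ih =>
    rw [Finset.sum_insert hi, Finset.prod_insert hi]
    exact (h i (Finset.mem_insert_self _ _)).mul
      (ih fun j hj => h j (Finset.mem_insert_of_mem hj))

theorem Level.smul {a : W} {F : ZSeries d L A} (hF : Φ.Level a F) (r : ℝ) :
    Φ.Level a (r • F) := fun β => Φ.smul _ _ _ _ (hF β)

theorem Level.add {a : W} {F G : ZSeries d L A} (hF : Φ.Level a F) (hG : Φ.Level a G) :
    Φ.Level a (F + G) := fun β => Φ.add _ _ _ _ (hF β) (hG β)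

theorem Level.sub {a : W} {F G : ZSeries d L A} (hF : Φ.Level a F) (hG : Φ.Level a G) :
    Φ.Level a (F - G) := by
  have := hF.add (hG.smul (-1))
  rwa [neg_one_smul, ← sub_eq_add_neg] at this

theorem Level.X {c : Coord d L} {a : W} (h : Φ.mem (Finsupp.single c 1) a 1) :
    Φ.Level a (MvPowerSeries.X c : ZSeries d L A) := by
  classical
  intro β
  rw [MvPowerSeries.coeff_X]
  split_ifs with hβ
  · rw [hβ]
    exact h
  · exact Φ.zero _ _

theorem Level.dp {w : NIdx d → ZSeries d L A} {a : NIdx d → W} {K : NIdx d →₀ ℕ}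
    (h : ∀ n ∈ K.support, Φ.Level (a n) (w n)) :
    Φ.Level (K.sum fun n e => e • a n) (MultiIndexModel.dp w K) := by
  rw [MultiIndexModel.dp, Finsupp.prod, Finsupp.sum]
  exact Level.prod fun n hn => ((h n hn).pow _).smul _

variable {S : Setting d L} {u : NIdx d → ZSeries d L A}

/-- The image of `z_(𝔩,k)` has the level of `z_(𝔩,k)` if all its terms do. -/
theorem level_jetImage_inl {f : MIdx d L →+ W} (l : Option L) (k : NIdx d →₀ ℕ)
    (hX : ∀ l k, Φ.mem (eNoise l k) (f (eNoise l k)) 1)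
    (hu : ∀ n, S.deg n < S.eta → Φ.Level (f (ePoly L n)) (u n - MvPowerSeries.X (Sum.inr n)))
    (hred : ∀ k', S.Reaches l k k' → ∀ β x,
      Φ.mem β (f (eNoise l k') + (k' - k).sum fun n e => e • f (ePoly L n)) x →
        Φ.mem β (f (eNoise l k)) x) :
    Φ.Level (f (eNoise l k)) (S.jetImage u (Sum.inl (l, k))) := by
  classical
  refine Level.smul (fun β => ?_) _
  rw [S.coeff_shiftSeries (Finset.Subset.refl _), map_sum]
  refine mem_sum fun k' _ => ?_
  rw [Setting.shiftTerm]
  split_ifs with h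
  · refine hred k' h β _ (Level.smul (Level.mul (Level.X (hX l k')) (Level.dp fun n hn => hu n ?_))
      _ β)
    rw [Finsupp.mem_support_iff, Finsupp.tsub_apply] at hn
    rcases h.2 with rfl | h2
    · simp at hn
    · exact h2.deg_lt (n := n) (by omega)
  · exact Φ.zero _ _

/-- An additive weight `f` is respected by the substitution on monomials as soon as it is on
coordinates. -/
theorem level_jetMonomial {f : MIdx d L →+ W} {γ : MIdx d L}
    (h : ∀ c ∈ γ.support, Φ.Level (f (Finsupp.single c 1)) (S.jetImage u c)) :
    Φ.Level (f γ) (S.jetMonomial u γ) := by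
  rw [addHom_eq_sum, Setting.jetMonomial, Finsupp.prod, Finsupp.sum]
  exact Level.prod fun c hc => (h c hc).pow _

end Filtration

/-- The filtration by a condition on the multi-indices of the nonzero coefficients. -/
def supportFiltration (A : Type*) {W : Type*} [CommRing A] [Algebra ℝ A] [AddCommMonoid W]
    (P : MIdx d L → W → Prop) (h0 : P 0 0)
    (hadd : ∀ β β' a a', P β a → P β' a' → P (β + β') (a + a')) : Filtration d L A W where
  mem β a x := x ≠ 0 → P β a
  zero _ _ h := absurd rfl h
  add β a x y hx hy hne := by
    by_cases h : x = 0
    · rw [h, zero_add] at hne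
      exact hy hne
    · exact hx h
  smul β a r x hx hne := hx fun h => hne (by rw [h, smul_zero])
  mul β β' a a' x x' hx hx' hne :=
    hadd _ _ _ _ (hx (left_ne_zero_of_mul hne)) (hx' (right_ne_zero_of_mul hne))
  one _ := h0

end Gradings

/-! ### The sectors are preserved -/

section Sectors

variable {d : ℕ} {L : Type*} {S : Setting d L} {A : Type*} [CommRing A] [Algebra ℝ A]

/-- A weight for which `z_(𝔩,k+e_𝐧)` together with `z_𝐧` weighs as much as `z_(𝔩,k)` is constant
along the terms of `shiftSeries`. -/
theorem noise_weight_eq {W : Type*} [AddCommMonoid W] (f : MIdx d L →+ W) (l : Option L)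
    (h : ∀ k n, f (eNoise l (k + Finsupp.single n 1)) + f (ePoly L n) = f (eNoise l k))
    {k k' : NIdx d →₀ ℕ} (hk : k ≤ k') :
    f (eNoise l k') + ((k' - k).sum fun n e => e • f (ePoly L n)) = f (eNoise l k) := by
  classical
  obtain ⟨j, rfl⟩ := exists_add_of_le hk
  rw [add_tsub_cancel_left]
  induction hj : j.degree using Nat.strong_induction_on generalizing j with
  | _ N ih =>
    by_cases h0 : j = 0
    · simp [h0]
    obtain ⟨j', n, rfl, hlt⟩ := exists_eq_add_single j h0
    rw [Finsupp.sum_add_index (by simp) (by intros; rw [add_smul]),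
      Finsupp.sum_single_index (by simp), one_smul, ← add_assoc k, add_comm (Finsupp.sum _ _),
      ← add_assoc, h]
    exact ih _ (hj ▸ hlt) j' le_self_add rfl

theorem bracketHom_weight (l : Option L) (k : NIdx d →₀ ℕ) (n : NIdx d) :
    bracketHom (eNoise l (k + Finsupp.single n 1)) + bracketHom (ePoly L n) =
      bracketHom (eNoise l k) := by
  change bracket _ + bracket _ = bracket _
  rw [bracket_eNoise, bracket_eNoise, bracket_ePoly, map_add, Finsupp.degree_single]
  push_cast
  ring

theorem noiseHomHom_weight (l : Option L) (k : NIdx d →₀ ℕ) (n : NIdx d) :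
    noiseHomHom (eNoise l (k + Finsupp.single n 1)) + noiseHomHom (ePoly L n) =
      noiseHomHom (eNoise l k) := by
  change noiseHom _ + noiseHom _ = noiseHom _
  rw [noiseHom_ePoly]
  cases l
  · rw [noiseHom_eNoise_none, noiseHom_eNoise_none]
  · rw [noiseHom_eNoise_some, noiseHom_eNoise_some]

theorem homHom_weight (l : Option L) (k : NIdx d →₀ ℕ) (n : NIdx d) :
    S.homHom (eNoise l (k + Finsupp.single n 1)) + S.homHom (ePoly L n) =
      S.homHom (eNoise l k) := by
  classical
  change S.hom _ + S.hom _ = S.hom _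
  rw [S.hom_eNoise, S.hom_eNoise, S.hom_ePoly, Finsupp.sum_add_index' (by simp)
    (by intros; push_cast; ring), Finsupp.sum_single_index (by simp)]
  push_cast
  ring

theorem setN_notMem_zero (n : NIdx d) : ((0 : MIdx d L), n) ∉ {p | p.1 ∈ S.setN} := by
  intro h
  have : bracket (0 : MIdx d L) = 1 := h.1.1
  simp [bracket] at this

/-- A family of power series supported in `𝓝`, as in the jets of the characters for `𝓜^±`. -/
def SupportedInN (S : Setting d L) (π : NIdx d → ZSeries d L A) : Prop :=
  ∀ n β, MvPowerSeries.coeff β (π n) ≠ 0 → β ∈ S.setN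

theorem coeff_jetOf_ne_zero {h : Fin d → A} {π : NIdx d → ZSeries d L A}
    (hπ : SupportedInN S π) {n : NIdx d} {β : MIdx d L}
    (hβ : MvPowerSeries.coeff β (jetOf h π n) ≠ 0) :
    β ∈ S.setN ∨ ∃ N, n ≤ N ∧ β = ePoly L N := by
  by_cases h1 : β ∈ S.setN
  · exact Or.inl h1
  right
  have h2 : MvPowerSeries.coeff β (π n) = 0 := by
    by_contra h3
    exact h1 (hπ n β h3)
  rw [jetOf, map_add, h2, add_zero] at hβ
  by_cases hr : β ∈ Set.range (ePoly L)
  · obtain ⟨N, rfl⟩ := hr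
    rw [coeff_linSeries, shiftCoef] at hβ
    by_cases hle : n ≤ N
    · exact ⟨N, hle, rfl⟩
    · rw [if_neg hle] at hβ
      exact absurd rfl hβ
  · exact absurd (coeff_linSeries_of_notMem _ hr) hβ

theorem coeff_jetOf_sub_X_ne_zero {h : Fin d → A} {π : NIdx d → ZSeries d L A}
    (hπ : SupportedInN S π) {n : NIdx d} {β : MIdx d L}
    (hβ : MvPowerSeries.coeff β (jetOf h π n - MvPowerSeries.X (Sum.inr n)) ≠ 0) :
    β ∈ S.setN ∨ ∃ N, n ≤ N ∧ n ≠ N ∧ β = ePoly L N := by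
  classical
  by_cases h1 : MvPowerSeries.coeff β (jetOf h π n) = 0
  · rw [map_sub, h1, zero_sub, MvPowerSeries.coeff_X] at hβ
    split_ifs at hβ with h2
    · exfalso
      change β = ePoly L n at h2
      rw [jetOf, map_add, h2, coeff_linSeries, shiftCoef_self] at h1
      have h3 : ePoly L n ∈ S.setN := by
        refine hπ n _ fun h3 => ?_
        rw [h3, add_zero] at h1
        rw [h1] at hβ
        exact hβ neg_zero
      have := h3.2
      rw [noiseHom_ePoly] at this
      exact lt_irrefl _ this
    · exact absurd neg_zero hβ
  · rcases coeff_jetOf_ne_zero hπ h1 with h2 | ⟨N, hN, rfl⟩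
    · exact Or.inl h2
    · by_cases hn : n = N
      · subst hn
        left
        refine hπ n _ fun h3 => hβ ?_
        have hx : MvPowerSeries.coeff (ePoly L n) (MvPowerSeries.X (Sum.inr n) : ZSeries d L A) =
            1 := MvPowerSeries.coeff_index_single_self_X _
        rw [map_sub, jetOf, map_add, coeff_linSeries, shiftCoef_self, h3, hx, add_zero, sub_self]
      · exact Or.inr ⟨N, hN, hn, rfl⟩

/-- The substitutions preserve the grading `[·]`. -/
theorem bracket_of_coeff_ne_zero {h : Fin d → A} {π : NIdx d → ZSeries d L A}
    (hπ : SupportedInN S π) {β γ : MIdx d L}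
    (hβ : MvPowerSeries.coeff β (S.jetMonomial (jetOf h π) γ) ≠ 0) : bracket β = bracket γ := by
  let Φ := supportFiltration (d := d) (L := L) A (fun β (a : ℤ) => bracket β = a)
    rfl (by rintro β β' a a' rfl rfl; exact bracket_add β β')
  have hX : ∀ c, Φ.mem (Finsupp.single c 1) (bracketHom (Finsupp.single c 1)) 1 := fun c _ => rfl
  have hu : ∀ n, Φ.Level (bracketHom (ePoly L n)) (jetOf h π n) := by
    intro n β hβ
    change bracket β = bracket _
    rw [bracket_ePoly]
    rcases coeff_jetOf_ne_zero hπ hβ with h1 | ⟨N, -, rfl⟩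
    · exact h1.1.1
    · exact bracket_ePoly N
  have hγ : Φ.Level (bracketHom γ) (S.jetMonomial (jetOf h π) γ) := by
    refine Filtration.level_jetMonomial ?_
    rintro (⟨l, k⟩ | n) _
    · refine Filtration.level_jetImage_inl l k (fun l k => hX _)
        (fun n _ => (hu n).sub (Filtration.Level.X (hX _))) fun k' hk' β x => ?_
      rw [noise_weight_eq bracketHom l (bracketHom_weight l) hk'.1]
      exact id
    · exact hu n
  exact hγ β hβ

/-- The substitutions do not decrease the number of noises. -/
theorem noiseHom_le_of_coeff_ne_zero {u : NIdx d → ZSeries d L A} {β γ : MIdx d L}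
    (hβ : MvPowerSeries.coeff β (S.jetMonomial u γ) ≠ 0) : noiseHom γ ≤ noiseHom β := by
  let Φ := supportFiltration (d := d) (L := L) A (fun β (a : ℕ) => a ≤ noiseHom β)
    (Nat.zero_le _) (by intro β β' a a' h h'; rw [noiseHom_add]; omega)
  have hX : ∀ c, Φ.mem (Finsupp.single c 1) (noiseHomHom (Finsupp.single c 1)) 1 :=
    fun c _ => le_refl (noiseHom _)
  have hu : ∀ n, Φ.Level (noiseHomHom (ePoly L n)) (u n) := by
    intro n β _
    change noiseHom _ ≤ _
    rw [noiseHom_ePoly]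
    exact Nat.zero_le _
  have hγ : Φ.Level (noiseHomHom γ) (S.jetMonomial u γ) := by
    refine Filtration.level_jetMonomial ?_
    rintro (⟨l, k⟩ | n) _
    · refine Filtration.level_jetImage_inl l k (fun l k => hX _)
        (fun n _ => (hu n).sub (Filtration.Level.X (hX _))) fun k' hk' β x => ?_
      rw [noise_weight_eq noiseHomHom l (noiseHomHom_weight l) hk'.1]
      exact id
    · exact hu n
  exact hγ β hβ

/-- The substitutions do not decrease the homogeneity, provided that the jet does not. -/
theorem hom_le_of_coeff_ne_zero (hS : S.Standing) {h : Fin d → A} {π : NIdx d → ZSeries d L A}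
    (hπ : SupportedInN S π)
    (hπ' : ∀ n β, MvPowerSeries.coeff β (π n) ≠ 0 → S.deg n < S.eta + S.hom β) {β γ : MIdx d L}
    (hβ : MvPowerSeries.coeff β (S.jetMonomial (jetOf h π) γ) ≠ 0) : S.hom γ ≤ S.hom β := by
  let Φ := supportFiltration (d := d) (L := L) A (fun β (a : ℝ) => a ≤ S.hom β)
    (le_of_eq (map_zero S.homHom).symm)
    (by intro β β' a a' h h'; rw [S.hom_add]; exact add_le_add h h')
  have hX : ∀ c, Φ.mem (Finsupp.single c 1) (S.homHom (Finsupp.single c 1)) 1 :=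
    fun c _ => le_refl (S.hom _)
  have hu : ∀ n, Φ.Level (S.homHom (ePoly L n)) (jetOf h π n) := by
    intro n β hβ
    change S.hom _ ≤ S.hom _
    rw [S.hom_ePoly]
    by_cases h1 : MvPowerSeries.coeff β (π n) = 0
    · rcases coeff_jetOf_ne_zero hπ hβ with h2 | ⟨N, hN, rfl⟩
      · rw [jetOf, map_add, h1, add_zero, coeff_linSeries_of_notMem] at hβ
        · exact absurd rfl hβ
        · rintro ⟨N, rfl⟩
          have := h2.2
          rw [noiseHom_ePoly] at this
          exact lt_irrefl _ this
      · rw [S.hom_ePoly]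
        linarith [hS.deg_mono hN]
    · linarith [hπ' n β h1]
  have hγ : Φ.Level (S.homHom γ) (S.jetMonomial (jetOf h π) γ) := by
    refine Filtration.level_jetMonomial ?_
    rintro (⟨l, k⟩ | n) _
    · refine Filtration.level_jetImage_inl l k (fun l k => hX _)
        (fun n _ => (hu n).sub (Filtration.Level.X (hX _))) fun k' hk' β x => ?_
      rw [noise_weight_eq S.homHom l (homHom_weight l) hk'.1]
      exact id
    · exact hu n
  exact hγ β hβ

/-- Polynomial coordinates of degree below `r` are never created by a translation, because `r ≤ 𝔰_i`
for all `i`. -/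
theorem Setting.Standing.regsol_le_deg (hS : S.Standing) {n N : NIdx d} (hle : n ≤ N)
    (hne : n ≠ N) : S.regsol ≤ S.deg N := by
  obtain ⟨i, hi⟩ : ∃ i, N i ≠ 0 := by
    by_contra h
    push Not at h
    have h0 : N = 0 := Finsupp.ext h
    rw [h0] at hle hne
    exact hne (le_antisymm hle (zero_le))
  have h1 : Finsupp.single i 1 ≤ N := by
    rw [Finsupp.single_le_iff]
    omega
  calc S.regsol ≤ S.s i := hS.regsol_le i
    _ = S.deg (Finsupp.single i 1) := (S.deg_single i).symm
    _ ≤ S.deg N := hS.deg_mono h1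

/-- The sector spanned by `𝓝₋` is preserved: the terms of `shiftSeries` stay subcritical, the
grading `[·]` is preserved, and no polynomial coordinate of degree below `r` is created. -/
theorem mem_setNminus_of_coeff_ne_zero (hS : S.Standing) {h : Fin d → A}
    {π : NIdx d → ZSeries d L A} (hπ : SupportedInN S π) {β γ : MIdx d L} (hγ : γ ∈ S.setNminus)
    (hβ : MvPowerSeries.coeff β (S.jetMonomial (jetOf h π) γ) ≠ 0) : β ∈ S.setNminus := by
  classical
  -- the conditions on the support are closed under addition, so they form a filtration of trivial
  -- weight
  let P : MIdx d L → Unit → Prop := fun β _ =>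
    (∀ l k, β (Sum.inl (l, k)) ≠ 0 → S.Subcritical l k) ∧
      ∀ n, S.deg n < S.regsol → β (Sum.inr n) = 0
  have hadd : ∀ β β' a a', P β a → P β' a' → P (β + β') (a + a') := by
    rintro β β' - - ⟨h1, h2⟩ ⟨h1', h2'⟩
    refine ⟨fun l k hne => ?_, fun n hn => ?_⟩
    · by_cases h3 : β (Sum.inl (l, k)) = 0
      · refine h1' l k fun h4 => hne ?_
        rw [Finsupp.add_apply, h3, h4]
      · exact h1 l k h3
    · rw [Finsupp.add_apply, h2 n hn, h2' n hn]
  let Φ := supportFiltration (d := d) (L := L) A P ⟨by simp, by simp⟩ hadd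
  have hXn : ∀ n, S.regsol ≤ S.deg n → P (ePoly L n) () := by
    intro n hn
    refine ⟨by simp [ePoly], fun m hm => ?_⟩
    have : n ≠ m := by
      rintro rfl
      exact absurd hm (not_lt.mpr hn)
    simp [ePoly, this]
  have hXl : ∀ l k, S.Subcritical l k → P (eNoise l k) () := by
    intro l k hlk
    refine ⟨fun l' k' hne => ?_, by simp [eNoise]⟩
    have : (l, k) = (l', k') := by
      by_contra h3
      apply hne
      rw [eNoise, Finsupp.single_apply, if_neg]
      intro h4
      exact h3 (Sum.inl.inj h4)
    rw [Prod.mk.injEq] at this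
    rw [← this.1, ← this.2]
    exact hlk
  have hw : ∀ n, Φ.Level () (jetOf h π n - MvPowerSeries.X (Sum.inr n)) := by
    intro n β hβ
    rcases coeff_jetOf_sub_X_ne_zero hπ hβ with h1 | ⟨N, hN, hne, rfl⟩
    · exact h1.1.2
    · exact hXn N (hS.regsol_le_deg hN hne)
  have hγ' : Φ.Level (0 : Unit) (S.jetMonomial (jetOf h π) γ) := by
    refine Filtration.level_jetMonomial (f := (0 : MIdx d L →+ Unit)) ?_
    rintro (⟨l, k⟩ | n) hc
    · have hsub := hγ.2.1 l k (Finsupp.mem_support_iff.mp hc)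
      refine Filtration.Level.smul (fun β => ?_) _
      have hs := S.coeff_shiftSeries (l := l) (k := k) (β := β)
        (w := fun n => jetOf h π n - MvPowerSeries.X (Sum.inr n)) (Finset.Subset.refl _)
      rw [map_sum (MvPowerSeries.coeff β)] at hs
      rw [hs]
      refine Filtration.mem_sum fun k' _ => ?_
      rw [Setting.shiftTerm]
      split_ifs with hr
      · have hsub' : S.Subcritical l k' := by
          rcases hr.2 with rfl | h2
          · exact hsub
          · exact h2
        exact Filtration.Level.smul (Filtration.Level.mul (a := ()) (b := ())
          (Filtration.Level.X fun _ => hXl l k' hsub')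
          (Filtration.Level.dp (a := fun _ => ()) fun n _ => hw n)) _ β
      · exact Φ.zero _ _
    · have hn : S.regsol ≤ S.deg n := by
        by_contra h1
        exact (Finsupp.mem_support_iff.mp hc) (hγ.2.2 n (not_le.mp h1))
      have h2 := (hw n).add (Filtration.Level.X (c := Sum.inr n) fun _ => hXn n hn)
      rw [sub_add_cancel] at h2
      exact h2
  refine ⟨?_, hγ' β hβ⟩
  rw [bracket_of_coeff_ne_zero hπ hβ, hγ.1]

theorem mem_setN_of_coeff_ne_zero (hS : S.Standing) {h : Fin d → A}
    {π : NIdx d → ZSeries d L A} (hπ : SupportedInN S π) {β γ : MIdx d L} (hγ : γ ∈ S.setN)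
    (hβ : MvPowerSeries.coeff β (S.jetMonomial (jetOf h π) γ) ≠ 0) : β ∈ S.setN :=
  ⟨mem_setNminus_of_coeff_ne_zero hS hπ hγ.1 hβ,
    lt_of_lt_of_le hγ.2 (noiseHom_le_of_coeff_ne_zero hβ)⟩

theorem Setting.jetMonomial_ePoly (u : NIdx d → ZSeries d L A) (n : NIdx d) :
    S.jetMonomial u (ePoly L n) = u n := by
  rw [jetMonomial, ePoly, Finsupp.prod_single_index (by simp), pow_one]
  rfl

theorem Setting.jetMonomial_eNoise (u : NIdx d → ZSeries d L A) (l : Option L)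
    (k : NIdx d →₀ ℕ) : S.jetMonomial u (eNoise l k) = S.jetImage u (Sum.inl (l, k)) := by
  rw [jetMonomial, eNoise, Finsupp.prod_single_index (by simp), pow_one]

theorem mem_populated_of_coeff_ne_zero (hS : S.Standing) {h : Fin d → A}
    {π : NIdx d → ZSeries d L A} (hπ : SupportedInN S π) {β γ : MIdx d L} (hγ : γ ∈ S.populated)
    (hβ : MvPowerSeries.coeff β (S.jetMonomial (jetOf h π) γ) ≠ 0) : β ∈ S.populated := by
  rcases hγ with ⟨n, rfl⟩ | hγ
  · rw [Setting.jetMonomial_ePoly] at hβ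
    rcases coeff_jetOf_ne_zero hπ hβ with h1 | ⟨N, -, rfl⟩
    · exact Or.inr h1
    · exact Or.inl ⟨N, rfl⟩
  · exact Or.inr (mem_setN_of_coeff_ne_zero hS hπ hγ hβ)

theorem mem_allIdx_of_coeff_ne_zero (hS : S.Standing) {h : Fin d → A}
    {π : NIdx d → ZSeries d L A} (hπ : SupportedInN S π) {β γ : MIdx d L} (hγ : γ ∈ S.allIdx)
    (hβ : MvPowerSeries.coeff β (S.jetMonomial (jetOf h π) γ) ≠ 0) : β ∈ S.allIdx := by
  rcases hγ with hγ | hγ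
  · exact Or.inl (mem_populated_of_coeff_ne_zero hS hπ hγ hβ)
  · exact Or.inr (mem_setNminus_of_coeff_ne_zero hS hπ hγ hβ)

end Sectors

/-! ### Triangularity -/

section Triangular

variable {d : ℕ} {L : Type*} {S : Setting d L} {A : Type*} [CommRing A] [Algebra ℝ A]

/-- The filtration on pairs of coefficients in which level `a` means: no terms of degree below `a`,
and agreement of the two components in degrees up to `N - 2 + a`. -/
def agreeFiltration (d : ℕ) (L A : Type*) [CommRing A] [Algebra ℝ A] (N : ℕ) :
    Filtration d L (A × A) ℕ where
  mem β a x := (β.degree < a → x = 0) ∧ (β.degree + 1 < N + a → x.1 = x.2)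
  zero β a := ⟨fun _ => rfl, fun _ => rfl⟩
  add β a x y hx hy := ⟨fun h => by rw [hx.1 h, hy.1 h, add_zero],
    fun h => by rw [Prod.fst_add, Prod.snd_add, hx.2 h, hy.2 h]⟩
  smul β a r x hx := ⟨fun h => by rw [hx.1 h, smul_zero],
    fun h => by rw [Prod.smul_fst, Prod.smul_snd, hx.2 h]⟩
  mul β β' a a' x x' hx hx' := by
    rw [map_add]
    refine ⟨fun h => ?_, fun h => ?_⟩
    · by_cases h1 : β.degree < a
      · rw [hx.1 h1, zero_mul]
      · rw [hx'.1 (by omega), mul_zero]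
    · by_cases h1 : β.degree < a
      · rw [hx.1 h1, zero_mul]
        rfl
      · by_cases h2 : β'.degree < a'
        · rw [hx'.1 h2, mul_zero]
          rfl
        · rw [Prod.fst_mul, Prod.snd_mul, hx.2 (by omega), hx'.2 (by omega)]
  one := ⟨fun h => absurd h (Nat.not_lt_zero _), fun _ => rfl⟩

/-- Apart from the polynomial coordinates, the coefficient of `z^β` in the image of a monomial
depends only on the coefficients of the jet in degrees below the degree of `β`. -/
theorem coeff_jetMonomial_congr {u u' : NIdx d → ZSeries d L A}
    (h0 : ∀ n, MvPowerSeries.constantCoeff (u n) = 0)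
    (h0' : ∀ n, MvPowerSeries.constantCoeff (u' n) = 0) {β γ : MIdx d L} (N : Set (NIdx d))
    (hN : ∀ n, S.deg n < S.eta → n ∈ N)
    (hu : ∀ n ∈ N, ∀ β' : MIdx d L, β'.degree < β.degree →
      MvPowerSeries.coeff β' (u n) = MvPowerSeries.coeff β' (u' n))
    (hγ : (∃ l k, γ = eNoise l k) ∨ 2 ≤ γ.degree) (hγN : ∀ n, γ (Sum.inr n) ≠ 0 → n ∈ N) :
    MvPowerSeries.coeff β (S.jetMonomial u γ) = MvPowerSeries.coeff β (S.jetMonomial u' γ) := by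
  classical
  -- both jets are carried along as a single jet with coefficients in `A × A`
  let v : NIdx d → ZSeries d L (A × A) := fun n β =>
    (MvPowerSeries.coeff β (u n), MvPowerSeries.coeff β (u' n))
  have hv1 : ∀ n, MvPowerSeries.mapAlgHom (AlgHom.fst ℝ A A) (v n) = u n := fun n => by
    ext β
    rw [MvPowerSeries.mapAlgHom_apply, MvPowerSeries.coeff_map]
    rfl
  have hv2 : ∀ n, MvPowerSeries.mapAlgHom (AlgHom.snd ℝ A A) (v n) = u' n := fun n => by
    ext β
    rw [MvPowerSeries.mapAlgHom_apply, MvPowerSeries.coeff_map]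
    rfl
  let Φ := agreeFiltration d L A β.degree
  let f : MIdx d L →+ ℕ := Finsupp.degree
  have hf : ∀ c : Coord d L, f (Finsupp.single c 1) = 1 := fun c => Finsupp.degree_single _ _
  have hX : ∀ c, Φ.mem (Finsupp.single c 1) (f (Finsupp.single c 1)) 1 := fun c =>
    ⟨fun h => absurd h (lt_irrefl _), fun _ => rfl⟩
  have hvl : ∀ n ∈ N, Φ.Level (f (ePoly L n)) (v n) := by
    intro n hn β'
    rw [ePoly, hf]
    refine ⟨fun h => ?_, fun h => hu n hn β' (by omega)⟩
    have : β' = 0 := by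
      rw [← Finsupp.degree_eq_zero_iff]
      omega
    rw [this]
    have e1 := h0 n
    have e2 := h0' n
    rw [← MvPowerSeries.coeff_zero_eq_constantCoeff_apply] at e1 e2
    exact Prod.ext e1 e2
  have hwl : ∀ n ∈ N, Φ.Level (f (ePoly L n)) (v n - MvPowerSeries.X (Sum.inr n)) := fun n hn =>
    (hvl n hn).sub (Filtration.Level.X (hX _))
  have hmono : ∀ β' a a' x, a' ≤ a → Φ.mem β' a x → Φ.mem β' a' x := fun β' a a' x h hx =>
    ⟨fun h1 => hx.1 (by omega), fun h1 => hx.2 (by omega)⟩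
  suffices h : (MvPowerSeries.coeff β (S.jetMonomial v γ)).1 =
      (MvPowerSeries.coeff β (S.jetMonomial v γ)).2 by
    have e1 := S.mapAlgHom_jetMonomial (AlgHom.fst ℝ A A) v γ
    have e2 := S.mapAlgHom_jetMonomial (AlgHom.snd ℝ A A) v γ
    simp only [hv1, hv2] at e1 e2
    change _ = S.jetMonomial u γ at e1
    change _ = S.jetMonomial u' γ at e2
    rw [← e1, ← e2, MvPowerSeries.mapAlgHom_apply, MvPowerSeries.coeff_map,
      MvPowerSeries.mapAlgHom_apply, MvPowerSeries.coeff_map]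
    exact h
  rcases hγ with ⟨l, k, rfl⟩ | hγ
  · rw [Setting.jetMonomial_eNoise]
    simp only [Setting.jetImage]
    rw [coeff_real_smul, Prod.smul_fst, Prod.smul_snd]
    congr 1
    rw [S.coeff_shiftSeries (Finset.Subset.refl _), map_sum, Prod.fst_sum, Prod.snd_sum]
    refine Finset.sum_congr rfl fun k' _ => ?_
    rw [Setting.shiftTerm]
    split_ifs with hr
    · by_cases hk : k' = k
      · rw [hk, tsub_self, dp_zero, mul_one, coeff_real_smul, MvPowerSeries.coeff_X]
        split_ifs <;> rfl
      · have hsub : S.Subcritical l k' := hr.2.resolve_left hk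
        have h1 := Filtration.Level.smul (Filtration.Level.mul
          (Filtration.Level.X (c := Sum.inl (l, k')) (hX _))
          (Filtration.Level.dp (K := k' - k) (a := fun n => f (ePoly L n))
            fun n hn => hwl n (hN n (hsub.deg_lt (n := n) (by
              rw [Finsupp.mem_support_iff, Finsupp.tsub_apply] at hn
              omega))))) (kFact k') β
        refine h1.2 ?_
        have h2 : ((k' - k).sum fun n e => e • f (ePoly L n)) = (k' - k).degree := by
          rw [Finsupp.degree_apply, Finsupp.sum]
          refine Finset.sum_congr rfl fun n _ => ?_
          rw [ePoly, hf, smul_eq_mul, mul_one]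
        -- the factor `z_(𝔩,k')` has positive degree, so the divided power only sees lower degrees
        have h3 : (k' - k).degree ≠ 0 := by
          rw [Ne, Finsupp.degree_eq_zero_iff]
          exact fun h => hk (le_antisymm (tsub_eq_zero_iff_le.mp h) hr.1)
        rw [h2, hf]
        omega
    · rfl
  · have h1 : Φ.Level (f γ) (S.jetMonomial v γ) := by
      refine Filtration.level_jetMonomial ?_
      rintro (⟨l, k⟩ | n) hc
      · refine Filtration.level_jetImage_inl (f := f) l k (fun l k => hX _)
          (fun n hn => hwl n (hN n hn)) fun k' _ β' x hx => ?_
        refine hmono _ _ _ _ ?_ hx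
        rw [eNoise, eNoise, hf, hf]
        omega
      · exact hvl n (hγN n (Finsupp.mem_support_iff.mp hc))
    refine (h1 β).2 ?_
    change _ < β.degree + γ.degree
    omega

/-- A recursion along the degree of the multi-indices has a solution, which inherits the properties
preserved by the recursion. -/
theorem exists_fixedPoint {X : Type*} (T : (MIdx d L → X) → MIdx d L → X)
    (hT : ∀ P P' β, (∀ γ : MIdx d L, γ.degree < β.degree → P γ = P' γ) → T P β = T P' β)
    (r : MIdx d L → X → Prop) (hr : ∀ P, (∀ β, r β (P β)) → ∀ β, r β (T P β))
    (P₀ : MIdx d L → X) (hr0 : ∀ β, r β (P₀ β)) :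
    ∃ P, T P = P ∧ ∀ β, r β (P β) := by
  have key : ∀ N (β : MIdx d L), β.degree < N → ∀ i j, β.degree < i → β.degree < j →
      T^[i] P₀ β = T^[j] P₀ β := by
    intro N
    induction N with
    | zero => exact fun β h => absurd h (Nat.not_lt_zero _)
    | succ N ih =>
      intro β _ i j hi hj
      obtain ⟨i, rfl⟩ := Nat.exists_eq_succ_of_ne_zero (Nat.ne_zero_of_lt hi)
      obtain ⟨j, rfl⟩ := Nat.exists_eq_succ_of_ne_zero (Nat.ne_zero_of_lt hj)
      rw [Function.iterate_succ_apply', Function.iterate_succ_apply']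
      exact hT _ _ _ fun γ hγ => ih γ (by omega) i j (by omega) (by omega)
  have hri : ∀ N β, r β (T^[N] P₀ β) := by
    intro N
    induction N with
    | zero => exact hr0
    | succ N ih =>
      intro β
      rw [Function.iterate_succ_apply']
      exact hr _ ih β
  refine ⟨fun β => T^[β.degree + 1] P₀ β, ?_, fun β => hri _ β⟩
  funext β
  rw [Function.iterate_succ_apply']
  exact hT _ _ _ fun γ hγ => key (γ.degree + 1) γ (by omega) _ _ (by omega) hγ

end Triangular

/-! ### Smooth functions and their iterated partial derivatives -/

section Smooth

variable {d : ℕ}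

theorem NIdx.induction {p : NIdx d → Prop} (h0 : p 0)
    (h1 : ∀ n i, p n → p (n + Finsupp.single i 1)) (n : NIdx d) : p n := by
  induction hN : n.degree using Nat.strong_induction_on generalizing n with
  | _ N ih =>
    by_cases hn : n = 0
    · rw [hn]
      exact h0
    · obtain ⟨n', i, rfl, hlt⟩ := exists_eq_add_single n hn
      exact h1 _ _ (ih _ (hN ▸ hlt) n' rfl)

theorem kFact_eq_nFactorial (n : NIdx d) : kFact n = nFactorial n := by
  rw [kFact, nFactorial, Finsupp.prod_fintype _ _ (by simp)]

theorem nFactorial_pos (n : NIdx d) : 0 < nFactorial n := kFact_eq_nFactorial n ▸ kFact_pos n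

/-- The algebra of smooth functions. -/
def smoothFun (d : ℕ) : Subalgebra ℝ ((Fin d → ℝ) → ℝ) where
  carrier := {f | ContDiff ℝ ∞ f}
  mul_mem' {f g} hf hg := show ContDiff ℝ ∞ (f * g) from
    ContDiff.mul (show ContDiff ℝ ∞ f from hf) (show ContDiff ℝ ∞ g from hg)
  add_mem' {f g} hf hg := show ContDiff ℝ ∞ (f + g) from
    ContDiff.add (show ContDiff ℝ ∞ f from hf) (show ContDiff ℝ ∞ g from hg)
  algebraMap_mem' r := show ContDiff ℝ ∞ (fun _ => r) from contDiff_const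

theorem contDiff_partialDeriv {f : (Fin d → ℝ) → ℝ} (hf : ContDiff ℝ ∞ f) (i : Fin d) :
    ContDiff ℝ ∞ (partialDeriv i f) :=
  (hf.fderiv_right (m := ∞) (by norm_num)).clm_apply contDiff_const

theorem differentiable_of_smooth {E : Type*} [NormedAddCommGroup E] [NormedSpace ℝ E]
    {f : E → ℝ} (hf : ContDiff ℝ ∞ f) : Differentiable ℝ f :=
  hf.differentiable (by norm_num)

/-- `∂_i` as a derivation of the algebra of smooth functions. -/
def partialDer (i : Fin d) : Derivation ℝ (smoothFun d) (smoothFun d) :=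
  Derivation.mk'
    { toFun := fun f => ⟨partialDeriv i f, contDiff_partialDeriv f.2 i⟩
      map_add' := fun f g => by
        ext y
        have h1 := (differentiable_of_smooth f.2) y
        have h2 := (differentiable_of_smooth g.2) y
        change fderiv ℝ ((f : (Fin d → ℝ) → ℝ) + (g : (Fin d → ℝ) → ℝ)) y _ = fderiv ℝ _ y _ + fderiv ℝ _ y _
        rw [fderiv_add h1 h2]
        rfl
      map_smul' := fun r f => by
        ext y
        have h1 := (differentiable_of_smooth f.2) y
        change fderiv ℝ (r • (f : (Fin d → ℝ) → ℝ)) y _ = r • fderiv ℝ _ y _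
        rw [fderiv_const_smul h1]
        rfl }
    fun f g => by
      ext y
      have h1 := (differentiable_of_smooth f.2) y
      have h2 := (differentiable_of_smooth g.2) y
      change fderiv ℝ ((f : (Fin d → ℝ) → ℝ) * (g : (Fin d → ℝ) → ℝ)) y _ =
        (f : (Fin d → ℝ) → ℝ) y * fderiv ℝ _ y _ + (g : (Fin d → ℝ) → ℝ) y * fderiv ℝ _ y _
      rw [fderiv_mul h1 h2]
      rfl

theorem partialDeriv_comm {f : (Fin d → ℝ) → ℝ} (hf : ContDiff ℝ ∞ f) (i j : Fin d) :
    partialDeriv i (partialDeriv j f) = partialDeriv j (partialDeriv i f) := by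
  funext y
  have hd : DifferentiableAt ℝ (fderiv ℝ f) y :=
    ((hf.fderiv_right (m := ∞) (by norm_num)).differentiable (by norm_num)) y
  have key : ∀ a b : Fin d, partialDeriv a (partialDeriv b f) y =
      fderiv ℝ (fderiv ℝ f) y (Pi.single a 1) (Pi.single b 1) := by
    intro a b
    change fderiv ℝ (fun y => fderiv ℝ f y (Pi.single b 1)) y _ = _
    rw [fderiv_clm_apply hd (differentiableAt_const _)]
    simp
  rw [key, key]
  have hs : IsSymmSndFDerivAt ℝ f y :=
    hf.contDiffAt.isSymmSndFDerivAt (by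
      simp only [minSmoothness_of_isRCLikeNormedField]
      exact WithTop.coe_le_coe.mpr le_top)
  exact hs _ _

theorem partialDer_commute (i j : Fin d) :
    Commute (partialDer i : smoothFun d →ₗ[ℝ] smoothFun d)
      (partialDer j : smoothFun d →ₗ[ℝ] smoothFun d) :=
  LinearMap.ext fun f => Subtype.ext (partialDeriv_comm f.2 i j)

/-- `∂^𝐧` as an endomorphism of the space of smooth functions. -/
def multiDer (n : NIdx d) : Module.End ℝ (smoothFun d) :=
  ((List.finRange d).map fun i => (partialDer i : smoothFun d →ₗ[ℝ] smoothFun d) ^ n i).prod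

theorem coe_multiDer (n : NIdx d) (f : smoothFun d) :
    ((multiDer n f : smoothFun d) : (Fin d → ℝ) → ℝ) = multiDeriv n f := by
  rw [multiDer, multiDeriv]
  induction List.finRange d with
  | nil => rfl
  | cons i l ih =>
    rw [List.map_cons, List.prod_cons, Module.End.mul_apply, List.foldr_cons, ← ih]
    generalize ((List.map _ l).prod : Module.End ℝ (smoothFun d)) f = g
    induction n i with
    | zero => rfl
    | succ e ihe =>
      rw [pow_succ', Module.End.mul_apply, Function.iterate_succ_apply', ← ihe]
      rfl

theorem prod_map_mul_of_commute {ι R : Type*} [Monoid R] (l : List ι) (a b : ι → R)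
    (h : ∀ i j, Commute (a i) (b j)) :
    (l.map fun i => a i * b i).prod = (l.map a).prod * (l.map b).prod := by
  induction l with
  | nil => simp
  | cons i l ih =>
    rw [List.map_cons, List.prod_cons, List.map_cons, List.prod_cons, List.map_cons,
      List.prod_cons, ih, mul_assoc, mul_assoc]
    congr 1
    rw [← mul_assoc, ← mul_assoc]
    congr 1
    refine (Commute.list_prod_left _ _ fun x hx => ?_).eq.symm
    obtain ⟨j, -, rfl⟩ := List.mem_map.mp hx
    exact h j i

theorem multiDer_add (m n : NIdx d) : (multiDer (m + n) : Module.End ℝ (smoothFun d)) =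
    multiDer m * multiDer n := by
  rw [multiDer, multiDer, multiDer, ← prod_map_mul_of_commute _ _ _ fun i j =>
    (partialDer_commute i j).pow_pow _ _]
  congr 2
  funext i
  rw [Finsupp.add_apply, pow_add]

theorem multiDer_zero : (multiDer 0 : Module.End ℝ (smoothFun d)) = 1 := by
  rw [multiDer]
  refine List.prod_eq_one fun x hx => ?_
  obtain ⟨i, -, rfl⟩ := List.mem_map.mp hx
  rw [Finsupp.zero_apply, pow_zero]

theorem multiDer_single (i : Fin d) : multiDer (Finsupp.single i 1) =
    (partialDer i : smoothFun d →ₗ[ℝ] smoothFun d) := by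
  classical
  rw [multiDer]
  have key : ∀ l : List (Fin d), l.Nodup → (l.map fun j =>
      (partialDer j : smoothFun d →ₗ[ℝ] smoothFun d) ^ (Finsupp.single i 1 : NIdx d) j).prod =
      if i ∈ l then (partialDer i : smoothFun d →ₗ[ℝ] smoothFun d) else 1 := by
    intro l hl
    induction l with
    | nil => rfl
    | cons j l ih =>
      rw [List.map_cons, List.prod_cons, ih hl.of_cons]
      by_cases hj : i = j
      · subst hj
        rw [Finsupp.single_eq_same, pow_one, if_neg (List.nodup_cons.mp hl).1, mul_one,
          if_pos List.mem_cons_self]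
      · rw [Finsupp.single_eq_of_ne (Ne.symm hj), pow_zero, one_mul]
        simp [hj]
  rw [key _ (List.nodup_finRange d), if_pos (List.mem_finRange i)]

theorem contDiff_multiDeriv {f : (Fin d → ℝ) → ℝ} (hf : ContDiff ℝ ∞ f) (n : NIdx d) :
    ContDiff ℝ ∞ (multiDeriv n f) := by
  have := (multiDer n ⟨f, hf⟩).2
  rw [coe_multiDer] at this
  exact this

theorem multiDeriv_index_zero {f : (Fin d → ℝ) → ℝ} (hf : ContDiff ℝ ∞ f) :
    multiDeriv 0 f = f := by
  have := coe_multiDer 0 ⟨f, hf⟩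
  rw [multiDer_zero] at this
  exact this.symm

theorem multiDeriv_index_add {f : (Fin d → ℝ) → ℝ} (hf : ContDiff ℝ ∞ f) (m n : NIdx d) :
    multiDeriv (m + n) f = multiDeriv m (multiDeriv n f) := by
  have := coe_multiDer (m + n) ⟨f, hf⟩
  rw [multiDer_add, Module.End.mul_apply, coe_multiDer, coe_multiDer] at this
  exact this.symm

theorem multiDeriv_index_single {f : (Fin d → ℝ) → ℝ} (hf : ContDiff ℝ ∞ f) (i : Fin d) :
    multiDeriv (Finsupp.single i 1) f = partialDeriv i f := by
  have := coe_multiDer (Finsupp.single i 1) ⟨f, hf⟩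
  rw [multiDer_single] at this
  exact this.symm

theorem multiDeriv_sub {f g : (Fin d → ℝ) → ℝ} (hf : ContDiff ℝ ∞ f) (hg : ContDiff ℝ ∞ g)
    (n : NIdx d) : multiDeriv n (f - g) = multiDeriv n f - multiDeriv n g := by
  have := congrArg Subtype.val (map_sub (multiDer n) (⟨f, hf⟩ : smoothFun d) ⟨g, hg⟩)
  rw [coe_multiDer] at this
  refine this.trans ?_
  rw [Subalgebra.coe_sub, coe_multiDer, coe_multiDer]

theorem multiDeriv_sum {ι : Type*} (s : Finset ι) (a : ι → ℝ) {f : ι → (Fin d → ℝ) → ℝ}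
    (hf : ∀ i ∈ s, ContDiff ℝ ∞ (f i)) (n : NIdx d) (y : Fin d → ℝ) :
    multiDeriv n (fun y => ∑ i ∈ s, a i * f i y) y = ∑ i ∈ s, a i * multiDeriv n (f i) y := by
  classical
  let g : ι → smoothFun d := fun i => if h : ContDiff ℝ ∞ (f i) then ⟨f i, h⟩ else 0
  have hg : ∀ i ∈ s, (g i : (Fin d → ℝ) → ℝ) = f i := fun i hi => by
    simp only [g, dif_pos (hf i hi)]
  have h1 : (fun y => ∑ i ∈ s, a i * f i y) =
      ((∑ i ∈ s, a i • g i : smoothFun d) : (Fin d → ℝ) → ℝ) := by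
    funext y
    rw [AddSubmonoidClass.coe_finsetSum, Finset.sum_apply]
    refine Finset.sum_congr rfl fun i hi => ?_
    rw [← hg i hi]
    rfl
  rw [h1, ← coe_multiDer, map_sum, AddSubmonoidClass.coe_finsetSum, Finset.sum_apply]
  refine Finset.sum_congr rfl fun i hi => ?_
  rw [map_smul, ← hg i hi, ← coe_multiDer]
  rfl

/-- The smooth function `y ↦ y_i - x_i`. -/
def displacement (x : Fin d → ℝ) (i : Fin d) : smoothFun d :=
  ⟨fun y => y i - x i, by
    change ContDiff ℝ ∞ fun y : Fin d → ℝ => y i - x i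
    fun_prop⟩

theorem partialDer_displacement (x : Fin d → ℝ) (i j : Fin d) :
    partialDer i (displacement x j) = if j = i then 1 else 0 := by
  ext y
  change fderiv ℝ (fun y : Fin d → ℝ => y j - x j) y (Pi.single i 1) = _
  rw [fderiv_sub_const]
  have h : HasFDerivAt (fun y : Fin d → ℝ => y j) (ContinuousLinearMap.proj (R := ℝ) j) y :=
    (ContinuousLinearMap.proj (R := ℝ) (φ := fun _ : Fin d => ℝ) j).hasFDerivAt
  rw [h.fderiv, ContinuousLinearMap.proj_apply, Pi.single_apply]
  split_ifs <;> rfl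

/-- Evaluation at a point. -/
def evalAt (y : Fin d → ℝ) : smoothFun d →ₐ[ℝ] ℝ :=
  (Pi.evalAlgHom ℝ (fun _ : Fin d → ℝ => ℝ) y).comp (smoothFun d).val

theorem coe_shiftCoef (x : Fin d → ℝ) (n N : NIdx d) (y : Fin d → ℝ) :
    ((shiftCoef (displacement x) n N : smoothFun d) : (Fin d → ℝ) → ℝ) y =
      shiftCoef (fun i => y i - x i) n N :=
  map_shiftCoef (evalAt y) (displacement x) n N

theorem contDiff_shiftCoef (x : Fin d → ℝ) (n N : NIdx d) :
    ContDiff ℝ ∞ fun y : Fin d → ℝ => shiftCoef (fun i => y i - x i) n N := by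
  have := (shiftCoef (displacement x) n N).2
  have h : ((shiftCoef (displacement x) n N : smoothFun d) : (Fin d → ℝ) → ℝ) =
      fun y : Fin d → ℝ => shiftCoef (fun i => y i - x i) n N :=
    funext fun y => coe_shiftCoef x n N y
  rw [h] at this
  exact this

theorem multiDer_shiftCoef (x : Fin d → ℝ) (n N : NIdx d) :
    multiDer n (shiftCoef (displacement x) 0 N) =
      nFactorial n • shiftCoef (displacement x) n N := by
  rw [← kFact_eq_nFactorial]
  induction n using NIdx.induction with
  | h0 => simp [multiDer_zero, kFact]
  | h1 n i ih =>
    rw [add_comm, multiDer_add, Module.End.mul_apply, ih, map_smul, multiDer_single,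
      Derivation.coeFn_coe, derivation_shiftCoef _ _ i (fun j => partialDer_displacement x i j),
      smul_smul, add_comm (Finsupp.single i 1), kFact_add_single, mul_comm]

theorem multiDeriv_shiftCoef (x : Fin d → ℝ) (n N : NIdx d) (y : Fin d → ℝ) :
    multiDeriv n (fun y : Fin d → ℝ => shiftCoef (fun i => y i - x i) 0 N) y =
      nFactorial n * shiftCoef (fun i => y i - x i) n N := by
  have h : ((shiftCoef (displacement x) 0 N : smoothFun d) : (Fin d → ℝ) → ℝ) =
      fun y : Fin d → ℝ => shiftCoef (fun i => y i - x i) 0 N :=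
    funext fun y => coe_shiftCoef x 0 N y
  rw [← h, ← coe_multiDer, multiDer_shiftCoef, ← coe_shiftCoef]
  rfl

theorem shiftCoef_zero_left {A : Type*} [CommRing A] [Algebra ℝ A] (h : Fin d → A)
    (N : NIdx d) : shiftCoef h 0 N = ∏ i, h i ^ N i := by
  rw [shiftCoef, if_pos (zero_le), tsub_zero, dp_eq_prod h N (Finset.subset_univ _),
    Finset.prod_smul, smul_smul, Finset.prod_inv_distrib, show kFact (0 : NIdx d) = 1 by
    simp [kFact], div_one, kFact_eq_nFactorial]
  change (nFactorial N * (nFactorial N)⁻¹) • _ = _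
  rw [mul_inv_cancel₀ (nFactorial_pos N).ne', one_smul]

/-- Joint smoothness of a function of the base point and the argument. -/
def JointSmooth (F : (Fin d → ℝ) → (Fin d → ℝ) → ℝ) : Prop :=
  ContDiff ℝ ∞ fun p : (Fin d → ℝ) × (Fin d → ℝ) => F p.1 p.2

theorem JointSmooth.right {F : (Fin d → ℝ) → (Fin d → ℝ) → ℝ} (hF : JointSmooth F)
    (x : Fin d → ℝ) : ContDiff ℝ ∞ (F x) :=
  ContDiff.comp (g := fun p : (Fin d → ℝ) × (Fin d → ℝ) => F p.1 p.2) hF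
    (contDiff_prodMk_right x)

theorem JointSmooth.partialDeriv {F : (Fin d → ℝ) → (Fin d → ℝ) → ℝ} (hF : JointSmooth F)
    (i : Fin d) : JointSmooth fun x => partialDeriv i (F x) := by
  have h : ∀ p : (Fin d → ℝ) × (Fin d → ℝ), MultiIndexModel.partialDeriv i (F p.1) p.2 =
      fderiv ℝ (fun p : (Fin d → ℝ) × (Fin d → ℝ) => F p.1 p.2) p (0, Pi.single i 1) := by
    intro p
    have h1 : HasFDerivAt (fun p : (Fin d → ℝ) × (Fin d → ℝ) => F p.1 p.2)
        (fderiv ℝ (fun p : (Fin d → ℝ) × (Fin d → ℝ) => F p.1 p.2) p) (p.1, p.2) :=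
      (differentiable_of_smooth hF p).hasFDerivAt
    have h2 := h1.comp p.2 (hasFDerivAt_prodMk_right p.1 p.2)
    change fderiv ℝ (F p.1) p.2 _ = _
    rw [show F p.1 = (fun p : (Fin d → ℝ) × (Fin d → ℝ) => F p.1 p.2) ∘ Prod.mk p.1 from rfl,
      h2.fderiv]
    simp
  change ContDiff ℝ ∞ _
  simp only [h]
  exact (ContDiff.fderiv_right (m := ∞) hF (by norm_num)).clm_apply contDiff_const

theorem JointSmooth.multiDeriv {F : (Fin d → ℝ) → (Fin d → ℝ) → ℝ} (hF : JointSmooth F)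
    (n : NIdx d) : JointSmooth fun x => multiDeriv n (F x) := by
  induction n using NIdx.induction with
  | h0 =>
    simp only [multiDeriv_index_zero (hF.right _)]
    exact hF
  | h1 n i ih =>
    simp only [add_comm n, multiDeriv_index_add (hF.right _),
      multiDeriv_index_single (contDiff_multiDeriv (hF.right _) _)]
    exact ih.partialDeriv i

end Smooth

/-! ### The scaled distance and homogeneity bounds -/

section Bounds

variable {d : ℕ} {L : Type*} {S : Setting d L}

namespace Setting

theorem size_nonneg (S : Setting d L) (x : Fin d → ℝ) : 0 ≤ S.size x :=
  Finset.sum_nonneg fun _ _ => Real.rpow_nonneg (abs_nonneg _) _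

theorem Standing.s_pos (hS : S.Standing) (i : Fin d) : 0 < S.s i :=
  zero_lt_one.trans_le (hS.one_le_s i)

theorem Standing.size_zero (hS : S.Standing) : S.size 0 = 0 := by
  refine Finset.sum_eq_zero fun i _ => ?_
  rw [Pi.zero_apply, abs_zero, Real.zero_rpow (one_div_pos.mpr (hS.s_pos i)).ne']

theorem rpow_le_size (S : Setting d L) (x : Fin d → ℝ) (i : Fin d) :
    |x i| ^ (1 / S.s i) ≤ S.size x :=
  Finset.single_le_sum (f := fun i => |x i| ^ (1 / S.s i))
    (fun _ _ => Real.rpow_nonneg (abs_nonneg _) _) (Finset.mem_univ i)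

theorem Standing.abs_le_size_rpow (hS : S.Standing) (x : Fin d → ℝ) (i : Fin d) :
    |x i| ≤ S.size x ^ S.s i := by
  have h := Real.rpow_le_rpow (Real.rpow_nonneg (abs_nonneg _) _) (S.rpow_le_size x i)
    (hS.s_pos i).le
  rwa [← Real.rpow_mul (abs_nonneg _), one_div_mul_cancel (hS.s_pos i).ne', Real.rpow_one] at h

theorem Standing.size_pos (hS : S.Standing) {x : Fin d → ℝ} (hx : x ≠ 0) : 0 < S.size x := by
  refine lt_of_le_of_ne (S.size_nonneg x) fun h => hx ?_
  funext i
  have := hS.abs_le_size_rpow x i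
  rw [← h, Real.zero_rpow (hS.s_pos i).ne'] at this
  exact abs_nonpos_iff.mp this

theorem Standing.size_smul_le (hS : S.Standing) (x : Fin d → ℝ) {t : ℝ} (h0 : 0 ≤ t)
    (h1 : t ≤ 1) : S.size (t • x) ≤ S.size x := by
  refine Finset.sum_le_sum fun i _ => Real.rpow_le_rpow (abs_nonneg _) ?_
    (one_div_pos.mpr (hS.s_pos i)).le
  rw [Pi.smul_apply, smul_eq_mul, abs_mul, abs_of_nonneg h0]
  exact mul_le_of_le_one_left (abs_nonneg _) h1

theorem Standing.continuous_size (hS : S.Standing) : Continuous S.size :=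
  continuous_finsetSum _ fun i _ => ((continuous_apply i).abs).rpow_const
    fun _ => Or.inr (one_div_pos.mpr (hS.s_pos i)).le

theorem Standing.abs_le_one (hS : S.Standing) {x : Fin d → ℝ} (h : S.size x ≤ 1) (i : Fin d) :
    |x i| ≤ 1 :=
  (hS.abs_le_size_rpow x i).trans (Real.rpow_le_one (S.size_nonneg x) h (hS.s_pos i).le)

theorem Standing.isCompact_size_le (hS : S.Standing) : IsCompact {x | S.size x ≤ 1} := by
  refine (isCompact_closedBall (0 : Fin d → ℝ) 1).of_isClosed_subset
    (isClosed_le hS.continuous_size continuous_const) fun x hx => ?_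
  rw [mem_closedBall_zero_iff, pi_norm_le_iff_of_nonneg zero_le_one]
  exact fun i => hS.abs_le_one hx i

theorem Standing.exists_bound (hS : S.Standing) {F : (Fin d → ℝ) → (Fin d → ℝ) → ℝ}
    (hF : JointSmooth F) {B : Set (Fin d → ℝ)} (hB : IsCompact B) :
    ∃ C, 0 ≤ C ∧ ∀ x ∈ B, ∀ y, S.size (y - x) ≤ 1 → |F x y| ≤ C := by
  have hc : Continuous fun p : (Fin d → ℝ) × (Fin d → ℝ) => F p.1 (p.1 + p.2) :=
    (ContDiff.continuous hF).comp (continuous_fst.prodMk (continuous_fst.add continuous_snd))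
  obtain ⟨C, hC⟩ := (hB.prod hS.isCompact_size_le).exists_bound_of_continuousOn hc.continuousOn
  refine ⟨max C 0, le_max_right _ _, fun x hx y hy => le_max_of_le_left ?_⟩
  have := hC (x, y - x) ⟨hx, hy⟩
  simpa using this

variable {κ κ' : ℝ} {F G : (Fin d → ℝ) → (Fin d → ℝ) → ℝ}

theorem LocalBound.exists_nonneg (h : S.LocalBound κ F) {B : Set (Fin d → ℝ)} (hB : IsCompact B) :
    ∃ C : ℝ, 0 ≤ C ∧ ∀ x ∈ B, ∀ y, S.size (y - x) ≤ 1 →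
    (y ≠ x ∨ 0 ≤ κ) → |F x y| ≤ C * S.size (y - x) ^ κ := by
  obtain ⟨C, hC⟩ := h B hB
  exact ⟨max C 0, le_max_right _ _, fun x hx y hy hyx => (hC x hx y hy hyx).trans
    (mul_le_mul_of_nonneg_right (le_max_left _ _) (Real.rpow_nonneg (S.size_nonneg _) _))⟩

theorem localBound_zero : S.LocalBound κ 0 := fun _ _ => ⟨0, fun x _ y _ _ => by simp⟩

theorem LocalBound.add (hF : S.LocalBound κ F) (hG : S.LocalBound κ G) :
    S.LocalBound κ (F + G) := by
  intro B hB
  obtain ⟨C, hC⟩ := hF B hB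
  obtain ⟨C', hC'⟩ := hG B hB
  refine ⟨C + C', fun x hx y hy h => ?_⟩
  rw [add_mul]
  exact (abs_add_le _ _).trans (add_le_add (hC x hx y hy h) (hC' x hx y hy h))

theorem LocalBound.smul (r : ℝ) (hF : S.LocalBound κ F) : S.LocalBound κ (r • F) := by
  intro B hB
  obtain ⟨C, hC⟩ := hF B hB
  refine ⟨|r| * C, fun x hx y hy h => ?_⟩
  rw [mul_assoc]
  change |r * F x y| ≤ _
  rw [abs_mul]
  exact mul_le_mul_of_nonneg_left (hC x hx y hy h) (abs_nonneg r)

theorem LocalBound.sub (hF : S.LocalBound κ F) (hG : S.LocalBound κ G) :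
    S.LocalBound κ (F - G) := by
  have := hF.add (hG.smul (-1))
  rwa [neg_one_smul, ← sub_eq_add_neg] at this

theorem LocalBound.sum {ι : Type*} {s : Finset ι} {f : ι → (Fin d → ℝ) → (Fin d → ℝ) → ℝ}
    (h : ∀ i ∈ s, S.LocalBound κ (f i)) : S.LocalBound κ (∑ i ∈ s, f i) := by
  classical
  induction s using Finset.induction_on with
  | empty => exact localBound_zero
  | insert i s hi ih =>
    rw [Finset.sum_insert hi]
    exact (h i (Finset.mem_insert_self _ _)).add
      (ih fun j hj => h j (Finset.mem_insert_of_mem hj))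

theorem LocalBound.mono (hS : S.Standing) (h : κ' ≤ κ) (hF : S.LocalBound κ F) :
    S.LocalBound κ' F := by
  intro B hB
  obtain ⟨C, hC0, hC⟩ := hF.exists_nonneg hB
  refine ⟨C, fun x hx y hy hyx => (hC x hx y hy (hyx.imp_right h.trans')).trans
    (mul_le_mul_of_nonneg_left ?_ hC0)⟩
  by_cases hxy : y = x
  · have h0 : 0 ≤ κ' := hyx.resolve_left (not_not.mpr hxy)
    rw [hxy, sub_self, hS.size_zero]
    rcases h0.eq_or_lt with h1 | h1
    · rw [← h1, Real.rpow_zero]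
      exact Real.zero_rpow_le_one _
    · rw [Real.zero_rpow h1.ne', Real.zero_rpow (h1.trans_le h).ne']
  · exact Real.rpow_le_rpow_of_exponent_ge (hS.size_pos (sub_ne_zero.mpr hxy)) hy h

theorem LocalBound.mul (hS : S.Standing) (hF : S.LocalBound κ F) (hG : S.LocalBound κ' G) :
    S.LocalBound (κ + κ') (F * G) := by
  intro B hB
  obtain ⟨C, hC0, hC⟩ := hF.exists_nonneg hB
  obtain ⟨C', hC0', hC'⟩ := hG.exists_nonneg hB
  refine ⟨C * C', fun x hx y hy hyx => ?_⟩
  change |F x y * G x y| ≤ _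
  rw [abs_mul]
  -- off the diagonal, and on the diagonal for two nonnegative exponents
  have key : (y ≠ x ∨ 0 ≤ κ) → (y ≠ x ∨ 0 ≤ κ') →
      S.size (y - x) ^ κ * S.size (y - x) ^ κ' ≤ S.size (y - x) ^ (κ + κ') →
      |F x y| * |G x y| ≤ C * C' * S.size (y - x) ^ (κ + κ') := by
    intro h1 h2 h3
    calc |F x y| * |G x y| ≤ (C * S.size (y - x) ^ κ) * (C' * S.size (y - x) ^ κ') :=
          mul_le_mul (hC x hx y hy h1) (hC' x hx y hy h2) (abs_nonneg _)
            (mul_nonneg hC0 (Real.rpow_nonneg (S.size_nonneg _) _))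
      _ = C * C' * (S.size (y - x) ^ κ * S.size (y - x) ^ κ') := by ring
      _ ≤ _ := mul_le_mul_of_nonneg_left h3 (mul_nonneg hC0 hC0')
  by_cases hxy : y = x
  · have h0 : 0 ≤ κ + κ' := hyx.resolve_left (not_not.mpr hxy)
    have hz : S.size (y - x) = 0 := by rw [hxy, sub_self, hS.size_zero]
    have hpos : 0 ≤ C * C' * S.size (y - x) ^ (κ + κ') :=
      mul_nonneg (mul_nonneg hC0 hC0') (Real.rpow_nonneg (S.size_nonneg _) _)
    rcases le_or_gt 0 κ with h1 | h1
    · rcases le_or_gt 0 κ' with h2 | h2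
      · refine key (Or.inr h1) (Or.inr h2) (le_of_eq ?_)
        rw [Real.rpow_add_of_nonneg (S.size_nonneg _) h1 h2]
      · have h3 := hC x hx y hy (Or.inr h1)
        rw [hz, Real.zero_rpow (by linarith), mul_zero] at h3
        rw [le_antisymm h3 (abs_nonneg _), zero_mul]
        exact hpos
    · have h3 := hC' x hx y hy (Or.inr (by linarith))
      rw [hz, Real.zero_rpow (by linarith), mul_zero] at h3
      rw [le_antisymm h3 (abs_nonneg _), mul_zero]
      exact hpos
  · refine key (Or.inl hxy) (Or.inl hxy) (le_of_eq ?_)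
    rw [Real.rpow_add (hS.size_pos (sub_ne_zero.mpr hxy))]

theorem JointSmooth.localBound (hS : S.Standing) (hF : JointSmooth F) (hκ : κ ≤ 0) :
    S.LocalBound κ F := by
  refine LocalBound.mono hS hκ fun B hB => ?_
  obtain ⟨C, -, hC⟩ := hS.exists_bound hF hB
  refine ⟨C, fun x hx y hy _ => ?_⟩
  rw [Real.rpow_zero, mul_one]
  exact hC x hx y hy

/-- Along the segment from `x` to `y`, the derivative of `F x` is controlled by the partial
derivatives at an intermediate point. -/
theorem exists_segment_deriv {f : (Fin d → ℝ) → ℝ} (hf : ContDiff ℝ ∞ f) (x y : Fin d → ℝ) :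
    ∃ t ∈ Set.Ioo (0 : ℝ) 1, f y - f x =
      ∑ i, partialDeriv i f (x + t • (y - x)) * (y i - x i) := by
  let g : ℝ → ℝ := fun t => f (x + t • (y - x))
  have hg : ∀ t, HasDerivAt g (fderiv ℝ f (x + t • (y - x)) (y - x)) t := by
    intro t
    have h1 : HasDerivAt (fun t : ℝ => x + t • (y - x)) (y - x) t := by
      simpa using ((hasDerivAt_id t).smul_const (y - x)).const_add x
    exact ((differentiable_of_smooth hf _).hasFDerivAt).comp_hasDerivAt t h1
  obtain ⟨t, ht, h⟩ := exists_hasDerivAt_eq_slope g _ zero_lt_one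
    (fun t _ => (hg t).continuousAt.continuousWithinAt) fun t _ => hg t
  refine ⟨t, ht, ?_⟩
  have h2 : (y - x) = ∑ i, (y i - x i) • (Pi.single i (1 : ℝ) : Fin d → ℝ) := by
    funext j
    simp [Finset.sum_apply, Pi.single_apply]
  have h3 : f y - f x = fderiv ℝ f (x + t • (y - x)) (y - x) := by
    rw [h]
    simp [g]
  rw [h3]
  conv_lhs => rw [h2, map_sum]
  refine Finset.sum_congr rfl fun i _ => ?_
  rw [map_smul, smul_eq_mul, mul_comm, ← h2]
  rfl

/-- **Taylor's theorem**: a smooth function whose derivatives of scaled degree below `θ` vanish on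
the diagonal is bounded by the `θ`-th power of the scaled distance. -/
theorem localBound_of_multiDeriv_eq_zero (hS : S.Standing) (hF : JointSmooth F)
    {θ : ℝ} (h : ∀ x n, S.deg n < θ → multiDeriv n (F x) x = 0) : S.LocalBound θ F := by
  -- induction on the order: a derivative in a direction `i` lowers the exponent by `𝔰_i ≥ 1`
  obtain ⟨N, hN⟩ := exists_nat_ge θ
  induction N generalizing F θ with
  | zero => exact JointSmooth.localBound hS hF (by simpa using hN)
  | succ N ih =>
    rcases le_or_gt θ 0 with h0 | h0
    · exact JointSmooth.localBound hS hF h0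
    -- truncation of the exponent at `0` makes the bound monotone along segments
    have hG : ∀ i, S.LocalBound (max (θ - S.s i) 0) fun x => partialDeriv i (F x) := by
      intro i
      refine ih (JointSmooth.partialDeriv hF i) (fun x n hn => ?_) ?_
      · rw [← multiDeriv_index_single (hF.right x), ← multiDeriv_index_add (hF.right x)]
        refine h x _ ?_
        rw [S.deg_add, S.deg_single]
        rcases lt_max_iff.mp hn with h1 | h1
        · linarith
        · exact absurd h1 (not_lt.mpr (hS.deg_nonneg n))
      · have := hS.one_le_s i
        push_cast at hN
        exact max_le (by linarith) (Nat.cast_nonneg N)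
    intro B hB
    choose C hC0 hC using fun i => (hG i).exists_nonneg hB
    refine ⟨∑ i, C i, fun x hx y hy _ => ?_⟩
    have hx0 : F x x = 0 := by
      have := h x 0 (by rwa [S.deg_zero])
      rwa [multiDeriv_index_zero (hF.right x)] at this
    obtain ⟨t, ht, he⟩ := exists_segment_deriv (hF.right x) x y
    rw [hx0, sub_zero] at he
    rw [he, Finset.sum_mul]
    refine (Finset.abs_sum_le_sum_abs _ _).trans (Finset.sum_le_sum fun i _ => ?_)
    rw [abs_mul]
    have h1 : S.size (x + t • (y - x) - x) ≤ S.size (y - x) := by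
      rw [add_sub_cancel_left]
      exact hS.size_smul_le _ ht.1.le ht.2.le
    have h2 := hC i x hx (x + t • (y - x)) (h1.trans hy) (Or.inr (le_max_right _ _))
    have h3 := hS.abs_le_size_rpow (y - x) i
    have h4 : S.size (x + t • (y - x) - x) ^ max (θ - S.s i) 0 ≤
        S.size (y - x) ^ max (θ - S.s i) 0 :=
      Real.rpow_le_rpow (S.size_nonneg _) h1 (le_max_right _ _)
    have hsz := S.size_nonneg (y - x)
    calc |partialDeriv i (F x) (x + t • (y - x))| * |y i - x i|
        ≤ (C i * S.size (y - x) ^ max (θ - S.s i) 0) * S.size (y - x) ^ S.s i :=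
          mul_le_mul (h2.trans (mul_le_mul_of_nonneg_left h4 (hC0 i))) h3 (abs_nonneg _)
            (mul_nonneg (hC0 i) (Real.rpow_nonneg hsz _))
      _ = C i * S.size (y - x) ^ (max (θ - S.s i) 0 + S.s i) := by
          rw [Real.rpow_add_of_nonneg hsz (le_max_right _ _) (hS.s_pos i).le, mul_assoc]
      _ ≤ C i * S.size (y - x) ^ θ := by
          refine mul_le_mul_of_nonneg_left ?_ (hC0 i)
          refine Real.rpow_le_rpow_of_exponent_ge_of_imp hsz hy ?_ ?_
          · have := le_max_left (θ - S.s i) 0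
            linarith
          · intro _ h5
            have h6 := le_max_right (θ - S.s i) 0
            have h7 := hS.s_pos i
            linarith

theorem localBound_dp (hS : S.Standing) (n : NIdx d) :
    S.LocalBound (S.deg n) fun x y => dp (fun i => y i - x i) n := by
  have hi : ∀ i, S.LocalBound (S.s i) fun x y => y i - x i := by
    intro i B _
    refine ⟨1, fun x _ y _ _ => ?_⟩
    rw [one_mul]
    exact hS.abs_le_size_rpow (y - x) i
  induction n using NIdx.induction with
  | h0 =>
    intro B _
    refine ⟨1, fun x _ y _ _ => ?_⟩
    beta_reduce
    rw [dp_zero, S.deg_zero, Real.rpow_zero, abs_one, mul_one]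
  | h1 n i ih =>
    have h1 := (LocalBound.mul hS (hi i) ih).smul (((n i : ℝ) + 1)⁻¹)
    rw [S.deg_add, S.deg_single, add_comm (S.deg n)]
    convert h1 using 1
    funext x y
    have h2 := dp_add_single (fun i => y i - x i) n i
    have h3 : ((n i : ℝ) + 1) ≠ 0 := by positivity
    change _ = ((n i : ℝ) + 1)⁻¹ * ((y i - x i) * dp (fun i => y i - x i) n)
    rw [← h2, smul_eq_mul, inv_mul_cancel_left₀ h3]

theorem localBound_shiftCoef (hS : S.Standing) (n N : NIdx d) :
    S.LocalBound (S.deg N - S.deg n) fun x y => shiftCoef (fun i => y i - x i) n N := by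
  classical
  by_cases h : n ≤ N
  · simp only [shiftCoef, if_pos h]
    have h1 : S.deg (N - n) = S.deg N - S.deg n := by
      conv_rhs => rw [← tsub_add_cancel_of_le h, S.deg_add]
      ring
    rw [← h1]
    exact (localBound_dp hS (N - n)).smul _
  · simp only [shiftCoef, if_neg h]
    exact localBound_zero

end Setting

end Bounds

/-! ### The integration kernel -/

section Kernel

variable {d : ℕ} {L : Type*} {S : Setting d L}

open MeasureTheory

theorem integrableOn_abs_rpow {q : ℝ} (hq : -1 < q) :
    IntegrableOn (fun t : ℝ => |t| ^ q) (Set.Icc (-1) 1) := by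
  have h1 : IntervalIntegrable (fun t : ℝ => |t| ^ q) volume 0 1 := by
    refine (intervalIntegral.intervalIntegrable_rpow' (a := 0) (b := 1) hq).congr ?_
    intro t ht
    rw [Set.uIoc_of_le zero_le_one] at ht
    change t ^ q = |t| ^ q
    rw [abs_of_pos ht.1]
  have h2 : IntervalIntegrable (fun t : ℝ => |t| ^ q) volume (-1) 0 := by
    have := (IntervalIntegrable.iff_comp_neg).mp h1
    simp only [abs_neg, neg_zero] at this
    exact this.symm
  rw [integrableOn_Icc_iff_integrableOn_Ioc]
  exact (intervalIntegrable_iff_integrableOn_Ioc_of_le (by norm_num)).mp (h2.trans h1)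

namespace Setting

theorem Standing.size_rescale (hS : S.Standing) {r : ℝ} (hr : 0 ≤ r) (x : Fin d → ℝ) :
    S.size (S.rescale r x) = r * S.size x := by
  rw [size, size, Finset.mul_sum]
  refine Finset.sum_congr rfl fun i _ => ?_
  rw [rescale, abs_mul, abs_of_nonneg (Real.rpow_nonneg hr _),
    Real.mul_rpow (Real.rpow_nonneg hr _) (abs_nonneg _), ← Real.rpow_mul hr,
    mul_one_div_cancel (hS.s_pos i).ne', Real.rpow_one]

/-- A homogeneous function is controlled by its values on the unit sphere. -/
theorem Standing.exists_bound_homogeneous (hS : S.Standing) {Kbar : (Fin d → ℝ) → ℝ} {p : ℝ}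
    (hc : ContinuousOn Kbar {0}ᶜ)
    (hK : ∀ r : ℝ, 0 < r → ∀ x : Fin d → ℝ, x ≠ 0 → Kbar (S.rescale r x) = r ^ p * Kbar x) :
    ∃ C, 0 ≤ C ∧ ∀ x, x ≠ 0 → |Kbar x| ≤ C * S.size x ^ p := by
  have hcomp : IsCompact {x | S.size x = 1} :=
    hS.isCompact_size_le.of_isClosed_subset (isClosed_eq hS.continuous_size continuous_const)
      fun x hx => le_of_eq hx
  have hsub : {x | S.size x = 1} ⊆ ({0}ᶜ : Set (Fin d → ℝ)) := by
    rintro x hx rfl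
    rw [Set.mem_ofPred_eq, hS.size_zero] at hx
    exact zero_ne_one hx
  obtain ⟨C, hC⟩ := hcomp.exists_bound_of_continuousOn (hc.mono hsub)
  refine ⟨max C 0, le_max_right _ _, fun x hx => ?_⟩
  have hpos := hS.size_pos hx
  set y := S.rescale (S.size x)⁻¹ x with hy
  have hy1 : S.size y = 1 := by
    rw [hy, hS.size_rescale (inv_nonneg.mpr hpos.le), inv_mul_cancel₀ hpos.ne']
  have hy0 : y ≠ 0 := hsub hy1
  have hxy : S.rescale (S.size x) y = x := by
    funext i
    rw [hy, rescale, rescale, ← mul_assoc, ← Real.mul_rpow hpos.le (inv_nonneg.mpr hpos.le),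
      mul_inv_cancel₀ hpos.ne', Real.one_rpow, one_mul]
  rw [← hxy, hK _ hpos y hy0, hxy, abs_mul, abs_of_nonneg (Real.rpow_nonneg hpos.le _), mul_comm]
  exact mul_le_mul_of_nonneg_right ((hC y hy1).trans (le_max_left _ _))
    (Real.rpow_nonneg hpos.le _)

theorem Standing.hasCompactSupport_kernel (hS : S.Standing) {K : (Fin d → ℝ) → ℝ}
    (hK : S.IsKernel K) : HasCompactSupport K := by
  obtain ⟨Kbar, χ, -, -, -, -, hχ, hKχ⟩ := hK
  refine HasCompactSupport.intro hS.isCompact_size_le fun x hx => ?_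
  rw [hKχ]
  by_contra h
  exact hx (hχ x (right_ne_zero_of_mul h))

/-- A negative power of the scaled length is dominated by a product of powers of the coordinates,
distributed in proportion to the scaling. -/
theorem Standing.size_rpow_le_prod (hS : S.Standing) {q : ℝ} (hq : q ≤ 0) {x : Fin d → ℝ}
    (hx : ∀ i, x i ≠ 0) (hd : 0 < d) :
    S.size x ^ (q * ∑ i, S.s i) ≤ ∏ i, |x i| ^ q := by
  have hpos : 0 < S.size x := by
    refine hS.size_pos fun h => hx ⟨0, hd⟩ ?_
    rw [h]
    rfl
  rw [Finset.mul_sum, Real.rpow_sum_of_pos hpos]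
  refine Finset.prod_le_prod (fun i _ => Real.rpow_nonneg hpos.le _) fun i _ => ?_
  have h1 : 0 < |x i| := abs_pos.mpr (hx i)
  have h2 := Real.rpow_le_rpow_of_nonpos (Real.rpow_pos_of_pos h1 _) (S.rpow_le_size x i)
    (mul_nonpos_of_nonpos_of_nonneg hq (hS.s_pos i).le)
  refine h2.trans (le_of_eq ?_)
  rw [← Real.rpow_mul h1.le]
  congr 1
  have := (hS.s_pos i).ne'
  field_simp

/-- Integrability at the origin: the kernel is of order `|x|^(η-|𝔰|)` there, and this is bounded by
a product of integrable one-dimensional powers. -/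
theorem Standing.integrable_kernel (hS : S.Standing) (hd : 0 < d) {K : (Fin d → ℝ) → ℝ}
    (hK : S.IsKernel K) : Integrable K := by
  obtain ⟨Kbar, χ, hKc, hKh, hχ, hχc, hχs, hKχ⟩ := hK
  have : Nonempty (Fin d) := ⟨⟨0, hd⟩⟩
  obtain ⟨C, hC0, hC⟩ := hS.exists_bound_homogeneous hKc.continuousOn hKh
  obtain ⟨C', hC'⟩ := hχc.exists_bound_of_continuous hχ.continuous
  set σ := ∑ i, S.s i with hσ
  have hσ0 : 0 < σ := Finset.sum_pos (fun i _ => hS.s_pos i) Finset.univ_nonempty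
  -- the exponent of each coordinate: above `-1` for integrability, and `q |𝔰| ≤ η - |𝔰|`
  set q : ℝ := min (-1 + S.eta / σ) 0 with hq
  have hq1 : -1 < q := lt_min (by linarith [div_pos hS.eta_pos hσ0]) (by norm_num)
  have hq0 : q ≤ 0 := min_le_right _ _
  have hqσ : q * σ ≤ S.eta - σ := by
    calc q * σ ≤ (-1 + S.eta / σ) * σ := mul_le_mul_of_nonneg_right (min_le_left _ _) hσ0.le
      _ = S.eta - σ := by field_simp; ring
  have hmeas : Measurable K := by
    refine measurable_of_continuousOn_compl_singleton 0 ?_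
    rw [show K = fun x => Kbar x * χ x from funext hKχ]
    exact hKc.continuousOn.mul hχ.continuous.continuousOn
  have hC'0 : 0 ≤ C' := (norm_nonneg _).trans (hC' 0)
  have hint : Integrable fun x : Fin d → ℝ =>
      (C * C') * ∏ i, (Set.Icc (-1 : ℝ) 1).indicator (fun t => |t| ^ q) (x i) :=
    (Integrable.fintype_prod fun _ => (integrable_indicator_iff measurableSet_Icc).mpr
      (integrableOn_abs_rpow hq1)).const_mul _
  refine hint.mono' hmeas.aestronglyMeasurable ?_
  have hne : ∀ᵐ x : Fin d → ℝ, ∀ i, x i ≠ 0 :=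
    ae_all_iff.mpr fun i => Measure.ae_eval_ne (μ := fun _ : Fin d => volume) i 0
  filter_upwards [hne] with x hx
  have hx0 : x ≠ 0 := fun h => hx ⟨0, hd⟩ (by rw [h]; rfl)
  have hprod : 0 ≤ ∏ i, (Set.Icc (-1 : ℝ) 1).indicator (fun t => |t| ^ q) (x i) :=
    Finset.prod_nonneg fun i _ => Set.indicator_nonneg
      (fun t _ => Real.rpow_nonneg (abs_nonneg t) _) _
  by_cases hχx : χ x = 0
  · rw [hKχ, hχx, mul_zero, norm_zero]
    exact mul_nonneg (mul_nonneg hC0 hC'0) hprod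
  have hx1 := hχs x hχx
  have h1 : S.size x ^ (S.eta - σ) ≤
      ∏ i, (Set.Icc (-1 : ℝ) 1).indicator (fun t => |t| ^ q) (x i) := by
    calc S.size x ^ (S.eta - σ) ≤ S.size x ^ (q * σ) :=
          Real.rpow_le_rpow_of_exponent_ge (hS.size_pos hx0) hx1 hqσ
      _ ≤ ∏ i, |x i| ^ q := hS.size_rpow_le_prod hq0 hx hd
      _ = _ := Finset.prod_congr rfl fun i _ =>
          (Set.indicator_of_mem (Set.mem_Icc.mpr (abs_le.mp (hS.abs_le_one hx1 i)))
            (fun t : ℝ => |t| ^ q)).symm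
  rw [hKχ, norm_mul]
  calc ‖Kbar x‖ * ‖χ x‖ ≤ (C * S.size x ^ (S.eta - σ)) * C' :=
        mul_le_mul (hC x hx0) (hC' x) (norm_nonneg _)
          (mul_nonneg hC0 (Real.rpow_nonneg (S.size_nonneg _) _))
    _ ≤ (C * ∏ i, (Set.Icc (-1 : ℝ) 1).indicator (fun t => |t| ^ q) (x i)) * C' :=
        mul_le_mul_of_nonneg_right (mul_le_mul_of_nonneg_left h1 hC0) hC'0
    _ = _ := by ring

end Setting

/-- The convolution with a kernel of compact support preserves joint smoothness. -/
theorem JointSmooth.conv {K : (Fin d → ℝ) → ℝ} (hK : LocallyIntegrable K)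
    (hKc : HasCompactSupport K) {F : (Fin d → ℝ) → (Fin d → ℝ) → ℝ} (hF : JointSmooth F) :
    JointSmooth fun x => conv K (F x) := by
  obtain ⟨R, hR0, hR⟩ : ∃ R : ℝ, 0 < R ∧ tsupport K ⊆ Metric.closedBall 0 R := by
    obtain ⟨R, hR⟩ := hKc.isBounded.subset_closedBall (0 : Fin d → ℝ)
    exact ⟨max R 1, lt_max_of_lt_right zero_lt_one,
      hR.trans (Metric.closedBall_subset_closedBall (le_max_left _ _))⟩
  -- a cutoff which is one on the reflected support of the kernel
  let ψ : ContDiffBump (0 : Fin d → ℝ) := ⟨R, R + 1, hR0, by linarith⟩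
  let g : (Fin d → ℝ) × (Fin d → ℝ) → (Fin d → ℝ) → ℝ := fun p t => F p.1 (p.2 + t) * ψ t
  have hg : ContDiff ℝ ∞ ↿g := by
    have h1 : ContDiff ℝ ∞ fun q : ((Fin d → ℝ) × (Fin d → ℝ)) × (Fin d → ℝ) =>
        F q.1.1 (q.1.2 + q.2) :=
      ContDiff.comp (g := fun p : (Fin d → ℝ) × (Fin d → ℝ) => F p.1 p.2)
        (f := fun q : ((Fin d → ℝ) × (Fin d → ℝ)) × (Fin d → ℝ) => (q.1.1, q.1.2 + q.2)) hF
        (by fun_prop)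
    have h2 : ContDiff ℝ ∞ fun q : ((Fin d → ℝ) × (Fin d → ℝ)) × (Fin d → ℝ) => ψ q.2 :=
      ψ.contDiff.comp contDiff_snd
    exact h1.mul h2
  have key := contDiffOn_convolution_right_with_param_comp (n := ⊤) (𝕜 := ℝ) (μ := volume)
    (ContinuousLinearMap.mul ℝ ℝ) (s := Set.univ) (v := fun _ => (0 : Fin d → ℝ))
    contDiffOn_const (f := K) (g := g) (k := Metric.closedBall 0 (R + 1)) isOpen_univ
    (isCompact_closedBall _ _) (fun p t _ ht => ?_) hK hg.contDiffOn
  · rw [contDiffOn_univ] at key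
    change ContDiff ℝ ∞ _
    have e : ∀ f f' : (Fin d → ℝ) × (Fin d → ℝ) → ℝ, (∀ p, f' p = f p) → ContDiff ℝ ∞ f →
        ContDiff ℝ ∞ f' := fun f f' h hf => (funext h : f' = f) ▸ hf
    refine e _ _ (fun p => ?_) key
    change ∫ t, K t * F p.1 (p.2 - t) = ∫ t, K t * (F p.1 (p.2 + (0 - t)) * ψ (0 - t))
    refine integral_congr_ae (Filter.Eventually.of_forall fun t => ?_)
    change K t * F p.1 (p.2 - t) = K t * (F p.1 (p.2 + (0 - t)) * ψ (0 - t))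
    by_cases ht : K t = 0
    · rw [ht, zero_mul, zero_mul]
    · have h1 : t ∈ Metric.closedBall (0 : Fin d → ℝ) R := hR (subset_tsupport K ht)
      have h2 : ψ (0 - t) = 1 := by
        refine ψ.one_of_mem_closedBall ?_
        rw [mem_closedBall_zero_iff] at h1 ⊢
        rwa [zero_sub, norm_neg]
      rw [h2, mul_one, zero_sub, sub_eq_add_neg]
  · change F p.1 (p.2 + t) * ψ t = 0
    rw [ψ.zero_of_le_dist (by
      rw [Metric.mem_closedBall, not_le] at ht
      exact ht.le), mul_zero]

end Kernel

/-! ### Spaces of polynomials -/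

section Polynomials

variable {d : ℕ} {L : Type*}

/-- The space of polynomial functions with exponents in `s`. -/
def polyIn (s : Set (NIdx d)) : Submodule ℝ ((Fin d → ℝ) → ℝ) :=
  Submodule.span ℝ ((fun n (y : Fin d → ℝ) => dp y n) '' s)

variable {s t : Set (NIdx d)}

theorem polyIn_mono (h : s ⊆ t) : polyIn s ≤ polyIn t := Submodule.span_mono (Set.image_mono h)

theorem dp_mem_polyIn {n : NIdx d} (hn : n ∈ s) : (fun y : Fin d → ℝ => dp y n) ∈ polyIn s :=
  Submodule.subset_span ⟨n, hn, rfl⟩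

theorem dp_sub_mem_polyIn (hs : IsLowerSet s) {n : NIdx d} (hn : n ∈ s) (x : Fin d → ℝ) :
    (fun y : Fin d → ℝ => dp (y - x) n) ∈ polyIn s := by
  classical
  have h : (fun y : Fin d → ℝ => dp (y - x) n) =
      ∑ p ∈ Finset.HasAntidiagonal.antidiagonal n, dp (-x) p.2 • fun y : Fin d → ℝ => dp y p.1 := by
    funext y
    rw [Finset.sum_apply, sub_eq_add_neg]
    refine (dp_add y (-x) n).trans (Finset.sum_congr rfl fun p _ => ?_)
    rw [Pi.smul_apply, smul_eq_mul, mul_comm]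
  rw [h]
  refine Submodule.sum_mem _ fun p hp => Submodule.smul_mem _ _ (dp_mem_polyIn ?_)
  rw [Finset.HasAntidiagonal.mem_antidiagonal] at hp
  exact hs (hp ▸ le_self_add) hn

theorem comp_sub_mem_polyIn (hs : IsLowerSet s) {f : (Fin d → ℝ) → ℝ} (hf : f ∈ polyIn s)
    (x : Fin d → ℝ) : (fun y => f (y - x)) ∈ polyIn s := by
  induction hf using Submodule.span_induction with
  | mem f hf =>
    obtain ⟨n, hn, rfl⟩ := hf
    exact dp_sub_mem_polyIn hs hn x
  | zero => exact Submodule.zero_mem _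
  | add f g _ _ hf hg => exact Submodule.add_mem _ hf hg
  | smul r f _ hf => exact Submodule.smul_mem _ r hf

theorem dp_eq_shiftCoef {A : Type*} [CommRing A] [Algebra ℝ A] (h : Fin d → A) (n : NIdx d) :
    dp h n = (nFactorial n)⁻¹ • shiftCoef h 0 n := by
  rw [shiftCoef, if_pos (zero_le), tsub_zero, smul_smul, show kFact (0 : NIdx d) = 1 by
    simp [kFact], div_one, kFact_eq_nFactorial, inv_mul_cancel₀ (nFactorial_pos n).ne', one_smul]

theorem contDiff_dp (n : NIdx d) (x : Fin d → ℝ) :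
    ContDiff ℝ ∞ fun y : Fin d → ℝ => dp (y - x) n := by
  have h : (fun y : Fin d → ℝ => dp (y - x) n) =
      fun y : Fin d → ℝ => (nFactorial n)⁻¹ • shiftCoef (fun i => y i - x i) 0 n :=
    funext fun y => dp_eq_shiftCoef _ n
  rw [h]
  exact (contDiff_shiftCoef x 0 n).const_smul _

theorem multiDeriv_dp (n m : NIdx d) (x : Fin d → ℝ) :
    multiDeriv m (fun y : Fin d → ℝ => dp (y - x) n) x = if m = n then 1 else 0 := by
  have h : (fun y : Fin d → ℝ => dp (y - x) n) =
      fun y : Fin d → ℝ => ∑ _i ∈ ({()} : Finset Unit), (nFactorial n)⁻¹ *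
        shiftCoef (fun i => y i - x i) 0 n := by
    funext y
    rw [Finset.sum_singleton]
    exact dp_eq_shiftCoef _ n
  rw [h, multiDeriv_sum _ (fun _ => (nFactorial n)⁻¹) fun _ _ => contDiff_shiftCoef x 0 n,
    Finset.sum_singleton, multiDeriv_shiftCoef]
  have h0 : (fun i => x i - x i) = (0 : Fin d → ℝ) := funext fun i => sub_self _
  rw [h0]
  split_ifs with hmn
  · rw [hmn, shiftCoef_self, mul_one, inv_mul_cancel₀ (nFactorial_pos n).ne']
  · rw [shiftCoef_zero hmn, mul_zero, mul_zero]

theorem exists_expansion (hs : IsLowerSet s) {f : (Fin d → ℝ) → ℝ} (hf : f ∈ polyIn s)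
    (x : Fin d → ℝ) : ∃ (F : Finset (NIdx d)) (a : NIdx d → ℝ), (F : Set (NIdx d)) ⊆ s ∧
      f = fun y => ∑ n ∈ F, a n * dp (y - x) n := by
  have h := comp_sub_mem_polyIn hs hf (-x)
  rw [polyIn, Finsupp.mem_span_image_iff_linearCombination] at h
  obtain ⟨l, hl, h⟩ := h
  refine ⟨l.support, l, (Finsupp.mem_supported ℝ l).mp hl, ?_⟩
  funext y
  have h2 := congrFun h (y - x)
  rw [sub_neg_eq_add, sub_add_cancel] at h2
  rw [← h2, Finsupp.linearCombination_apply, Finsupp.sum, Finset.sum_apply]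
  rfl

theorem contDiff_of_mem_polyIn {f : (Fin d → ℝ) → ℝ} (hf : f ∈ polyIn s) : ContDiff ℝ ∞ f := by
  obtain ⟨F, a, -, rfl⟩ := exists_expansion (s := Set.univ) (fun _ _ _ _ => trivial)
    (polyIn_mono (Set.subset_univ s) hf) 0
  exact ContDiff.sum fun n _ => contDiff_const.mul (contDiff_dp n 0)

/-- A polynomial is determined by its derivatives at a point. -/
theorem eq_zero_of_multiDeriv_eq_zero (hs : IsLowerSet s) {f : (Fin d → ℝ) → ℝ}
    (hf : f ∈ polyIn s) {x : Fin d → ℝ} (h : ∀ n ∈ s, multiDeriv n f x = 0) : f = 0 := by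
  classical
  obtain ⟨F, a, hF, rfl⟩ := exists_expansion hs hf x
  funext y
  refine Finset.sum_eq_zero fun m hm => ?_
  have h1 := h m (hF hm)
  rw [multiDeriv_sum F a fun n _ => contDiff_dp n x] at h1
  simp_rw [multiDeriv_dp] at h1
  simp only [mul_ite, mul_one, mul_zero] at h1
  rw [Finset.sum_ite_eq, if_pos hm] at h1
  rw [h1, zero_mul]

theorem exists_mvPolynomial {f : (Fin d → ℝ) → ℝ} (hf : f ∈ polyIn s) :
    ∃ q : MvPolynomial (Fin d) ℝ, (∀ n ∈ q.support, n ∈ s) ∧ ∀ y, f y = MvPolynomial.eval y q := by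
  classical
  induction hf using Submodule.span_induction with
  | mem f hf =>
    obtain ⟨n, hn, rfl⟩ := hf
    refine ⟨MvPolynomial.monomial n (nFactorial n)⁻¹, fun m hm => ?_, fun y => ?_⟩
    · rw [Finset.mem_singleton.mp (MvPolynomial.support_monomial_subset hm)]
      exact hn
    · rw [MvPolynomial.eval_monomial, Finsupp.prod_fintype _ _ (by simp), ← shiftCoef_zero_left]
      exact dp_eq_shiftCoef y n
  | zero => exact ⟨0, by simp, by simp⟩
  | add f g _ _ hf hg =>
    obtain ⟨q, hq, h1⟩ := hf
    obtain ⟨q', hq', h2⟩ := hg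
    refine ⟨q + q', fun n hn => ?_, fun y => ?_⟩
    · rcases Finset.mem_union.mp (MvPolynomial.support_add hn) with h | h
      · exact hq n h
      · exact hq' n h
    · rw [map_add, Pi.add_apply, h1, h2]
  | smul r f _ hf =>
    obtain ⟨q, hq, h1⟩ := hf
    refine ⟨r • q, fun n hn => hq n (MvPolynomial.support_smul hn), fun y => ?_⟩
    rw [MvPolynomial.smul_eval, Pi.smul_apply, smul_eq_mul, h1]

theorem dp_mul_dp (y : Fin d → ℝ) (n m : NIdx d) :
    dp y n * dp y m = (nFactorial (n + m) / (nFactorial n * nFactorial m)) * dp y (n + m) := by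
  have h : ∀ N : NIdx d, dp y N = (nFactorial N)⁻¹ * ∏ i, y i ^ N i := fun N => by
    rw [dp_eq_shiftCoef, shiftCoef_zero_left, smul_eq_mul]
  have h1 := (nFactorial_pos n).ne'
  have h2 := (nFactorial_pos m).ne'
  have h3 := (nFactorial_pos (n + m)).ne'
  rw [h, h, h]
  simp only [Finsupp.add_apply, pow_add, Finset.prod_mul_distrib]
  field_simp

theorem mul_mem_polyIn {u : Set (NIdx d)} (hst : ∀ n ∈ s, ∀ m ∈ t, n + m ∈ u)
    {f g : (Fin d → ℝ) → ℝ} (hf : f ∈ polyIn s) (hg : g ∈ polyIn t) : f * g ∈ polyIn u := by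
  induction hf using Submodule.span_induction with
  | mem f hf =>
    obtain ⟨n, hn, rfl⟩ := hf
    induction hg using Submodule.span_induction with
    | mem g hg =>
      obtain ⟨m, hm, rfl⟩ := hg
      have h : ((fun y : Fin d → ℝ => dp y n) * fun y : Fin d → ℝ => dp y m) =
          (nFactorial (n + m) / (nFactorial n * nFactorial m)) •
            fun y : Fin d → ℝ => dp y (n + m) := funext fun y => dp_mul_dp y n m
      rw [h]
      exact Submodule.smul_mem _ _ (dp_mem_polyIn (hst n hn m hm))
    | zero => rw [mul_zero]; exact Submodule.zero_mem _
    | add f g _ _ hf hg => rw [mul_add]; exact Submodule.add_mem _ hf hg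
    | smul r f _ hf => rw [mul_smul_comm]; exact Submodule.smul_mem _ r hf
  | zero => rw [zero_mul]; exact Submodule.zero_mem _
  | add f g _ _ hf hg => rw [add_mul]; exact Submodule.add_mem _ hf hg
  | smul r f _ hf => rw [smul_mul_assoc]; exact Submodule.smul_mem _ r hf

open MeasureTheory

variable {K : (Fin d → ℝ) → ℝ}

theorem convolutionExists_of_continuous (hK : LocallyIntegrable K) (hKc : HasCompactSupport K)
    {f : (Fin d → ℝ) → ℝ} (hf : Continuous f) :
    ConvolutionExists K f (ContinuousLinearMap.mul ℝ ℝ) volume :=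
  hKc.convolutionExists_left_of_continuous_right _ hK hf

theorem conv_add (hK : LocallyIntegrable K) (hKc : HasCompactSupport K)
    {f g : (Fin d → ℝ) → ℝ} (hf : Continuous f) (hg : Continuous g) :
    conv K (f + g) = conv K f + conv K g :=
  (convolutionExists_of_continuous hK hKc hf).distrib_add
    (convolutionExists_of_continuous hK hKc hg)

theorem conv_smul (r : ℝ) (f : (Fin d → ℝ) → ℝ) : conv K (r • f) = r • conv K f :=
  convolution_smul

theorem conv_sum (hK : LocallyIntegrable K) (hKc : HasCompactSupport K) {ι : Type*}
    (F : Finset ι) (a : ι → ℝ) {f : ι → (Fin d → ℝ) → ℝ} (hf : ∀ i ∈ F, Continuous (f i)) :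
    conv K (fun y => ∑ i ∈ F, a i * f i y) = fun y => ∑ i ∈ F, a i * conv K (f i) y := by
  classical
  induction F using Finset.induction_on with
  | empty =>
    simp only [Finset.sum_empty]
    funext y
    change ∫ t, K t * 0 = 0
    simp
  | insert i F hi ih =>
    have h1 : (fun y => ∑ j ∈ insert i F, a j * f j y) =
        a i • f i + fun y => ∑ j ∈ F, a j * f j y := by
      funext y
      rw [Finset.sum_insert hi]
      rfl
    have hF : ∀ j ∈ F, Continuous (f j) := fun j hj => hf j (Finset.mem_insert_of_mem hj)
    have hc : Continuous fun y => ∑ j ∈ F, a j * f j y :=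
      continuous_finsetSum _ fun j hj => continuous_const.mul (hF j hj)
    rw [h1, conv_add hK hKc ((hf i (Finset.mem_insert_self _ _)).const_smul (a i)) hc, conv_smul,
      ih hF]
    funext y
    rw [Finset.sum_insert hi]
    rfl

/-- Convolution with the kernel maps polynomials to polynomials: in the binomial expansion of
`dp (y - z) n` only exponents below `n` occur. -/
theorem conv_mem_polyIn (hK : LocallyIntegrable K) (hKc : HasCompactSupport K)
    (hs : IsLowerSet s) {f : (Fin d → ℝ) → ℝ} (hf : f ∈ polyIn s) : conv K f ∈ polyIn s := by
  classical
  induction hf using Submodule.span_induction with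
  | mem f hf =>
    obtain ⟨n, hn, rfl⟩ := hf
    have h : conv K (fun y : Fin d → ℝ => dp y n) =
        ∑ p ∈ Finset.HasAntidiagonal.antidiagonal n,
          (conv K (fun y : Fin d → ℝ => dp y p.2) 0) • fun y : Fin d → ℝ => dp y p.1 := by
      funext y
      have hc : ∀ m : NIdx d, Continuous fun y : Fin d → ℝ => dp y m := fun m => by
        have := (contDiff_dp m (0 : Fin d → ℝ)).continuous
        simpa only [sub_zero] using this
      have h1 : ∀ m, conv K (fun z : Fin d → ℝ => dp (y + z) m) 0 =
          conv K (fun z : Fin d → ℝ => dp z m) y := by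
        intro m
        change ∫ t, K t * dp (y + (0 - t)) m = ∫ t, K t * dp (y - t) m
        simp only [zero_sub, ← sub_eq_add_neg]
      have h2 : (fun z : Fin d → ℝ => dp (y + z) n) = fun z =>
          ∑ p ∈ Finset.HasAntidiagonal.antidiagonal n, dp y p.1 * dp z p.2 :=
        funext fun z => dp_add y z n
      have h3 := conv_sum hK hKc (Finset.HasAntidiagonal.antidiagonal n)
        (fun p : (Fin d →₀ ℕ) × (Fin d →₀ ℕ) => dp y p.1) (f := fun p z => dp z p.2)
        fun p _ => hc p.2
      rw [← h1, h2, h3, Finset.sum_apply]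
      exact Finset.sum_congr rfl fun p _ => mul_comm _ _
    rw [h]
    refine Submodule.sum_mem _ fun p hp => Submodule.smul_mem _ _ (dp_mem_polyIn ?_)
    rw [Finset.HasAntidiagonal.mem_antidiagonal] at hp
    exact hs (hp ▸ le_self_add) hn
  | zero =>
    have : conv K 0 = 0 := by
      have := conv_smul (K := K) 0 0
      rwa [zero_smul, zero_smul] at this
    rw [this]
    exact Submodule.zero_mem _
  | add f g hf hg h1 h2 =>
    rw [conv_add hK hKc (contDiff_of_mem_polyIn hf).continuous
      (contDiff_of_mem_polyIn hg).continuous]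
    exact Submodule.add_mem _ h1 h2
  | smul r f _ hf =>
    rw [conv_smul]
    exact Submodule.smul_mem _ r hf

end Polynomials

/-! ### Index sets and the right-hand side -/

section Indices

variable {d : ℕ} {L : Type*} {S : Setting d L}

theorem eNoise_mem_setNminus (hS : S.Standing) (l : Option L) : eNoise l 0 ∈ S.setNminus := by
  classical
  refine ⟨by rw [bracket_eNoise]; simp, fun l' k' h => ?_, fun n _ => by simp [eNoise]⟩
  have : (l, (0 : NIdx d →₀ ℕ)) = (l', k') := by
    by_contra h3
    apply h
    rw [eNoise, Finsupp.single_apply, if_neg fun h4 => h3 (Sum.inl.inj h4)]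
  rw [Prod.mk.injEq] at this
  rw [← this.2]
  exact hS.subcritical_zero l'

theorem ePoly_notMem_setN (n : NIdx d) : ePoly L n ∉ S.setN := fun h => by
  have := h.2
  rw [noiseHom_ePoly] at this
  exact lt_irrefl _ this

theorem degree_pos_of_bracket_eq_one {γ : MIdx d L} (h : bracket γ = 1) : 0 < γ.degree := by
  rw [Nat.pos_iff_ne_zero, Ne, Finsupp.degree_eq_zero_iff]
  rintro rfl
  simp [bracket] at h

/-- Apart from the noises themselves, the multi-indices in `𝓝` have degree at least two. -/
theorem eNoise_or_two_le_degree {γ : MIdx d L} (hγ : γ ∈ S.setN) :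
    (∃ l k, γ = eNoise l k) ∨ 2 ≤ γ.degree := by
  by_contra h
  push Not at h
  have h0 := degree_pos_of_bracket_eq_one hγ.1.1
  have h1 : γ.degree = 1 := by omega
  obtain ⟨γ', c, rfl, hlt⟩ := exists_eq_add_single γ fun h2 => by simp [h2] at h0
  have h2 : γ' = 0 := by
    rw [← Finsupp.degree_eq_zero_iff]
    omega
  rw [h2, zero_add] at h hγ
  rcases c with ⟨l, k⟩ | n
  · exact h.1 l k rfl
  · exact ePoly_notMem_setN n hγ

/-- Multi-indices of negative homogeneity involve only derivatives of order less than `η`. -/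
theorem deg_lt_eta_of_hom_neg (hS : S.Standing) {β : MIdx d L} (hβ : β ∈ S.setNminus)
    (hneg : S.hom β < 0) {m : NIdx d} (hm : β (Sum.inr m) ≠ 0) : S.deg m < S.eta := by
  classical
  -- the weight `|·| + (η - r) [·]` is nonnegative on all coordinates which occur in `β`, and equals
  -- `|𝐦| - r` on `z_𝐦`; since `[β] = 1`, its total is `|β| + η - r`, so `|𝐦| ≤ |β| + η < η`
  let w : Coord d L → ℝ := fun c => S.hom (Finsupp.single c 1) +
    (S.eta - S.regsol) * (bracket (Finsupp.single c 1) : ℤ)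
  have hsum : S.hom β + (S.eta - S.regsol) * (bracket β : ℤ) =
      ∑ c ∈ β.support, (β c : ℝ) * w c := by
    have h1 := addHom_eq_sum S.homHom β
    have h2 := addHom_eq_sum bracketHom β
    change S.hom β = _ at h1
    change bracket β = _ at h2
    rw [h1, h2, Finsupp.sum, Finsupp.sum]
    push_cast
    rw [Finset.mul_sum, ← Finset.sum_add_distrib]
    refine Finset.sum_congr rfl fun c _ => ?_
    simp only [w, nsmul_eq_mul]
    change (β c : ℝ) * S.hom _ + (S.eta - S.regsol) * (((β c : ℤ) * bracket _ : ℤ) : ℝ) = _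
    push_cast
    ring
  have hinr : ∀ n, w (Sum.inr n) = S.deg n - S.regsol := by
    intro n
    have h1 := S.hom_ePoly (L := L) n
    have h2 := bracket_ePoly (L := L) n
    rw [ePoly] at h1 h2
    simp only [w, h1, h2]
    push_cast
    ring
  have hinl : ∀ l k, w (Sum.inl (l, k)) = S.eta + (S.alpha l + S.regSum k) - S.regsol := by
    intro l k
    have h1 := S.hom_eNoise l k
    have h2 := bracket_eNoise l k
    rw [eNoise] at h1 h2
    have h3 : S.regSum k = (k.sum fun n a => (S.eta - S.deg n) * (a : ℝ)) -
        (S.eta - S.regsol) * (k.degree : ℝ) := by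
      rw [Setting.regSum, Finsupp.degree_apply, Finsupp.sum, Finsupp.sum]
      push_cast
      rw [Finset.mul_sum, ← Finset.sum_sub_distrib]
      exact Finset.sum_congr rfl fun n _ => by ring
    simp only [w, h1, h2, h3]
    push_cast
    ring
  have hnonneg : ∀ c ∈ β.support, 0 ≤ w c := by
    rintro (⟨l, k⟩ | n) hc
    · have hsub := hβ.2.1 l k (Finsupp.mem_support_iff.mp hc)
      rw [hinl]
      have hreg := hS.reg_lt l
      by_cases hk : k = 0
      · have := hsub.1
        rw [hk, Setting.regSum, Finsupp.sum_zero_index]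
        linarith
      · have := (hsub.2 k (pos_iff_ne_zero.mpr hk) le_rfl).2
        linarith
    · rw [hinr]
      by_contra h
      exact (Finsupp.mem_support_iff.mp hc) (hβ.2.2 n (by linarith))
  have hle : w (Sum.inr m) ≤ ∑ c ∈ β.support, (β c : ℝ) * w c := by
    have hms := Finsupp.mem_support_iff.mpr hm
    refine le_trans ?_ (Finset.single_le_sum (f := fun c => (β c : ℝ) * w c)
      (fun c hc => mul_nonneg (Nat.cast_nonneg _) (hnonneg c hc)) hms)
    refine le_mul_of_one_le_left (hnonneg _ hms) ?_
    exact_mod_cast Nat.one_le_iff_ne_zero.mpr hm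
  rw [← hsum, hinr, hβ.1] at hle
  push_cast at hle
  linarith

/-- The multi-indices which occur in `∑_𝔩 ξ_𝔩 z_(𝔩,0) + c`. -/
def IsSource (S : Setting d L) (γ : MIdx d L) : Prop := (∃ l, γ = eNoise l 0) ∨ γ ∈ S.setC

theorem IsSource.mem_setNminus (hS : S.Standing) {γ : MIdx d L} (h : IsSource S γ) :
    γ ∈ S.setNminus := by
  rcases h with ⟨l, rfl⟩ | h
  · exact eNoise_mem_setNminus hS l
  · exact h.1.1

theorem IsSource.eNoise_or_two_le_degree {γ : MIdx d L} (h : IsSource S γ) :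
    (∃ l k, γ = eNoise l k) ∨ 2 ≤ γ.degree := by
  rcases h with ⟨l, rfl⟩ | h
  · exact Or.inl ⟨l, 0, rfl⟩
  · exact MultiIndexModel.eNoise_or_two_le_degree h.1

theorem IsSource.deg_lt (hS : S.Standing) {γ : MIdx d L} (h : IsSource S γ) {n : NIdx d}
    (hn : γ (Sum.inr n) ≠ 0) : S.deg n < S.eta := by
  rcases h with ⟨l, rfl⟩ | h
  · exact absurd (by simp [eNoise]) hn
  · exact deg_lt_eta_of_hom_neg hS h.1.1 h.2.1 hn

theorem hom_eNoise_zero (l : Option L) : S.hom (eNoise l 0) = S.alpha l := by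
  rw [S.hom_eNoise, Finsupp.sum_zero_index, add_zero]

theorem IsSource.hom_nonpos (hS : S.Standing) {γ : MIdx d L} (h : IsSource S γ) :
    S.hom γ ≤ 0 := by
  rcases h with ⟨l, rfl⟩ | h
  · rw [hom_eNoise_zero]
    cases l with
    | none => exact hS.alpha_zero.le
    | some l => exact (hS.alpha_neg l).le
  · exact h.2.1.le

theorem zero_notMem_setMminus (n : NIdx d) : ((0 : MIdx d L), n) ∉ S.setMminus :=
  fun h => setN_notMem_zero n h.1

theorem zero_notMem_setMplus (n : NIdx d) : ((0 : MIdx d L), n) ∉ S.setMplus :=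
  fun h => setN_notMem_zero n h.1

theorem finite_setMminus (hS : S.Standing) (β : MIdx d L) : {n | (β, n) ∈ S.setMminus}.Finite :=
  (hS.finite_deg_lt S.eta).subset fun _ h => h.2

theorem finite_setMplus (hS : S.Standing) (β : MIdx d L) : {n | (β, n) ∈ S.setMplus}.Finite :=
  (hS.finite_deg_lt (S.eta + S.hom β)).subset fun _ h => h.2

variable [Fintype L] {ξ : L → (Fin d → ℝ) → ℝ} {c : MIdx d L → ℝ}

theorem isSource_of_rhsCoef_ne_zero (hc : S.Admissible c) {γ : MIdx d L} {y : Fin d → ℝ}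
    (h : Setting.rhsCoef ξ c y γ ≠ 0) : IsSource S γ := by
  by_contra h1
  apply h
  rw [IsSource, not_or] at h1
  have h2 : c γ = 0 := by
    by_contra h3
    exact h1.2 (hc γ h3)
  rw [Setting.rhsCoef, h2, add_zero]
  refine Finset.sum_eq_zero fun l _ => if_neg fun h3 => h1.1 ⟨l, h3⟩

theorem contDiff_rhsCoef (hξ : ∀ l, ContDiff ℝ ∞ (ξ l)) (γ : MIdx d L) :
    ContDiff ℝ ∞ fun y => Setting.rhsCoef ξ c y γ := by
  classical
  refine ContDiff.add (ContDiff.sum fun l _ => ?_) contDiff_const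
  by_cases h : γ = eNoise l 0
  · simp only [h, if_true]
    cases l with
    | none => exact contDiff_const
    | some l => exact hξ l
  · simp only [h, if_false]
    exact contDiff_const

theorem rhsCoef_noise_none (hc : S.Admissible c) (y : Fin d → ℝ) :
    Setting.rhsCoef ξ c y (eNoise none 0) = 1 := by
  classical
  have h2 : c (eNoise none 0) = 0 := by
    by_contra h3
    have := (hc _ h3).1.2
    rw [noiseHom_eNoise_none] at this
    exact lt_irrefl _ this
  rw [Setting.rhsCoef, h2, add_zero, Finset.sum_eq_single none]
  · rw [if_pos rfl]
    rfl
  · intro l _ hl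
    refine if_neg fun h => hl ?_
    have := Finsupp.single_left_injective one_ne_zero h
    exact (Prod.ext_iff.mp (Sum.inl.inj this)).1.symm
  · exact fun h => absurd (Finset.mem_univ _) h

end Indices

/-! ### Filtrations by analytic properties of the coefficients -/

section AnalyticFiltrations

variable {d : ℕ} {L : Type*} {S : Setting d L}

/-- The algebra of functions of a base point and an argument. -/
abbrev BiFun (d : ℕ) := (Fin d → ℝ) → (Fin d → ℝ) → ℝ

/-- Evaluation of functions of two points. -/
def biEval (x y : Fin d → ℝ) : BiFun d →ₐ[ℝ] ℝ :=
  (Pi.evalAlgHom ℝ (fun _ : Fin d → ℝ => ℝ) y).comp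
    (Pi.evalAlgHom ℝ (fun _ : Fin d → ℝ => (Fin d → ℝ) → ℝ) x)

/-- The displacement `(x,y) ↦ y_i - x_i`. -/
def biDisp (i : Fin d) : BiFun d := fun x y => y i - x i

theorem shiftCoef_biDisp (n N : NIdx d) :
    shiftCoef (biDisp (d := d)) n N = fun x y => shiftCoef (fun i => y i - x i) n N :=
  funext fun x => funext fun y => map_shiftCoef (biEval x y) biDisp n N

theorem jointSmooth_shiftCoef (n N : NIdx d) :
    JointSmooth fun x y : Fin d → ℝ => shiftCoef (fun i => y i - x i) n N := by
  have h := contDiff_shiftCoef (0 : Fin d → ℝ) n N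
  have h1 : ContDiff ℝ ∞ fun p : (Fin d → ℝ) × (Fin d → ℝ) => p.2 - p.1 := by fun_prop
  have h2 := ContDiff.comp h h1
  simp only [Function.comp_def, Pi.sub_apply, Pi.zero_apply, sub_zero] at h2
  exact h2

theorem Filtration.level_jetOf {A W : Type*} [CommRing A] [Algebra ℝ A] [AddCommMonoid W]
    {Φ : Filtration d L A W} {h : Fin d → A} {π : NIdx d → ZSeries d L A} {n : NIdx d} {a : W}
    (h1 : ∀ N, Φ.mem (ePoly L N) a (shiftCoef h n N)) (h2 : Φ.Level a (π n)) :
    Φ.Level a (jetOf h π n) := by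
  refine Filtration.Level.add (fun β => ?_) h2
  by_cases hβ : β ∈ Set.range (ePoly L)
  · obtain ⟨N, rfl⟩ := hβ
    rw [coeff_linSeries]
    exact h1 N
  · rw [coeff_linSeries_of_notMem _ hβ]
    exact Φ.zero _ _

theorem Filtration.level_charSeries {A W : Type*} [CommRing A] [Algebra ℝ A] [AddCommMonoid W]
    {Φ : Filtration d L A W} {M : Set (MIdx d L × NIdx d)} {v : M → A} {n : NIdx d} {a : W}
    (h : ∀ β (hβ : (β, n) ∈ M), Φ.mem β a (v ⟨(β, n), hβ⟩)) : Φ.Level a (charSeries v n) := by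
  intro β
  by_cases hβ : (β, n) ∈ M
  · rw [coeff_charSeries _ hβ]
    exact h β hβ
  · rw [coeff_charSeries_of_notMem _ hβ]
    exact Φ.zero _ _

theorem Filtration.level_jetMonomial_of_level {A W : Type*} [CommRing A] [Algebra ℝ A]
    [AddCommMonoid W] {Φ : Filtration d L A W} (f : MIdx d L →+ W)
    (hf : ∀ l k n, f (eNoise l (k + Finsupp.single n 1)) + f (ePoly L n) = f (eNoise l k))
    (hX : ∀ c, Φ.mem (Finsupp.single c 1) (f (Finsupp.single c 1)) 1)
    {u : NIdx d → ZSeries d L A} (hu : ∀ n, Φ.Level (f (ePoly L n)) (u n)) (γ : MIdx d L) :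
    Φ.Level (f γ) (S.jetMonomial u γ) := by
  refine Filtration.level_jetMonomial ?_
  rintro (⟨l, k⟩ | n) _
  · refine Filtration.level_jetImage_inl l k (fun l k => hX _)
      (fun n _ => (hu n).sub (Filtration.Level.X (hX _))) fun k' hk' β x => ?_
    rw [noise_weight_eq f l (hf l) hk'.1]
    exact id
  · exact hu n

/-- The (one-level) filtration by joint smoothness. -/
def smoothFiltration (d : ℕ) (L : Type*) : Filtration d L (BiFun d) Unit where
  mem _ _ F := JointSmooth F
  zero _ _ := contDiff_const
  add _ _ _ _ h h' := ContDiff.add h h'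
  smul _ _ r _ h := ContDiff.const_smul r h
  mul _ _ _ _ _ _ h h' := ContDiff.mul h h'
  one := contDiff_const

/-- The filtration by homogeneity bounds: at level `a`, the coefficient of `z^β` is of order
`|β| - a`. -/
def boundFiltration (hS : S.Standing) : Filtration d L (BiFun d) ℝ where
  mem β a F := S.LocalBound (S.hom β - a) F
  zero _ _ := Setting.localBound_zero
  add _ _ _ _ h h' := h.add h'
  smul _ _ r _ h := h.smul r
  mul β β' a a' _ _ h h' := by
    rw [S.hom_add, add_sub_add_comm]
    exact Setting.LocalBound.mul hS h h'
  one := by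
    have h : S.hom (0 : MIdx d L) - 0 = 0 := by
      rw [sub_zero]
      exact map_zero S.homHom
    rw [h]
    exact Setting.JointSmooth.localBound hS contDiff_const le_rfl

/-- The multi-indices of scaled degree at most `κ`. -/
def degLE (S : Setting d L) (κ : ℝ) : Set (NIdx d) := {n | S.deg n ≤ κ}

/-- The multi-indices of scaled degree less than `κ`. -/
def degLT (S : Setting d L) (κ : ℝ) : Set (NIdx d) := {n | S.deg n < κ}

theorem isLowerSet_degLE (hS : S.Standing) (κ : ℝ) : IsLowerSet (degLE S κ) :=
  fun _ _ h hm => (hS.deg_mono h).trans hm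

theorem isLowerSet_degLT (hS : S.Standing) (κ : ℝ) : IsLowerSet (degLT S κ) :=
  fun _ _ h hm => (hS.deg_mono h).trans_lt hm

theorem one_mem_polyIn {s : Set (NIdx d)} (h : 0 ∈ s) : (1 : (Fin d → ℝ) → ℝ) ∈ polyIn s := by
  have h1 := dp_mem_polyIn h
  simp only [dp_zero] at h1
  exact h1

/-- The filtration which requires, on the multi-indices without noises, the coefficient of `z^β`
to be a polynomial of degree at most `|β| - a` in the second point. -/
def polyFiltration (S : Setting d L) : Filtration d L (BiFun d) ℝ where
  mem β a F := noiseHom β = 0 → ∀ x, F x ∈ polyIn (degLE S (S.hom β - a))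
  zero _ _ _ _ := Submodule.zero_mem _
  add _ _ _ _ h h' h0 x := Submodule.add_mem _ (h h0 x) (h' h0 x)
  smul _ _ r _ h h0 x := Submodule.smul_mem _ r (h h0 x)
  mul β β' a a' _ _ h h' h0 x := by
    rw [noiseHom_add] at h0
    refine mul_mem_polyIn (fun n hn m hm => ?_) (h (by omega) x) (h' (by omega) x)
    change S.deg _ ≤ _
    rw [S.deg_add, S.hom_add, add_sub_add_comm]
    exact add_le_add hn hm
  one _ x := by
    refine one_mem_polyIn ?_
    change S.deg 0 ≤ S.hom 0 - 0
    rw [S.deg_zero, sub_zero]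
    exact (map_zero S.homHom).ge

end AnalyticFiltrations

/-! ### The model -/

section Model

variable {d : ℕ} {L : Type*} {S : Setting d L}

/-- The jet of the characters `𝚷_x(y)`, as a power series over the functions of `x` and `y`. -/
def modelJet (S : Setting d L) (P : MIdx d L → BiFun d) : NIdx d → ZSeries d L (BiFun d) :=
  charJet (M := S.setMminus) (Sum.elim
    (fun p x y => (nFactorial p.1.2)⁻¹ * multiDeriv p.1.2 (P p.1.1 x) y) biDisp)

theorem mapAlgHom_modelJet (P : MIdx d L → BiFun d) (x y : Fin d → ℝ) (n : NIdx d) :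
    MvPowerSeries.mapAlgHom (biEval x y) (modelJet S P n) =
      jetOfChar (S.modelChar (fun β => P β x) x y) n := by
  rw [modelJet, mapAlgHom_charJet, jetOfChar]
  congr 1
  funext a
  rw [Setting.modelChar, MvPolynomial.aeval_X]
  rcases a with p | i <;> rfl

theorem coeff_jetMonomial_modelJet (P : MIdx d L → BiFun d) (β γ : MIdx d L) (x y : Fin d → ℝ) :
    MvPowerSeries.coeff β (S.jetMonomial (modelJet S P) γ) x y = MvPowerSeries.coeff β
      (S.jetMonomial (jetOfChar (S.modelChar (fun β => P β x) x y)) γ) := by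
  have h := S.mapAlgHom_jetMonomial (biEval x y) (modelJet S P) γ
  simp only [mapAlgHom_modelJet] at h
  change _ = S.jetMonomial (jetOfChar (S.modelChar (fun β => P β x) x y)) γ at h
  rw [← h, MvPowerSeries.mapAlgHom_apply, MvPowerSeries.coeff_map]
  rfl

theorem jetAdm_modelJet (hS : S.Standing) (P : MIdx d L → BiFun d) : JetAdm (modelJet S P) :=
  jetAdm_charJet zero_notMem_setMminus (finite_setMminus hS) _

theorem jetAdm_modelChar (hS : S.Standing)
    (f : MvPolynomial (S.setMminus ⊕ Fin d) ℝ →ₐ[ℝ] ℝ) : JetAdm (jetOfChar f) :=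
  jetAdm_charJet zero_notMem_setMminus (finite_setMminus hS) _

theorem supportedInN_charSeries {A : Type*} [CommRing A] [Algebra ℝ A]
    {M : Set (MIdx d L × NIdx d)} (hM : ∀ p ∈ M, p.1 ∈ S.setN) (v : M → A) :
    SupportedInN S (charSeries v) := by
  intro n β h
  by_contra h1
  exact h (coeff_charSeries_of_notMem _ fun h2 => h1 (hM _ h2))

theorem coeff_charJet_congr {A : Type*} [CommRing A] [Algebra ℝ A]
    {M : Set (MIdx d L × NIdx d)} {v v' : M ⊕ Fin d → A} {n : NIdx d} {β : MIdx d L}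
    (h1 : ∀ i, v (Sum.inr i) = v' (Sum.inr i))
    (h2 : ∀ h : (β, n) ∈ M, v (Sum.inl ⟨(β, n), h⟩) = v' (Sum.inl ⟨(β, n), h⟩)) :
    MvPowerSeries.coeff β (charJet v n) = MvPowerSeries.coeff β (charJet v' n) := by
  have h3 : (fun i => v (Sum.inr i)) = fun i => v' (Sum.inr i) := funext h1
  rw [charJet, charJet, jetOf, jetOf, map_add, map_add, h3]
  congr 1
  by_cases hm : (β, n) ∈ M
  · rw [coeff_charSeries _ hm, coeff_charSeries _ hm]
    exact h2 hm
  · rw [coeff_charSeries_of_notMem _ hm, coeff_charSeries_of_notMem _ hm]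

theorem Filtration.level_charJet {W : Type*} [AddCommMonoid W] {Φ : Filtration d L (BiFun d) W}
    {M : Set (MIdx d L × NIdx d)} {v : M → BiFun d} {n : NIdx d} {a : W}
    (h1 : ∀ N, Φ.mem (ePoly L N) a fun x y => shiftCoef (fun i => y i - x i) n N)
    (h2 : ∀ β (hβ : (β, n) ∈ M), Φ.mem β a (v ⟨(β, n), hβ⟩)) :
    Φ.Level a (charJet (Sum.elim v biDisp) n) := by
  refine Filtration.level_jetOf (fun N => ?_) (Filtration.level_charSeries h2)
  have h3 := h1 N
  rw [← shiftCoef_biDisp] at h3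
  exact h3

theorem JointSmooth.sum {ι : Type*} {s : Finset ι} {f : ι → BiFun d}
    (h : ∀ i ∈ s, JointSmooth (f i)) : JointSmooth (∑ i ∈ s, f i) := by
  have e : (fun p : (Fin d → ℝ) × (Fin d → ℝ) => (∑ i ∈ s, f i) p.1 p.2) =
      fun p => ∑ i ∈ s, f i p.1 p.2 := by
    funext p
    rw [Finset.sum_apply, Finset.sum_apply]
  rw [JointSmooth, e]
  exact ContDiff.sum h

theorem jointSmooth_of_right {f : (Fin d → ℝ) → ℝ} (hf : ContDiff ℝ ∞ f) :
    JointSmooth fun _ y => f y :=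
  ContDiff.comp hf contDiff_snd

theorem JointSmooth.diag {F : BiFun d} (hF : JointSmooth F) : JointSmooth fun x _ => F x x :=
  ContDiff.comp (g := fun p : (Fin d → ℝ) × (Fin d → ℝ) => F p.1 p.2)
    (f := fun p : (Fin d → ℝ) × (Fin d → ℝ) => (p.1, p.1)) hF (contDiff_fst.prodMk contDiff_fst)

theorem jointSmooth_dp (n : NIdx d) : JointSmooth fun x y : Fin d → ℝ => dp (y - x) n := by
  have h := contDiff_dp n (0 : Fin d → ℝ)
  have h1 : ContDiff ℝ ∞ fun p : (Fin d → ℝ) × (Fin d → ℝ) => p.2 - p.1 := by fun_prop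
  have h2 := ContDiff.comp h h1
  simp only [Function.comp_def, sub_zero] at h2
  exact h2

open Classical in
/-- The remainder `f - ∑_{|𝐧| < κ} ∂^𝐧 f(x) (· - x)^𝐧 / 𝐧!` of the Taylor expansion at the base
point. -/
def taylorRemainder (hS : S.Standing) (κ : ℝ) (F : BiFun d) : BiFun d := fun x y =>
  F x y - ∑ n ∈ (hS.finite_deg_lt κ).toFinset, multiDeriv n (F x) x * dp (y - x) n

theorem jointSmooth_taylorRemainder (hS : S.Standing) (κ : ℝ) {F : BiFun d}
    (hF : JointSmooth F) : JointSmooth (taylorRemainder hS κ F) :=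
  ContDiff.sub hF (ContDiff.sum fun n _ =>
    ContDiff.mul (JointSmooth.diag (JointSmooth.multiDeriv hF n)) (jointSmooth_dp n))

theorem multiDeriv_taylorRemainder (hS : S.Standing) {κ : ℝ} {F : BiFun d} (hF : JointSmooth F)
    (x : Fin d → ℝ) {n : NIdx d} (hn : S.deg n < κ) :
    multiDeriv n (taylorRemainder hS κ F x) x = 0 := by
  classical
  have h1 : taylorRemainder hS κ F x = F x - fun y =>
      ∑ n ∈ (hS.finite_deg_lt κ).toFinset, multiDeriv n (F x) x * dp (y - x) n := rfl
  rw [h1, multiDeriv_sub (hF.right x) (ContDiff.sum fun m _ =>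
    contDiff_const.mul (contDiff_dp m x)), Pi.sub_apply,
    multiDeriv_sum _ (fun m => multiDeriv m (F x) x) fun m _ => contDiff_dp m x]
  simp_rw [multiDeriv_dp, mul_ite, mul_one, mul_zero]
  rw [Finset.sum_ite_eq, if_pos ((hS.finite_deg_lt κ).mem_toFinset.mpr hn), sub_self]

theorem taylorRemainder_sub_mem_polyIn (hS : S.Standing) (κ : ℝ) (F : BiFun d)
    (x : Fin d → ℝ) : taylorRemainder hS κ F x - F x ∈ polyIn (degLT S κ) := by
  have h1 : taylorRemainder hS κ F x - F x = -∑ n ∈ (hS.finite_deg_lt κ).toFinset,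
      multiDeriv n (F x) x • fun y : Fin d → ℝ => dp (y - x) n := by
    funext y
    rw [Pi.sub_apply, taylorRemainder, sub_sub_cancel_left, Pi.neg_apply, Finset.sum_apply]
    rfl
  rw [h1]
  refine Submodule.neg_mem _ (Submodule.sum_mem _ fun n hn => Submodule.smul_mem _ _
    (dp_sub_mem_polyIn (isLowerSet_degLT hS κ) ?_ x))
  exact (hS.finite_deg_lt κ).mem_toFinset.mp hn

variable [Fintype L] {ξ : L → (Fin d → ℝ) → ℝ} {c : MIdx d L → ℝ}

/-- The series `∑_𝔩 ξ_𝔩(y) z_(𝔩,0) + c`. -/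
def rhsSeries (ξ : L → (Fin d → ℝ) → ℝ) (c : MIdx d L → ℝ) (y : Fin d → ℝ) : ZSeries d L ℝ :=
  fun γ => Setting.rhsCoef ξ c y γ

theorem modelMinus_eq_finsum (hS : S.Standing) (hc : S.Admissible c)
    (Q : MIdx d L → (Fin d → ℝ) → ℝ) (x y : Fin d → ℝ) {β : MIdx d L} (hβ : β ∈ S.allIdx) :
    S.modelMinus ξ c Q x β y = ∑ᶠ γ, MvPowerSeries.coeff β
      (S.jetMonomial (jetOfChar (S.modelChar Q x y)) γ) * Setting.rhsCoef ξ c y γ := by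
  refine finsum_congr fun γ => ?_
  by_cases h : Setting.rhsCoef ξ c y γ = 0
  · rw [h, mul_zero, mul_zero]
  · rw [S.gammaStar_eq hS _ hβ
      (Or.inr ((isSource_of_rhsCoef_ne_zero hc h).mem_setNminus hS))]

theorem modelMinus_eq_coeff (hS : S.Standing) (hc : S.Admissible c)
    (Q : MIdx d L → (Fin d → ℝ) → ℝ) (x y : Fin d → ℝ) {β : MIdx d L} (hβ : β ∈ S.allIdx) :
    S.modelMinus ξ c Q x β y = MvPowerSeries.coeff β
      (S.jetSubst (jetOfChar (S.modelChar Q x y)) (rhsSeries ξ c y)) := by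
  rw [modelMinus_eq_finsum hS hc Q x y hβ, S.coeff_jetSubst (jetAdm_modelChar hS _)]
  exact finsum_congr fun γ => mul_comm _ _

/-- The functions `Π⁻_{xβ}(y)` for a family `Π`. -/
def minus (S : Setting d L) (ξ : L → (Fin d → ℝ) → ℝ) (c : MIdx d L → ℝ)
    (P : MIdx d L → BiFun d) (β : MIdx d L) : BiFun d :=
  fun x y => S.modelMinus ξ c (fun γ => P γ x) x β y

theorem exists_minus_eq_sum (hS : S.Standing) (ξ : L → (Fin d → ℝ) → ℝ) (hc : S.Admissible c)
    (P : MIdx d L → BiFun d) {β : MIdx d L} (hβ : β ∈ S.allIdx) :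
    ∃ F : Finset (MIdx d L), (∀ γ ∈ F, IsSource S γ) ∧ minus S ξ c P β = ∑ γ ∈ F,
      MvPowerSeries.coeff β (S.jetMonomial (modelJet S P) γ) *
        fun _ y => Setting.rhsCoef ξ c y γ := by
  classical
  refine ⟨((S.finite_jetMonomial (jetAdm_modelJet hS P) β).toFinset).filter (IsSource S),
    fun γ hγ => (Finset.mem_filter.mp hγ).2, ?_⟩
  funext x y
  rw [minus, modelMinus_eq_finsum hS hc _ x y hβ, Finset.sum_apply, Finset.sum_apply,
    finsum_eq_sum_of_support_subset]
  · refine Finset.sum_congr rfl fun γ _ => ?_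
    rw [← coeff_jetMonomial_modelJet]
    rfl
  · intro γ hγ
    rw [Function.mem_support] at hγ
    rw [Finset.mem_coe, Finset.mem_filter, Set.Finite.mem_toFinset]
    refine ⟨fun h => ?_, isSource_of_rhsCoef_ne_zero hc (right_ne_zero_of_mul hγ)⟩
    rw [← coeff_jetMonomial_modelJet, h] at hγ
    exact left_ne_zero_of_mul hγ rfl

theorem jointSmooth_minus (hS : S.Standing) (hξ : ∀ l, ContDiff ℝ ∞ (ξ l))
    (hc : S.Admissible c) {P : MIdx d L → BiFun d} (hP : ∀ β, JointSmooth (P β)) {β : MIdx d L}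
    (hβ : β ∈ S.allIdx) : JointSmooth (minus S ξ c P β) := by
  obtain ⟨F, -, hF⟩ := exists_minus_eq_sum hS ξ hc P hβ
  rw [hF]
  refine JointSmooth.sum fun γ _ => ContDiff.mul ?_ (jointSmooth_of_right (contDiff_rhsCoef hξ γ))
  refine Filtration.level_jetMonomial_of_level (Φ := smoothFiltration d L) (S := S)
    (u := modelJet S P) (0 : MIdx d L →+ Unit) (fun _ _ _ => rfl)
    (fun _ => (contDiff_const : JointSmooth fun _ _ => 1)) (fun n => ?_) γ β
  refine Filtration.level_charJet (fun N => jointSmooth_shiftCoef n N) fun β' _ => ?_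
  · exact ContDiff.mul contDiff_const (JointSmooth.multiDeriv (hP β') n)

/-- `Π⁻_{xβ}` depends only on the components of `Π` of smaller degree; this makes the recursion for
`Π` well posed. -/
theorem minus_congr (hS : S.Standing) (hc : S.Admissible c) {P P' : MIdx d L → BiFun d}
    {β : MIdx d L} (hβ : β ∈ S.allIdx)
    (h : ∀ γ : MIdx d L, γ.degree < β.degree → P γ = P' γ) :
    minus S ξ c P β = minus S ξ c P' β := by
  funext x y
  rw [minus, minus, modelMinus_eq_finsum hS hc _ x y hβ, modelMinus_eq_finsum hS hc _ x y hβ]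
  refine finsum_congr fun γ => ?_
  by_cases h0 : Setting.rhsCoef ξ c y γ = 0
  · rw [h0, mul_zero, mul_zero]
  have hs := isSource_of_rhsCoef_ne_zero hc h0
  have key : ∀ (n : NIdx d) (β' : MIdx d L), β'.degree < β.degree →
      MvPowerSeries.coeff β' (jetOfChar (S.modelChar (fun γ => P γ x) x y) n) =
        MvPowerSeries.coeff β' (jetOfChar (S.modelChar (fun γ => P' γ x) x y) n) := by
    intro n β' hβ'
    refine coeff_charJet_congr (fun i => ?_) fun hm => ?_
    · rw [Setting.modelChar, Setting.modelChar, MvPolynomial.aeval_X, MvPolynomial.aeval_X]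
      rfl
    · rw [Setting.modelChar, Setting.modelChar, MvPolynomial.aeval_X, MvPolynomial.aeval_X,
        Sum.elim_inl, Sum.elim_inl, h β' hβ']
  have h1 := jetAdm_modelChar hS (S.modelChar (fun γ => P γ x) x y)
  have h2 := jetAdm_modelChar hS (S.modelChar (fun γ => P' γ x) x y)
  rw [coeff_jetMonomial_congr h1.const h2.const Set.univ (fun _ _ => trivial)
    (fun n _ => key n) hs.eNoise_or_two_le_degree fun _ _ => trivial]

/-- The homogeneity bound on `Π⁻`: the entries of `Γ^*_{Π_x}` have homogeneity `|β| - |γ|`, and the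
coefficients of the right-hand side are smooth functions sitting at nonpositive homogeneities.
-/
theorem localBound_minus (hS : S.Standing) (hξ : ∀ l, ContDiff ℝ ∞ (ξ l))
    (hc : S.Admissible c) {P : MIdx d L → BiFun d}
    (hP : ∀ β ∈ S.setN, ∀ n, S.LocalBound (S.hom β + S.eta - S.deg n)
      fun x y => multiDeriv n (P β x) y) {β : MIdx d L} (hβ : β ∈ S.allIdx) :
    S.LocalBound (S.hom β) (minus S ξ c P β) := by
  obtain ⟨F, hFs, hF⟩ := exists_minus_eq_sum hS ξ hc P hβ
  rw [hF]
  refine Setting.LocalBound.sum fun γ hγ => ?_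
  have h1 : S.LocalBound (S.hom β - S.hom γ)
      (MvPowerSeries.coeff β (S.jetMonomial (modelJet S P) γ)) := by
    refine Filtration.level_jetMonomial_of_level (Φ := boundFiltration hS) S.homHom homHom_weight
      (u := modelJet S P) (fun c => ?_) (fun n => ?_) γ β
    · change S.LocalBound (S.hom _ - S.hom _) _
      rw [sub_self]
      exact Setting.JointSmooth.localBound hS contDiff_const le_rfl
    · refine Filtration.level_charJet (fun N => ?_) fun β' hβ' => ?_
      · change S.LocalBound (S.hom _ - S.hom _) _
        rw [S.hom_ePoly, S.hom_ePoly, sub_sub_sub_cancel_right]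
        exact Setting.localBound_shiftCoef hS n N
      · change S.LocalBound (S.hom _ - S.hom _) _
        rw [S.hom_ePoly, sub_sub_eq_add_sub]
        exact (hP β' hβ'.1 n).smul _
  have h2 := Setting.LocalBound.mul hS h1 (Setting.JointSmooth.localBound (κ := 0) hS
    (jointSmooth_of_right (contDiff_rhsCoef (c := c) hξ γ)) le_rfl)
  refine h2.mono hS ?_
  linarith [(hFs γ hγ).hom_nonpos hS]

/-- Without noises, `Π⁻` is polynomial. -/
theorem minus_mem_polyIn (hS : S.Standing) (ξ : L → (Fin d → ℝ) → ℝ) (hc : S.Admissible c)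
    (P : MIdx d L → BiFun d) {β : MIdx d L} (hβ : β ∈ S.allIdx) (h0 : noiseHom β = 0)
    (x : Fin d → ℝ) : minus S ξ c P β x ∈ polyIn (degLE S (S.hom β)) := by
  have h1 : minus S ξ c P β x =
      MvPowerSeries.coeff β (S.jetMonomial (modelJet S P) (eNoise none 0)) x := by
    funext y
    rw [minus, modelMinus_eq_finsum hS hc _ x y hβ, finsum_eq_single _ (eNoise none 0),
      rhsCoef_noise_none hc, mul_one, coeff_jetMonomial_modelJet]
    intro γ hγ
    by_contra hne
    have hs := isSource_of_rhsCoef_ne_zero hc (right_ne_zero_of_mul hne)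
    have hle := noiseHom_le_of_coeff_ne_zero (left_ne_zero_of_mul hne)
    rcases hs with ⟨l, rfl⟩ | hs
    · cases l with
      | none => exact hγ rfl
      | some l =>
        rw [noiseHom_eNoise_some] at hle
        omega
    · have := hs.2.2
      omega
  rw [h1]
  have h2 : (polyFiltration S).mem β (S.homHom (eNoise none 0))
      (MvPowerSeries.coeff β (S.jetMonomial (modelJet S P) (eNoise none 0))) := by
    refine Filtration.level_jetMonomial_of_level (Φ := polyFiltration S) S.homHom homHom_weight
      (fun c _ x => ?_) (fun n => ?_) _ β
    · refine one_mem_polyIn ?_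
      change S.deg 0 ≤ S.hom _ - S.hom _
      rw [S.deg_zero, sub_self]
    · refine Filtration.level_charJet (fun N _ x => ?_) fun β' hβ' h0' => ?_
      · change _ ∈ polyIn (degLE S (S.hom _ - S.hom _))
        rw [S.hom_ePoly, S.hom_ePoly, sub_sub_sub_cancel_right]
        by_cases hle : n ≤ N
        · simp only [shiftCoef, if_pos hle]
          refine Submodule.smul_mem _ _ (dp_sub_mem_polyIn (isLowerSet_degLE hS _) ?_ x)
          change S.deg _ ≤ _
          have h3 := S.deg_add (N - n) n
          rw [tsub_add_cancel_of_le hle] at h3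
          linarith
        · simp only [shiftCoef, if_neg hle]
          exact Submodule.zero_mem _
      · exact absurd h0' hβ'.1.2.ne'
  have h3 := h2 h0 x
  have h4 : S.hom β - S.homHom (eNoise none 0) = S.hom β := by
    change S.hom β - S.hom _ = _
    rw [hom_eNoise_zero, hS.alpha_zero, sub_zero]
  rwa [h4] at h3

open MeasureTheory

variable {K : (Fin d → ℝ) → ℝ}

/-- The properties which determine the functions `Π_{xβ}(y) = P β x y`. -/
structure IsModel (S : Setting d L) (ξ : L → (Fin d → ℝ) → ℝ) (c : MIdx d L → ℝ)
    (K : (Fin d → ℝ) → ℝ) (P : MIdx d L → BiFun d) : Prop where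
  smooth : ∀ β, JointSmooth (P β)
  poly : ∀ n, P (ePoly L n) = shiftCoef biDisp 0 n
  eq_zero : ∀ β, β ∉ S.populated → P β = 0
  remainder : ∀ β ∈ S.setN, ∀ x,
    P β x - conv K (minus S ξ c P β x) ∈ polyIn (degLT S (S.hom β + S.eta))
  vanish : ∀ β ∈ S.setN, ∀ x n, S.deg n < S.hom β + S.eta → multiDeriv n (P β x) x = 0

/-- The model is constructed by recursion over the degree of `β`: on `𝓝` by subtracting from `K *
Π⁻_{xβ}` its Taylor polynomial at `x` of degree below `|β| + η`. -/
theorem exists_isModel (hS : S.Standing) (hξ : ∀ l, ContDiff ℝ ∞ (ξ l)) (hc : S.Admissible c)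
    (hK : LocallyIntegrable K) (hKc : HasCompactSupport K) :
    ∃ P : MIdx d L → BiFun d, IsModel S ξ c K P := by
  classical
  -- the right-hand side of the fixed point equation for the model
  let T : (MIdx d L → BiFun d) → MIdx d L → BiFun d := fun P β =>
    if β ∈ S.setN then
      taylorRemainder hS (S.hom β + S.eta) fun x => conv K (minus S ξ c P β x)
    else if h : ∃ n, ePoly L n = β then shiftCoef biDisp 0 h.choose
    else 0
  have hT : ∀ P P' β, (∀ γ : MIdx d L, γ.degree < β.degree → P γ = P' γ) →
      T P β = T P' β := by
    intro P P' β h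
    by_cases hβ : β ∈ S.setN
    · simp only [T, if_pos hβ, minus_congr hS hc (Or.inl (Or.inr hβ)) h]
    · simp only [T, if_neg hβ]
  have hr : ∀ P : MIdx d L → BiFun d, (∀ β, JointSmooth (P β)) → ∀ β, JointSmooth (T P β) := by
    intro P hP β
    by_cases hβ : β ∈ S.setN
    · simp only [T, if_pos hβ]
      exact jointSmooth_taylorRemainder hS _ (JointSmooth.conv hK hKc
        (jointSmooth_minus hS hξ hc hP (Or.inl (Or.inr hβ))))
    · simp only [T, if_neg hβ]
      split_ifs with h
      · rw [shiftCoef_biDisp]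
        exact jointSmooth_shiftCoef _ _
      · exact contDiff_const
  obtain ⟨P, hTP, hP⟩ := exists_fixedPoint T hT (fun _ F => JointSmooth F) hr 0
    fun _ => contDiff_const
  have hN : ∀ β ∈ S.setN, P β = taylorRemainder hS (S.hom β + S.eta)
      fun x => conv K (minus S ξ c P β x) := by
    intro β hβ
    conv_lhs => rw [← hTP]
    simp only [T, if_pos hβ]
  have hsm : ∀ β ∈ S.setN, JointSmooth fun x => conv K (minus S ξ c P β x) := fun β hβ =>
    JointSmooth.conv hK hKc (jointSmooth_minus hS hξ hc hP (Or.inl (Or.inr hβ)))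
  refine ⟨P, hP, fun n => ?_, fun β hβ => ?_, fun β hβ x => ?_, fun β hβ x n hn => ?_⟩
  · have h1 : ∃ m, ePoly L m = ePoly L n := ⟨n, rfl⟩
    rw [← hTP]
    simp only [T, if_neg (ePoly_notMem_setN n), dif_pos h1]
    rw [ePoly_injective h1.choose_spec]
  · rw [← hTP]
    simp only [T]
    rw [if_neg fun h => hβ (Or.inr h), dif_neg (c := ∃ n, ePoly L n = β) fun h => hβ (Or.inl h)]
  · rw [hN β hβ]
    have h2 := taylorRemainder_sub_mem_polyIn hS (S.hom β + S.eta)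
      (fun x => conv K (minus S ξ c P β x)) x
    exact h2
  · rw [hN β hβ]
    exact multiDeriv_taylorRemainder hS (hsm β hβ) x hn

end Model

/-! ### The recentering maps -/

section Recentering

variable {d : ℕ} {L : Type*} {S : Setting d L}

/-- The jet of the recentering characters with values `ϖ β 𝐧` on the generators `Z_(β,𝐧)`. -/
def recJet (S : Setting d L) (ϖ : MIdx d L → NIdx d → BiFun d) : NIdx d → ZSeries d L (BiFun d) :=
  charJet (M := S.setMplus) (Sum.elim (fun p => ϖ p.1.1 p.1.2) biDisp)

/-- The recentering character from `y` to `x`. -/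
def recChar (S : Setting d L) (ϖ : MIdx d L → NIdx d → BiFun d) (x y : Fin d → ℝ) :
    MvPolynomial (S.setMplus ⊕ Fin d) ℝ →ₐ[ℝ] ℝ :=
  MvPolynomial.aeval (Sum.elim (fun p => ϖ p.1.1 p.1.2 x y) fun i => y i - x i)

theorem mapAlgHom_recJet (ϖ : MIdx d L → NIdx d → BiFun d) (x y : Fin d → ℝ) (n : NIdx d) :
    MvPowerSeries.mapAlgHom (biEval x y) (recJet S ϖ n) = jetOfChar (recChar S ϖ x y) n := by
  rw [recJet, mapAlgHom_charJet, jetOfChar]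
  congr 1
  funext a
  rw [recChar, MvPolynomial.aeval_X]
  rcases a with p | i <;> rfl

theorem coeff_jetMonomial_recJet (ϖ : MIdx d L → NIdx d → BiFun d) (β γ : MIdx d L)
    (x y : Fin d → ℝ) : MvPowerSeries.coeff β (S.jetMonomial (recJet S ϖ) γ) x y =
      MvPowerSeries.coeff β (S.jetMonomial (jetOfChar (recChar S ϖ x y)) γ) := by
  have h := S.mapAlgHom_jetMonomial (biEval x y) (recJet S ϖ) γ
  simp only [mapAlgHom_recJet] at h
  change _ = S.jetMonomial (jetOfChar (recChar S ϖ x y)) γ at h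
  rw [← h, MvPowerSeries.mapAlgHom_apply, MvPowerSeries.coeff_map]
  rfl

theorem jetAdm_recJet (hS : S.Standing) (ϖ : MIdx d L → NIdx d → BiFun d) :
    JetAdm (recJet S ϖ) :=
  jetAdm_charJet zero_notMem_setMplus (finite_setMplus hS) _

theorem jetAdm_recChar (hS : S.Standing)
    (f : MvPolynomial (S.setMplus ⊕ Fin d) ℝ →ₐ[ℝ] ℝ) : JetAdm (jetOfChar f) :=
  jetAdm_charJet zero_notMem_setMplus (finite_setMplus hS) _

/-- The homogeneity bounds on the entries of `Γ^*_{xy}` follow from those on its jet. -/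
theorem localBound_recJet (hS : S.Standing) {ϖ : MIdx d L → NIdx d → BiFun d}
    (hϖ : ∀ β ∈ S.setN, ∀ n, S.LocalBound (S.hom β + S.eta - S.deg n) (ϖ β n))
    (β γ : MIdx d L) : S.LocalBound (S.hom β - S.hom γ)
      (MvPowerSeries.coeff β (S.jetMonomial (recJet S ϖ) γ)) := by
  refine Filtration.level_jetMonomial_of_level (Φ := boundFiltration hS) S.homHom homHom_weight
    (u := recJet S ϖ) (fun c => ?_) (fun n => ?_) γ β
  · change S.LocalBound (S.hom _ - S.hom _) _
    rw [sub_self]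
    exact Setting.JointSmooth.localBound hS contDiff_const le_rfl
  · refine Filtration.level_charJet (fun N => ?_) fun β' hβ' => ?_
    · change S.LocalBound (S.hom _ - S.hom _) _
      rw [S.hom_ePoly, S.hom_ePoly, sub_sub_sub_cancel_right]
      exact Setting.localBound_shiftCoef hS n N
    · change S.LocalBound (S.hom _ - S.hom _) _
      rw [S.hom_ePoly, sub_sub_eq_add_sub]
      exact hϖ β' hβ'.1 n

/-- The series `∑_β Π_{xβ}(z) z^β`. -/
def modelSeries (P : MIdx d L → BiFun d) (x z : Fin d → ℝ) : ZSeries d L ℝ := fun β => P β x z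

theorem coeff_modelSeries (P : MIdx d L → BiFun d) (x z : Fin d → ℝ) (β : MIdx d L) :
    MvPowerSeries.coeff β (modelSeries P x z) = P β x z := rfl

open Classical in
/-- The recursion for the recentering characters: matching the derivatives of order `𝐧` at `y` of
`Π_{xβ}` and of the recentered `Π_y`. -/
def recStep (S : Setting d L) (P : MIdx d L → BiFun d) (ϖ : MIdx d L → NIdx d → BiFun d)
    (β : MIdx d L) (n : NIdx d) : BiFun d := fun x y =>
  (nFactorial n)⁻¹ * (multiDeriv n (P β x) y - ∑ᶠ γ, if γ ∈ S.setN then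
    MvPowerSeries.coeff β (S.jetMonomial (recJet S ϖ) γ) x y * multiDeriv n (P γ y) y else 0)

/-- The recentering character solves the recursion and satisfies the homogeneity bounds. -/
structure IsRecentering (S : Setting d L) (P : MIdx d L → BiFun d)
    (ϖ : MIdx d L → NIdx d → BiFun d) : Prop where
  step : ∀ β n, ϖ β n = recStep S P ϖ β n
  bound : ∀ β ∈ S.setN, ∀ n, S.LocalBound (S.hom β + S.eta - S.deg n) (ϖ β n)

/-- By triangularity, the recursion for the characters only uses components of smaller degree. -/
theorem recStep_congr (hS : S.Standing) (P : MIdx d L → BiFun d)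
    {ϖ ϖ' : MIdx d L → NIdx d → BiFun d} {β : MIdx d L}
    (h : ∀ γ : MIdx d L, γ.degree < β.degree → ϖ γ = ϖ' γ) :
    recStep S P ϖ β = recStep S P ϖ' β := by
  classical
  have key : ∀ (n : NIdx d) (β' : MIdx d L), β'.degree < β.degree →
      MvPowerSeries.coeff β' (recJet S ϖ n) = MvPowerSeries.coeff β' (recJet S ϖ' n) := by
    intro n β' hβ'
    refine coeff_charJet_congr (fun i => rfl) fun hm => ?_
    rw [Sum.elim_inl, Sum.elim_inl, h β' hβ']
  have h1 := (jetAdm_recJet hS ϖ).const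
  have h2 := (jetAdm_recJet hS ϖ').const
  have h3 : ∀ γ ∈ S.setN, MvPowerSeries.coeff β (S.jetMonomial (recJet S ϖ) γ) =
      MvPowerSeries.coeff β (S.jetMonomial (recJet S ϖ') γ) := fun γ hγ =>
    coeff_jetMonomial_congr h1 h2 Set.univ (fun _ _ => trivial)
      (fun n _ => key n) (eNoise_or_two_le_degree hγ) fun _ _ => trivial
  funext n x y
  rw [recStep, recStep]
  have h4 : ∀ γ, (if γ ∈ S.setN then
      MvPowerSeries.coeff β (S.jetMonomial (recJet S ϖ) γ) x y * multiDeriv n (P γ y) y else 0) =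
      if γ ∈ S.setN then
      MvPowerSeries.coeff β (S.jetMonomial (recJet S ϖ') γ) x y * multiDeriv n (P γ y) y
      else 0 := by
    intro γ
    split_ifs with hγ
    · rw [h3 γ hγ]
    · rfl
  rw [finsum_congr h4]

variable [Fintype L] {ξ : L → (Fin d → ℝ) → ℝ} {c : MIdx d L → ℝ} {K : (Fin d → ℝ) → ℝ}
  {P : MIdx d L → BiFun d}

/-- All derivatives of `Π_{xβ}` satisfy the expected bounds, by Taylor's theorem. -/
theorem IsModel.localBound_multiDeriv (hP : IsModel S ξ c K P) (hS : S.Standing)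
    {β : MIdx d L} (hβ : β ∈ S.setN) (n : NIdx d) :
    S.LocalBound (S.hom β + S.eta - S.deg n) fun x y => multiDeriv n (P β x) y := by
  refine Setting.localBound_of_multiDeriv_eq_zero hS (JointSmooth.multiDeriv (hP.smooth β) n)
    fun x m hm => ?_
  rw [← multiDeriv_index_add ((hP.smooth β).right x)]
  refine hP.vanish β hβ x _ ?_
  rw [S.deg_add]
  linarith

/-- The recursion for the characters preserves the homogeneity bounds. -/
theorem IsModel.localBound_recStep (hP : IsModel S ξ c K P) (hS : S.Standing)
    {ϖ : MIdx d L → NIdx d → BiFun d}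
    (hϖ : ∀ β ∈ S.setN, ∀ n, S.LocalBound (S.hom β + S.eta - S.deg n) (ϖ β n)) {β : MIdx d L}
    (hβ : β ∈ S.setN) (n : NIdx d) :
    S.LocalBound (S.hom β + S.eta - S.deg n) (recStep S P ϖ β n) := by
  classical
  have hfin := S.finite_jetMonomial (jetAdm_recJet hS ϖ) β
  have he : recStep S P ϖ β n = (nFactorial n)⁻¹ • ((fun x y => multiDeriv n (P β x) y) -
      ∑ γ ∈ hfin.toFinset.filter (· ∈ S.setN),
        MvPowerSeries.coeff β (S.jetMonomial (recJet S ϖ) γ) *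
          fun _ y => multiDeriv n (P γ y) y) := by
    funext x y
    rw [recStep, Pi.smul_apply, Pi.smul_apply, smul_eq_mul, Pi.sub_apply, Pi.sub_apply,
      Finset.sum_apply, Finset.sum_apply, Finset.sum_filter,
      finsum_eq_sum_of_support_subset (s := hfin.toFinset)]
    · congr 2
    · intro γ hγ
      rw [Finset.mem_coe, Set.Finite.mem_toFinset]
      intro h0
      rw [Function.mem_support] at hγ
      apply hγ
      split_ifs
      · rw [h0]
        exact zero_mul _
      · rfl
  rw [he]
  refine ((hP.localBound_multiDeriv hS hβ n).sub (Setting.LocalBound.sum fun γ hγ => ?_)).smul _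
  have hγN := (Finset.mem_filter.mp hγ).2
  by_cases hdeg : S.deg n < S.hom γ + S.eta
  · have h0 : (fun (_ y : Fin d → ℝ) => multiDeriv n (P γ y) y) = 0 := by
      funext _ y
      exact hP.vanish γ hγN y n hdeg
    rw [h0, mul_zero]
    exact Setting.localBound_zero
  · have hs : JointSmooth fun (_ y : Fin d → ℝ) => multiDeriv n (P γ y) y :=
      jointSmooth_of_right (ContDiff.comp
        (g := fun p : (Fin d → ℝ) × (Fin d → ℝ) => multiDeriv n (P γ p.1) p.2)
        (JointSmooth.multiDeriv (hP.smooth γ) n) (contDiff_id.prodMk contDiff_id))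
    refine (Setting.LocalBound.mul hS (localBound_recJet hS hϖ β γ)
      (Setting.JointSmooth.localBound hS hs le_rfl)).mono hS ?_
    linarith

/-- The characters are constructed by recursion over the degree of `β`. -/
theorem exists_isRecentering (hP : IsModel S ξ c K P) (hS : S.Standing) :
    ∃ ϖ : MIdx d L → NIdx d → BiFun d, IsRecentering S P ϖ := by
  obtain ⟨ϖ, h1, h2⟩ := exists_fixedPoint (fun ϖ β => recStep S P ϖ β)
    (fun ϖ ϖ' β h => recStep_congr hS P h)
    (fun β F => β ∈ S.setN → ∀ n, S.LocalBound (S.hom β + S.eta - S.deg n) (F n))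
    (fun ϖ hϖ β hβ n => hP.localBound_recStep hS hϖ hβ n) (fun _ _ => 0)
    fun _ _ _ => Setting.localBound_zero
  exact ⟨ϖ, fun β n => congrFun (congrFun h1.symm β) n, fun β hβ => h2 β hβ⟩

end Recentering

/-! ### Recentering of the model -/

section RecenteringModel

variable {d : ℕ} {L : Type*} {S : Setting d L}

/-- The binomial theorem: translations of polynomials compose additively. -/
theorem sum_shiftCoef_mul_shiftCoef (a b : Fin d → ℝ) (N : NIdx d) :
    ∑ p ∈ Finset.HasAntidiagonal.antidiagonal N, shiftCoef a 0 p.1 * shiftCoef b p.1 N =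
      shiftCoef (a + b) 0 N := by
  classical
  have h0 : kFact (0 : NIdx d) = 1 := by simp [kFact]
  rw [shiftCoef, if_pos (zero_le), tsub_zero, h0, div_one, dp_add, Finset.smul_sum]
  refine Finset.sum_congr rfl fun p hp => ?_
  rw [Finset.HasAntidiagonal.mem_antidiagonal] at hp
  have h1 : p.1 ≤ N := hp ▸ le_self_add
  have h2 : N - p.1 = p.2 := by rw [← hp, add_tsub_cancel_left]
  rw [shiftCoef, shiftCoef, if_pos (zero_le), if_pos h1, h2, tsub_zero, h0, div_one]
  have := (kFact_pos p.1).ne'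
  simp only [smul_eq_mul]
  field_simp

theorem coeff_ePoly_jetOfChar {M : Set (MIdx d L × NIdx d)} (hM : ∀ p ∈ M, p.1 ∈ S.setN)
    (f : MvPolynomial (M ⊕ Fin d) ℝ →ₐ[ℝ] ℝ) (n N : NIdx d) :
    MvPowerSeries.coeff (ePoly L N) (jetOfChar f n) =
      shiftCoef (fun i => f (MvPolynomial.X (Sum.inr i))) n N := by
  rw [jetOfChar, charJet, jetOf, map_add, coeff_linSeries, coeff_charSeries_of_notMem, add_zero]
  exact fun h => ePoly_notMem_setN N (hM _ h)

theorem coeff_jetOfChar_of_mem {M : Set (MIdx d L × NIdx d)} (hM : ∀ p ∈ M, p.1 ∈ S.setN)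
    (f : MvPolynomial (M ⊕ Fin d) ℝ →ₐ[ℝ] ℝ) {β : MIdx d L} {n : NIdx d} (h : (β, n) ∈ M) :
    MvPowerSeries.coeff β (jetOfChar f n) = f (MvPolynomial.X (Sum.inl ⟨(β, n), h⟩)) := by
  rw [jetOfChar, charJet, jetOf, map_add, coeff_charSeries _ h, coeff_linSeries_of_notMem,
    zero_add]
  rintro ⟨m, rfl⟩
  exact ePoly_notMem_setN m (hM _ h)

theorem coeff_jetOfChar_of_notMem {M : Set (MIdx d L × NIdx d)}
    (f : MvPolynomial (M ⊕ Fin d) ℝ →ₐ[ℝ] ℝ) {β : MIdx d L} {n : NIdx d} (h : (β, n) ∉ M)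
    (h' : β ∉ Set.range (ePoly L)) : MvPowerSeries.coeff β (jetOfChar f n) = 0 := by
  rw [jetOfChar, charJet, jetOf, map_add, coeff_charSeries_of_notMem _ h,
    coeff_linSeries_of_notMem _ h', zero_add]

/-- In the populated sector, the multi-indices without noises are polynomial. -/
theorem mem_range_ePoly_of_noiseHom {γ : MIdx d L} (h : γ ∈ S.populated) (h0 : noiseHom γ = 0) :
    γ ∈ Set.range (ePoly L) := by
  rcases h with h | h
  · exact h
  · exact absurd h0 h.2.ne'

variable [Fintype L] {ξ : L → (Fin d → ℝ) → ℝ} {c : MIdx d L → ℝ} {K : (Fin d → ℝ) → ℝ}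
  {P : MIdx d L → BiFun d}

namespace IsModel

theorem mem_populated (hP : IsModel S ξ c K P) {γ : MIdx d L} {x z : Fin d → ℝ}
    (h : P γ x z ≠ 0) : γ ∈ S.populated := by
  by_contra h1
  rw [hP.eq_zero γ h1] at h
  exact h rfl

theorem ePoly_apply (hP : IsModel S ξ c K P) (n : NIdx d) (x y : Fin d → ℝ) :
    P (ePoly L n) x y = shiftCoef (fun i => y i - x i) 0 n := by
  rw [hP.poly, shiftCoef_biDisp]

theorem multiDeriv_ePoly (hP : IsModel S ξ c K P) (n N : NIdx d) (x y : Fin d → ℝ) :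
    multiDeriv n (P (ePoly L N) x) y = nFactorial n * shiftCoef (fun i => y i - x i) n N := by
  rw [hP.poly, shiftCoef_biDisp]
  exact multiDeriv_shiftCoef x n N y

theorem multiDeriv_eq_zero (hP : IsModel S ξ c K P) {γ : MIdx d L} (hγ : γ ∉ S.populated)
    (n : NIdx d) (x y : Fin d → ℝ) : multiDeriv n (P γ x) y = 0 := by
  have h := multiDeriv_sum (∅ : Finset Unit) (fun _ => 0) (f := fun _ _ => 0)
    (fun _ _ => contDiff_const) n y
  rw [Finset.sum_empty] at h
  rw [hP.eq_zero γ hγ]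
  exact h

/-- In low orders, the jet of the model is the jet of its generating series. -/
theorem coeff_jet (hP : IsModel S ξ c K P) {n : NIdx d} (hn : S.deg n < S.eta) (γ : MIdx d L)
    (x z : Fin d → ℝ) :
    MvPowerSeries.coeff γ (jetOfChar (S.modelChar (fun β => P β x) x z) n) =
      (nFactorial n)⁻¹ * multiDeriv n (P γ x) z := by
  by_cases h1 : γ ∈ S.setN
  · rw [coeff_jetOfChar_of_mem (S := S) (fun _ h => h.1) _ (show (γ, n) ∈ S.setMminus from ⟨h1, hn⟩),
      Setting.modelChar, MvPolynomial.aeval_X]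
    rfl
  · by_cases h2 : γ ∈ Set.range (ePoly L)
    · obtain ⟨N, rfl⟩ := h2
      rw [coeff_ePoly_jetOfChar (S := S) fun _ h => h.1, hP.multiDeriv_ePoly, ← mul_assoc,
        inv_mul_cancel₀ (nFactorial_pos n).ne', one_mul]
      simp only [Setting.modelChar, MvPolynomial.aeval_X, Sum.elim_inr]
    · rw [coeff_jetOfChar_of_notMem _ (fun h => h1 h.1) h2, hP.multiDeriv_eq_zero, mul_zero]
      exact fun h => h.elim h2 h1

/-- Differentiation of the recentering identity. -/
theorem multiDeriv_of_recentering (hP : IsModel S ξ c K P) {u : NIdx d → ZSeries d L ℝ}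
    (hu : JetAdm u) {β : MIdx d L} {x y : Fin d → ℝ}
    (h : ∀ z, MvPowerSeries.coeff β (S.jetSubst u (modelSeries P y z)) = P β x z) (n : NIdx d)
    (z : Fin d → ℝ) : multiDeriv n (P β x) z =
      ∑ᶠ γ, multiDeriv n (P γ y) z * MvPowerSeries.coeff β (S.jetMonomial u γ) := by
  have hfin := S.finite_jetMonomial hu β
  have hsum : ∀ g : MIdx d L → ℝ, ∑ᶠ γ, g γ * MvPowerSeries.coeff β (S.jetMonomial u γ) =
      ∑ γ ∈ hfin.toFinset, MvPowerSeries.coeff β (S.jetMonomial u γ) * g γ := by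
    intro g
    rw [finsum_eq_sum_of_support_subset (s := hfin.toFinset)]
    · exact Finset.sum_congr rfl fun γ _ => mul_comm _ _
    · intro γ hγ
      rw [Function.mem_support] at hγ
      rw [Finset.mem_coe, Set.Finite.mem_toFinset]
      exact right_ne_zero_of_mul hγ
  have h1 : P β x = fun z => ∑ γ ∈ hfin.toFinset,
      MvPowerSeries.coeff β (S.jetMonomial u γ) * P γ y z := by
    funext z
    rw [← h z, S.coeff_jetSubst hu]
    exact hsum fun γ => P γ y z
  rw [h1, multiDeriv_sum _ (fun γ => MvPowerSeries.coeff β (S.jetMonomial u γ))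
    fun γ _ => (hP.smooth γ).right y, hsum]

open Classical in
/-- The contribution of the polynomials to the derivatives at the base point is the jet. -/
theorem finsum_multiDeriv (hP : IsModel S ξ c K P) {u : NIdx d → ZSeries d L ℝ}
    (hu : JetAdm u) (β : MIdx d L) (y : Fin d → ℝ) (n : NIdx d) :
    ∑ᶠ γ, multiDeriv n (P γ y) y * MvPowerSeries.coeff β (S.jetMonomial u γ) =
      (∑ᶠ γ, if γ ∈ S.setN then
        MvPowerSeries.coeff β (S.jetMonomial u γ) * multiDeriv n (P γ y) y else 0) +
        nFactorial n * MvPowerSeries.coeff β (u n) := by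
  have hfin := S.finite_jetMonomial hu β
  have h1 : ∀ γ, multiDeriv n (P γ y) y * MvPowerSeries.coeff β (S.jetMonomial u γ) =
      (if γ ∈ S.setN then
        MvPowerSeries.coeff β (S.jetMonomial u γ) * multiDeriv n (P γ y) y else 0) +
      (if γ = ePoly L n then nFactorial n * MvPowerSeries.coeff β (u n) else 0) := by
    intro γ
    by_cases hγ : γ ∈ S.setN
    · rw [if_pos hγ, if_neg, add_zero, mul_comm]
      rintro rfl
      exact ePoly_notMem_setN n hγ
    · rw [if_neg hγ, zero_add]
      by_cases h2 : γ ∈ Set.range (ePoly L)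
      -- at the base point, only the monomial of the order of the derivative survives
      · obtain ⟨N, rfl⟩ := h2
        have h0 : (fun i => y i - y i) = (0 : Fin d → ℝ) := funext fun i => sub_self _
        rw [hP.multiDeriv_ePoly, h0]
        by_cases hN : N = n
        · rw [hN, shiftCoef_self, mul_one, if_pos rfl, Setting.jetMonomial_ePoly]
        · rw [shiftCoef_zero (Ne.symm hN), mul_zero, zero_mul,
            if_neg fun h => hN (ePoly_injective h)]
      · rw [hP.multiDeriv_eq_zero fun h => h.elim h2 hγ, zero_mul, if_neg]
        rintro rfl
        exact h2 ⟨n, rfl⟩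
  rw [finsum_congr h1, finsum_add_distrib]
  · congr 1
    exact (finsum_eq_single _ (ePoly L n) fun γ hγ => if_neg hγ).trans (if_pos rfl)
  · refine hfin.subset fun γ hγ h0 => ?_
    rw [Function.mem_support] at hγ
    apply hγ
    split_ifs
    · rw [h0, zero_mul]
    · rfl
  · refine (Set.finite_singleton (ePoly L n)).subset fun γ hγ => ?_
    rw [Function.mem_support] at hγ
    by_contra h0
    exact hγ (if_neg h0)

/-- A jet which recenters the model is determined by the model. -/
theorem eq_of_recentering (hP : IsModel S ξ c K P) {u u' : NIdx d → ZSeries d L ℝ}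
    (hu : JetAdm u) (hu' : JetAdm u') {x y : Fin d → ℝ}
    (h : ∀ z, S.jetSubst u (modelSeries P y z) = modelSeries P x z)
    (h' : ∀ z, S.jetSubst u' (modelSeries P y z) = modelSeries P x z) : u = u' := by
  classical
  suffices key : ∀ N (β : MIdx d L), β.degree = N → ∀ n,
      MvPowerSeries.coeff β (u n) = MvPowerSeries.coeff β (u' n) from
    funext fun n => MvPowerSeries.ext fun β => key _ β rfl n
  intro N
  induction N using Nat.strong_induction_on with
  | _ N ih =>
    intro β hβ n
    have e1 := hP.multiDeriv_of_recentering hu (β := β) (fun z => by rw [h z]; rfl) n y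
    have e2 := hP.multiDeriv_of_recentering hu' (β := β) (fun z => by rw [h' z]; rfl) n y
    rw [hP.finsum_multiDeriv hu] at e1
    rw [hP.finsum_multiDeriv hu'] at e2
    have hc : ∀ γ ∈ S.setN, MvPowerSeries.coeff β (S.jetMonomial u γ) =
        MvPowerSeries.coeff β (S.jetMonomial u' γ) := fun γ hγ =>
      coeff_jetMonomial_congr hu.const hu'.const Set.univ (fun _ _ => trivial)
        (fun n _ β' hβ' => ih _ (hβ ▸ hβ') β' rfl n) (eNoise_or_two_le_degree hγ)
        fun _ _ => trivial
    have h4 : ∀ γ, (if γ ∈ S.setN then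
        MvPowerSeries.coeff β (S.jetMonomial u γ) * multiDeriv n (P γ y) y else 0) =
        if γ ∈ S.setN then
        MvPowerSeries.coeff β (S.jetMonomial u' γ) * multiDeriv n (P γ y) y else 0 := by
      intro γ
      split_ifs with hγ
      · rw [hc γ hγ]
      · rfl
    rw [finsum_congr h4, e2] at e1
    exact mul_left_cancel₀ (nFactorial_pos n).ne' (add_left_cancel e1.symm)

end IsModel

end RecenteringModel

section RecenteringIdentity

variable {d : ℕ} {L : Type*} {S : Setting d L} {P : MIdx d L → BiFun d}
  {ϖ : MIdx d L → NIdx d → BiFun d}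

open Classical in
/-- The defining property of the characters: the derivatives at `y` of `Π_{xβ}` and of `(Γ^*_{xy}
Π_y)_β` agree in orders below `|β| + η`. -/
theorem IsRecentering.coeff_jet (hϖ : IsRecentering S P ϖ) {β : MIdx d L} {n : NIdx d}
    (h : (β, n) ∈ S.setMplus) (x y : Fin d → ℝ) :
    nFactorial n * MvPowerSeries.coeff β (jetOfChar (recChar S ϖ x y) n) =
      multiDeriv n (P β x) y - ∑ᶠ γ, if γ ∈ S.setN then
        MvPowerSeries.coeff β (S.jetMonomial (jetOfChar (recChar S ϖ x y)) γ) *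
          multiDeriv n (P γ y) y else 0 := by
  rw [coeff_jetOfChar_of_mem (S := S) (fun _ h => h.1) _ h, recChar, MvPolynomial.aeval_X,
    Sum.elim_inl, hϖ.step, recStep, ← mul_assoc, mul_inv_cancel₀ (nFactorial_pos n).ne', one_mul]
  simp only [coeff_jetMonomial_recJet]
  rfl

theorem coeff_jetOfChar_ne_zero {f : MvPolynomial (S.setMplus ⊕ Fin d) ℝ →ₐ[ℝ] ℝ}
    {β : MIdx d L} (hβ : β ∈ S.setN) {n : NIdx d}
    (h : MvPowerSeries.coeff β (jetOfChar f n) ≠ 0) : (β, n) ∈ S.setMplus := by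
  by_contra h1
  refine h (coeff_jetOfChar_of_notMem f h1 ?_)
  rintro ⟨m, rfl⟩
  exact ePoly_notMem_setN m hβ

theorem hom_le_of_coeff_recChar (hS : S.Standing)
    (f : MvPolynomial (S.setMplus ⊕ Fin d) ℝ →ₐ[ℝ] ℝ) {β γ : MIdx d L}
    (h : MvPowerSeries.coeff β (S.jetMonomial (jetOfChar f) γ) ≠ 0) : S.hom γ ≤ S.hom β := by
  refine hom_le_of_coeff_ne_zero hS (supportedInN_charSeries (fun _ h => h.1) _)
    (fun n β' h1 => ?_) h
  by_contra h2
  refine h1 (coeff_charSeries_of_notMem _ fun h3 => h2 ?_)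
  rw [add_comm] at h2 ⊢
  have := h3.2
  linarith

variable [Fintype L] {ξ : L → (Fin d → ℝ) → ℝ} {c : MIdx d L → ℝ} {K : (Fin d → ℝ) → ℝ}

/-- The series `Π⁻_x` is supported in `𝓝₋`. -/
theorem coeff_jetSubst_rhsSeries_eq_zero (hS : S.Standing) (hc : S.Admissible c)
    (f : MvPolynomial (S.setMminus ⊕ Fin d) ℝ →ₐ[ℝ] ℝ) {γ : MIdx d L} (hγ : γ ∉ S.setNminus)
    (z : Fin d → ℝ) :
    MvPowerSeries.coeff γ (S.jetSubst (jetOfChar f) (rhsSeries ξ c z)) = 0 := by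
  rw [S.coeff_jetSubst (jetAdm_modelChar hS f)]
  refine finsum_eq_zero_of_forall_eq_zero fun γ' => ?_
  by_contra h
  have hs := isSource_of_rhsCoef_ne_zero hc (left_ne_zero_of_mul h)
  exact hγ (mem_setNminus_of_coeff_ne_zero hS (supportedInN_charSeries (fun _ h => h.1) _)
    (hs.mem_setNminus hS) (right_ne_zero_of_mul h))

open Classical in
/-- If the model is recentered in degrees below that of `β`, then `Π⁻` is recentered at `β`. -/
theorem IsModel.minus_of_recentering (hP : IsModel S ξ c K P) (hS : S.Standing)
    (hc : S.Admissible c) {u : NIdx d → ZSeries d L ℝ} (hu : JetAdm u) {β : MIdx d L}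
    (hβ : β ∈ S.allIdx) {x y : Fin d → ℝ}
    (h : ∀ β' : MIdx d L, β'.degree < β.degree → ∀ z,
      MvPowerSeries.coeff β' (S.jetSubst u (modelSeries P y z)) = P β' x z) (z : Fin d → ℝ) :
    minus S ξ c P β x z = ∑ᶠ γ, (if γ ∈ S.setNminus then minus S ξ c P γ y z else 0) *
      MvPowerSeries.coeff β (S.jetMonomial u γ) := by
  have hvx := jetAdm_modelChar hS (S.modelChar (fun γ => P γ x) x z)
  have hvy := jetAdm_modelChar hS (S.modelChar (fun γ => P γ y) y z)
  have hw := JetAdm.jetSubst (S := S) hu hvy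
  have e1 : MvPowerSeries.coeff β (S.jetSubst u (S.jetSubst
      (jetOfChar (S.modelChar (fun γ => P γ y) y z)) (rhsSeries ξ c z))) =
      ∑ᶠ γ, (if γ ∈ S.setNminus then minus S ξ c P γ y z else 0) *
      MvPowerSeries.coeff β (S.jetMonomial u γ) := by
    rw [S.coeff_jetSubst hu]
    refine finsum_congr fun γ => ?_
    split_ifs with hγ
    · rw [minus, modelMinus_eq_coeff hS hc _ _ _ (Or.inr hγ)]
    · rw [coeff_jetSubst_rhsSeries_eq_zero hS hc _ hγ]
  rw [← e1, S.jetSubst_jetSubst hu hvy, minus, modelMinus_eq_coeff hS hc _ _ _ hβ,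
    S.coeff_jetSubst hvx, S.coeff_jetSubst hw]
  -- differentiating the recentering identity identifies the jet of `Π_x` with the image of that
  -- of `Π_y`; only the orders below `η` enter, because the sources see no others
  have key : ∀ n ∈ {n | S.deg n < S.eta}, ∀ β' : MIdx d L, β'.degree < β.degree →
      MvPowerSeries.coeff β' (jetOfChar (S.modelChar (fun γ => P γ x) x z) n) =
      MvPowerSeries.coeff β'
        (S.jetSubst u (jetOfChar (S.modelChar (fun γ => P γ y) y z) n)) := by
    intro n hn β' hβ'
    rw [hP.coeff_jet hn, S.coeff_jetSubst hu, hP.multiDeriv_of_recentering hu (h β' hβ') n z,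
      ← smul_eq_mul, smul_finsum]
    refine finsum_congr fun γ => ?_
    rw [hP.coeff_jet hn, smul_eq_mul, mul_assoc]
  refine finsum_congr fun γ => ?_
  by_cases h0 : MvPowerSeries.coeff γ (rhsSeries ξ c z) = 0
  · rw [h0, zero_mul, zero_mul]
  have hs : IsSource S γ := isSource_of_rhsCoef_ne_zero hc h0
  have hvx0 := hvx.const
  have hw0 := hw.const
  have h1 := coeff_jetMonomial_congr (S := S) hvx0 hw0 {n | S.deg n < S.eta} (fun _ h => h) key
    hs.eNoise_or_two_le_degree fun n hn => hs.deg_lt hS hn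
  rw [h1]

/-- Recentering on the polynomial components is the binomial theorem. -/
theorem IsModel.recentering_ePoly (hP : IsModel S ξ c K P) (hS : S.Standing)
    (ϖ : MIdx d L → NIdx d → BiFun d) (x y z : Fin d → ℝ) (N : NIdx d) :
    MvPowerSeries.coeff (ePoly L N)
      (S.jetSubst (jetOfChar (recChar S ϖ x y)) (modelSeries P y z)) = P (ePoly L N) x z := by
  classical
  have hu := jetAdm_recChar hS (recChar S ϖ x y)
  rw [S.coeff_jetSubst hu, hP.ePoly_apply, finsum_eq_sum_of_support_subset
    (s := (Finset.HasAntidiagonal.antidiagonal N).image fun p => ePoly L p.1)]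
  · rw [Finset.sum_image]
    · have e : (fun i => z i - x i) = (fun i => z i - y i) + fun i => y i - x i := by
        funext i
        simp
      rw [e, ← sum_shiftCoef_mul_shiftCoef]
      refine Finset.sum_congr rfl fun p _ => ?_
      rw [coeff_modelSeries, hP.ePoly_apply, Setting.jetMonomial_ePoly,
        coeff_ePoly_jetOfChar (S := S) fun _ h => h.1]
      simp only [recChar, MvPolynomial.aeval_X, Sum.elim_inr]
    · intro p hp q hq hpq
      have h1 : p.1 = q.1 := ePoly_injective hpq
      rw [Finset.mem_coe, Finset.HasAntidiagonal.mem_antidiagonal] at hp hq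
      refine Prod.ext h1 ?_
      rw [← hq, h1] at hp
      exact add_left_cancel hp
  · intro γ hγ
    rw [Function.mem_support] at hγ
    have h1 := hP.mem_populated (left_ne_zero_of_mul hγ)
    have h2 := noiseHom_le_of_coeff_ne_zero (right_ne_zero_of_mul hγ)
    rw [noiseHom_ePoly] at h2
    obtain ⟨m, rfl⟩ := mem_range_ePoly_of_noiseHom h1 (Nat.le_zero.mp h2)
    have h3 := right_ne_zero_of_mul hγ
    rw [Setting.jetMonomial_ePoly, coeff_ePoly_jetOfChar (S := S) fun _ h => h.1, shiftCoef] at h3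
    have h4 : m ≤ N := by
      by_contra h5
      rw [if_neg h5] at h3
      exact h3 rfl
    rw [Finset.mem_coe, Finset.mem_image]
    exact ⟨(m, N - m), Finset.HasAntidiagonal.mem_antidiagonal.mpr (add_tsub_cancel_of_le h4), rfl⟩

open MeasureTheory

/-- The step of the recentering identity at the non-polynomial multi-indices: by recentering of
`Π⁻` both sides have the same singular part, so they differ by a polynomial of low degree; the
choice of the character annihilates its derivatives at `y`. -/
theorem IsModel.recentering_step (hP : IsModel S ξ c K P) (hϖ : IsRecentering S P ϖ)
    (hS : S.Standing) (hξ : ∀ l, ContDiff ℝ ∞ (ξ l)) (hc : S.Admissible c)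
    (hK : LocallyIntegrable K) (hKc : HasCompactSupport K) {β : MIdx d L} (hβ : β ∈ S.setN)
    {x y : Fin d → ℝ} (h : ∀ β' : MIdx d L, β'.degree < β.degree → ∀ z,
      MvPowerSeries.coeff β' (S.jetSubst (jetOfChar (recChar S ϖ x y)) (modelSeries P y z)) =
        P β' x z) (z : Fin d → ℝ) :
    MvPowerSeries.coeff β (S.jetSubst (jetOfChar (recChar S ϖ x y)) (modelSeries P y z)) =
      P β x z := by
  classical
  set u := jetOfChar (recChar S ϖ x y) with hudef
  have hu : JetAdm u := jetAdm_recChar hS (recChar S ϖ x y)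
  have hfin := S.finite_jetMonomial hu β
  set F := hfin.toFinset with hF
  set a : MIdx d L → ℝ := fun γ => MvPowerSeries.coeff β (S.jetMonomial u γ) with ha
  have hsum : ∀ g : MIdx d L → ℝ, ∑ᶠ γ, g γ * a γ = ∑ γ ∈ F, a γ * g γ := by
    intro g
    rw [finsum_eq_sum_of_support_subset (s := F)]
    · exact Finset.sum_congr rfl fun γ _ => mul_comm _ _
    · intro γ hγ
      rw [Function.mem_support] at hγ
      rw [hF, Finset.mem_coe, Set.Finite.mem_toFinset]
      exact right_ne_zero_of_mul hγ
  have hβa : β ∈ S.allIdx := Or.inl (Or.inr hβ)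
  set s := degLT S (S.hom β + S.eta) with hs
  have hslow : IsLowerSet s := isLowerSet_degLT hS _
  -- the terms of the convolution with `Π⁻`
  set m : MIdx d L → (Fin d → ℝ) → ℝ := fun γ z =>
    if γ ∈ S.setNminus then minus S ξ c P γ y z else 0 with hm
  have hmc : ∀ γ, Continuous (m γ) := by
    intro γ
    by_cases hγ : γ ∈ S.setNminus
    · simp only [hm, if_pos hγ]
      exact ((jointSmooth_minus hS hξ hc hP.smooth (Or.inr hγ)).right y).continuous
    · simp only [hm, if_neg hγ]
      exact continuous_const
  have hminus : minus S ξ c P β x = fun z => ∑ γ ∈ F, a γ * m γ z := by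
    funext z
    rw [hP.minus_of_recentering hS hc hu hβa h z]
    exact hsum fun γ => m γ z
  -- `D` is the defect of the recentering identity: first it is shown to be a polynomial of degree
  -- below `|β| + η`, and then its derivatives at `y` are shown to vanish
  set D : (Fin d → ℝ) → ℝ := P β x - fun z => ∑ γ ∈ F, a γ * P γ y z with hD
  have hDpoly : D ∈ polyIn s := by
    have e : D = (P β x - conv K (minus S ξ c P β x)) +
        ∑ γ ∈ F, a γ • (conv K (m γ) - P γ y) := by
      rw [hminus, conv_sum hK hKc F a fun γ _ => hmc γ]
      funext z
      simp only [hD, Pi.add_apply, Pi.sub_apply, Finset.sum_apply, Pi.smul_apply, smul_eq_mul,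
        mul_sub, Finset.sum_sub_distrib]
      ring
    rw [e]
    refine Submodule.add_mem _ (hP.remainder β hβ x) (Submodule.sum_mem _ fun γ hγ =>
      Submodule.smul_mem _ _ ?_)
    have hγ0 : MvPowerSeries.coeff β (S.jetMonomial u γ) ≠ 0 := by
      rwa [hF, Set.Finite.mem_toFinset] at hγ
    have hhom := hom_le_of_coeff_recChar hS _ hγ0
    by_cases hγN : γ ∈ S.setN
    · have e2 : m γ = minus S ξ c P γ y := by
        funext z
        simp only [hm, if_pos hγN.1]
      rw [e2, ← neg_sub]
      refine Submodule.neg_mem _ (polyIn_mono (fun n hn => ?_) (hP.remainder γ hγN y))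
      exact lt_of_lt_of_le (b := S.hom γ + S.eta) hn (add_le_add hhom le_rfl)
    -- outside `𝓝` there are no noises, and both terms are polynomials themselves
    · refine Submodule.sub_mem _ (conv_mem_polyIn hK hKc hslow ?_) ?_
      · by_cases hγ' : γ ∈ S.setNminus
        · have e2 : m γ = minus S ξ c P γ y := by
            funext z
            simp only [hm, if_pos hγ']
          have h0 : noiseHom γ = 0 := by
            by_contra h1
            exact hγN ⟨hγ', Nat.pos_of_ne_zero h1⟩
          rw [e2]
          refine polyIn_mono (fun n hn => ?_) (minus_mem_polyIn hS ξ hc P (Or.inr hγ') h0 y)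
          have hη := hS.eta_pos
          exact lt_of_le_of_lt (b := S.hom γ) hn (by linarith)
        · have e2 : m γ = 0 := by
            funext z
            simp only [hm, if_neg hγ']
            rfl
          rw [e2]
          exact Submodule.zero_mem _
      · by_cases hγ' : γ ∈ Set.range (ePoly L)
        · obtain ⟨n, rfl⟩ := hγ'
          rw [Setting.jetMonomial_ePoly] at hγ0
          have h1 := (coeff_jetOfChar_ne_zero hβ hγ0).2
          have e2 : P (ePoly L n) y = nFactorial n • fun z : Fin d → ℝ => dp (z - y) n := by
            funext z
            rw [hP.ePoly_apply, Pi.smul_apply, dp_eq_shiftCoef, smul_smul,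
              mul_inv_cancel₀ (nFactorial_pos n).ne', one_smul]
            rfl
          rw [e2]
          refine Submodule.smul_mem _ _ (dp_sub_mem_polyIn hslow ?_ y)
          change S.deg n < S.hom β + S.eta
          rw [add_comm]
          exact h1
        · rw [hP.eq_zero γ fun h2 => h2.elim hγ' hγN]
          exact Submodule.zero_mem _
  have hD0 : D = 0 := by
    refine eq_zero_of_multiDeriv_eq_zero hslow hDpoly (x := y) fun n hn => ?_
    have hsm : ContDiff ℝ ∞ fun z => ∑ γ ∈ F, a γ * P γ y z :=
      ContDiff.sum fun γ _ => contDiff_const.mul ((hP.smooth γ).right y)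
    rw [hD, multiDeriv_sub ((hP.smooth β).right x) hsm, Pi.sub_apply,
      multiDeriv_sum F a fun γ _ => (hP.smooth γ).right y,
      ← hsum fun γ => multiDeriv n (P γ y) y]
    have h1 := hP.finsum_multiDeriv hu β y n
    have h2 := hϖ.coeff_jet (show (β, n) ∈ S.setMplus from ⟨hβ, by
      rw [add_comm]
      exact hn⟩) x y
    rw [← hudef] at h2
    rw [h1, h2]
    ring
  rw [S.coeff_jetSubst hu]
  have h3 := congrFun hD0 z
  rw [hD, Pi.sub_apply, Pi.zero_apply, sub_eq_zero] at h3
  rw [h3]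
  exact hsum fun γ => P γ y z

/-- The recentering identity `Π_x = Γ^*_{xy} Π_y`, by induction over the degree. -/
theorem IsModel.recentering (hP : IsModel S ξ c K P) (hϖ : IsRecentering S P ϖ)
    (hS : S.Standing) (hξ : ∀ l, ContDiff ℝ ∞ (ξ l)) (hc : S.Admissible c)
    (hK : LocallyIntegrable K) (hKc : HasCompactSupport K) (x y z : Fin d → ℝ) :
    S.jetSubst (jetOfChar (recChar S ϖ x y)) (modelSeries P y z) = modelSeries P x z := by
  suffices key : ∀ N (β : MIdx d L), β.degree = N → ∀ z, MvPowerSeries.coeff β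
      (S.jetSubst (jetOfChar (recChar S ϖ x y)) (modelSeries P y z)) = P β x z from
    MvPowerSeries.ext fun β => key _ β rfl z
  intro N
  induction N using Nat.strong_induction_on with
  | _ N ih =>
    intro β hN z
    by_cases hβ : β ∈ S.setN
    · exact hP.recentering_step hϖ hS hξ hc hK hKc hβ
        (fun β' hβ' => ih _ (hN ▸ hβ') β' rfl) z
    by_cases hβ' : β ∈ Set.range (ePoly L)
    · obtain ⟨n, rfl⟩ := hβ'
      exact hP.recentering_ePoly hS ϖ x y z n
    · have hpop : β ∉ S.populated := fun h => h.elim hβ' hβ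
      rw [S.coeff_jetSubst (jetAdm_recChar hS _), hP.eq_zero β hpop]
      refine finsum_eq_zero_of_forall_eq_zero fun γ => ?_
      by_contra h
      exact hpop (mem_populated_of_coeff_ne_zero hS (supportedInN_charSeries (fun _ h => h.1) _)
        (hP.mem_populated (left_ne_zero_of_mul h)) (right_ne_zero_of_mul h))

end RecenteringIdentity

/-! ### Composition of the recentering maps -/

section Composition

variable {d : ℕ} {L : Type*} {S : Setting d L} [Fintype L] {ξ : L → (Fin d → ℝ) → ℝ}
  {c : MIdx d L → ℝ} {K : (Fin d → ℝ) → ℝ} {P : MIdx d L → BiFun d}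
  {ϖ : MIdx d L → NIdx d → BiFun d}

open MeasureTheory

/-- The composition of two recentering jets recenters the model, hence is the recentering jet. -/
theorem IsModel.jetSubst_recChar (hP : IsModel S ξ c K P) (hϖ : IsRecentering S P ϖ)
    (hS : S.Standing) (hξ : ∀ l, ContDiff ℝ ∞ (ξ l)) (hc : S.Admissible c)
    (hK : LocallyIntegrable K) (hKc : HasCompactSupport K) (x y z : Fin d → ℝ) :
    (fun n => S.jetSubst (jetOfChar (recChar S ϖ x z)) (jetOfChar (recChar S ϖ z y) n)) =
      jetOfChar (recChar S ϖ x y) := by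
  have h1 := jetAdm_recChar hS (recChar S ϖ x z)
  have h2 := jetAdm_recChar hS (recChar S ϖ z y)
  refine hP.eq_of_recentering (JetAdm.jetSubst (S := S) h1 h2)
    (jetAdm_recChar hS (recChar S ϖ x y)) (x := x) (y := y) (fun t => ?_)
    (hP.recentering hϖ hS hξ hc hK hKc x y)
  rw [← S.jetSubst_jetSubst h1 h2, hP.recentering hϖ hS hξ hc hK hKc z y,
    hP.recentering hϖ hS hξ hc hK hKc x z]

/-- The composition rule `Γ^*_{xy} = Γ^*_{xz} Γ^*_{zy}` for the matrices. -/
theorem IsModel.gammaStar_comp (hP : IsModel S ξ c K P) (hϖ : IsRecentering S P ϖ)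
    (hS : S.Standing) (hξ : ∀ l, ContDiff ℝ ∞ (ξ l)) (hc : S.Admissible c)
    (hK : LocallyIntegrable K) (hKc : HasCompactSupport K) (x y z : Fin d → ℝ)
    {β γ : MIdx d L} (hβ : β ∈ S.allIdx) (hγ : γ ∈ S.allIdx) :
    S.gammaStar (recChar S ϖ x y) β γ =
      ∑ᶠ γ', S.gammaStar (recChar S ϖ x z) β γ' * S.gammaStar (recChar S ϖ z y) γ' γ := by
  have h1 := jetAdm_recChar hS (recChar S ϖ x z)
  have h2 := jetAdm_recChar hS (recChar S ϖ z y)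
  have h3 := JetAdm.jetSubst (S := S) h1 h2
  rw [S.gammaStar_eq hS _ hβ hγ, ← hP.jetSubst_recChar hϖ hS hξ hc hK hKc x y z,
    ← S.jetSubst_monomial h3, ← S.jetSubst_jetSubst h1 h2, S.jetSubst_monomial h2,
    S.coeff_jetSubst h1]
  refine finsum_congr fun γ' => ?_
  by_cases hγ' : γ' ∈ S.allIdx
  · rw [S.gammaStar_eq hS _ hβ hγ', S.gammaStar_eq hS _ hγ' hγ, mul_comm]
  · have h4 : S.gammaStar (recChar S ϖ z y) γ' γ = 0 := if_neg fun h => hγ' h.1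
    have h5 : MvPowerSeries.coeff γ' (S.jetMonomial (jetOfChar (recChar S ϖ z y)) γ) = 0 := by
      by_contra h
      exact hγ' (mem_allIdx_of_coeff_ne_zero hS (supportedInN_charSeries (fun _ h => h.1) _) hγ h)
    rw [h4, h5, mul_zero, zero_mul]

theorem IsModel.gammaStar_recentering (hP : IsModel S ξ c K P) (hϖ : IsRecentering S P ϖ)
    (hS : S.Standing) (hξ : ∀ l, ContDiff ℝ ∞ (ξ l)) (hc : S.Admissible c)
    (hK : LocallyIntegrable K) (hKc : HasCompactSupport K) (x y : Fin d → ℝ)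
    {β : MIdx d L} (hβ : β ∈ S.populated) (z : Fin d → ℝ) :
    P β x z = ∑ᶠ γ, S.gammaStar (recChar S ϖ x y) β γ * P γ y z := by
  have h := congrArg (MvPowerSeries.coeff β) (hP.recentering hϖ hS hξ hc hK hKc x y z)
  rw [S.coeff_jetSubst (jetAdm_recChar hS _)] at h
  refine h.symm.trans (finsum_congr fun γ => ?_)
  rw [coeff_modelSeries]
  by_cases h0 : P γ y z = 0
  · rw [h0, zero_mul, mul_zero]
  · rw [S.gammaStar_eq hS _ (Or.inl hβ) (Or.inl (hP.mem_populated h0)), mul_comm]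

theorem IsModel.localBound (hP : IsModel S ξ c K P) (hS : S.Standing) {β : MIdx d L}
    (hβ : β ∈ S.populated) : S.LocalBound (S.hom β + S.eta) (P β) := by
  rcases hβ with ⟨n, rfl⟩ | hβ
  · rw [S.hom_ePoly, hP.poly, shiftCoef_biDisp, sub_add_cancel]
    have h := Setting.localBound_shiftCoef hS 0 n
    rwa [S.deg_zero, sub_zero] at h
  · have h := hP.localBound_multiDeriv hS hβ 0
    simp only [multiDeriv_index_zero ((hP.smooth β).right _)] at h
    rwa [S.deg_zero, sub_zero] at h

end Composition

end MultiIndexModel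

end

theorem mainTheorem1 {d : ℕ} (hd : 0 < d) {L : Type*} [Fintype L] (S : Setting d L)
    (hS : S.Standing) (ξ : L → (Fin d → ℝ) → ℝ) (hξ : ∀ l, ContDiff ℝ ∞ (ξ l))
    (K : (Fin d → ℝ) → ℝ) (hK : S.IsKernel K)
    (c : MIdx d L → ℝ) (hc : S.Admissible c) :
    -- the sums in the definition of the maps `Γ^*` are componentwise finite
    S.FiniteRows S.setMminus ∧ S.FiniteRows S.setMplus ∧
    ∃ (P Pm : (Fin d → ℝ) → MIdx d L → (Fin d → ℝ) → ℝ)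
      (Γ : (Fin d → ℝ) → (Fin d → ℝ) → MIdx d L → MIdx d L → ℝ),
      -- `Π_x` is smooth with values in the populated sector
      (∀ x β, ContDiff ℝ ∞ (P x β)) ∧
      (∀ x β, β ∉ S.populated → P x β = 0) ∧
      -- `Γ_xy` belongs to the structure group
      (∀ x y, Γ x y ∈ S.structureGroup) ∧
      -- the polynomial components
      (∀ x n y, P x (ePoly L n) y = ∏ i, (y i - x i) ^ n i) ∧
      -- the renormalized model equations
      (∀ x, ∀ β ∈ S.setNminus, ContDiff ℝ ∞ (Pm x β)) ∧
      (∀ x, ∀ β ∈ S.setNminus, ∀ y, Pm x β y = S.modelMinus ξ c (P x) x β y) ∧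
      (∀ x, ∀ β ∈ S.setN,
        MeasureTheory.ConvolutionExists K (Pm x β) (ContinuousLinearMap.mul ℝ ℝ)
          MeasureTheory.volume ∧
        ∃ q : MvPolynomial (Fin d) ℝ,
          (∀ n ∈ q.support, S.deg n < S.hom β + S.eta) ∧
          ∀ y, P x β y = conv K (Pm x β) y + MvPolynomial.eval y q) ∧
      -- recentering and composition
      (∀ x y, ∀ β ∈ S.populated, ∀ z, P x β z = ∑ᶠ γ, Γ x y β γ * P y γ z) ∧
      (∀ x y z, ∀ β ∈ S.allIdx, ∀ γ ∈ S.allIdx,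
        Γ x y β γ = ∑ᶠ γ', Γ x z β γ' * Γ z y γ' γ) ∧
      -- the homogeneity bounds
      (∀ β ∈ S.setNminus, S.LocalBound (S.hom β) fun x y => Pm x β y) ∧
      (∀ β ∈ S.populated, S.LocalBound (S.hom β + S.eta) fun x y => P x β y) ∧
      (∀ β ∈ S.allIdx, ∀ γ ∈ S.allIdx,
        S.LocalBound (S.hom β - S.hom γ) fun x y => Γ x y β γ) := by
  have hKi := (hS.integrable_kernel hd hK).locallyIntegrable
  have hKc := hS.hasCompactSupport_kernel hK
  obtain ⟨P, hP⟩ := exists_isModel (ξ := ξ) hS hξ hc hKi hKc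
  obtain ⟨ϖ, hϖ⟩ := exists_isRecentering hP hS
  have hsm : ∀ β ∈ S.setNminus, JointSmooth (minus S ξ c P β) := fun β hβ =>
    jointSmooth_minus hS hξ hc hP.smooth (Or.inr hβ)
  refine ⟨S.finiteRows hS zero_notMem_setMminus (finite_setMminus hS),
    S.finiteRows hS zero_notMem_setMplus (finite_setMplus hS), fun x β => P β x,
    fun x β => minus S ξ c P β x, fun x y => S.gammaStar (recChar S ϖ x y),
    fun x β => (hP.smooth β).right x, fun x β h => congrFun (hP.eq_zero β h) x,
    fun x y => ⟨_, rfl⟩, fun x n y => ?_, fun x β hβ => (hsm β hβ).right x,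
    fun x β _ y => rfl, fun x β hβ => ⟨?_, ?_⟩, fun x y β hβ z => ?_,
    fun x y z β hβ γ hγ => ?_, fun β hβ => ?_, fun β hβ => hP.localBound hS hβ,
    fun β hβ γ hγ => ?_⟩
  · exact (hP.ePoly_apply n x y).trans (shiftCoef_zero_left _ n)
  · exact convolutionExists_of_continuous hKi hKc ((hsm β hβ.1).right x).continuous
  · obtain ⟨q, hq, h⟩ := exists_mvPolynomial (hP.remainder β hβ x)
    refine ⟨q, hq, fun y => ?_⟩
    rw [← h, Pi.sub_apply, add_sub_cancel]
  · exact hP.gammaStar_recentering hϖ hS hξ hc hKi hKc x y hβ z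
  · exact hP.gammaStar_comp hϖ hS hξ hc hKi hKc x y z hβ hγ
  · exact localBound_minus hS hξ hc (fun β hβ n => hP.localBound_multiDeriv hS hβ n) (Or.inr hβ)
  · have h := localBound_recJet hS hϖ.bound β γ
    have e : (fun x y => S.gammaStar (recChar S ϖ x y) β γ) =
        MvPowerSeries.coeff β (S.jetMonomial (recJet S ϖ) γ) := by
      funext x y
      rw [S.gammaStar_eq hS _ hβ hγ, coeff_jetMonomial_recJet]
    rw [e]
    exact h
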